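/- Let $d\ge 1$, $s\in(0,1/2)$, $t\in(2s,2]$, $\sigma>0$. Let $\Omega,\Lambda\subset\mathbb R^d$ be bounded open sets with Lipschitz boundary, $\overline\Omega\subset\Lambda$, and write $Q_\Omega=(\mathbb R^d\times\mathbb R^d)\setminus(\Omega^c\times\Omega^c)$. **Continuous problem.** Let $g\in L^\infty(\mathbb R^d)$ have compact support contained in $\Lambda$. Let $\mathbb V^g$ be the set of $v:\mathbb R^d\to\mathbb R$ with $v|_\Omega\in W^{2s}_1(\Omega)$, $v=g$ a.e. in $\Omega^c$ and $\iint_{Q_\Omega}\frac{|v(x)-v(y)|}{|x-y|^{d+2s}}\,dx\,dy<\infty$. Put $G_s(\rho)=\int_0^\rho(1+r^2)^{-(d+1+2s)/2}dr$, $\widetilde G_s(\rho)=\int_0^1(1+\rho^2r^2)^{-(d+1+2s)/2}dr$, and $$a_u(w,v)=\iint_{Q_\Omega}\widetilde G_s\Big(\tfrac{u(x)-u(y)}{|x-y|}\Big)\frac{(w(x)-w(y))(v(x)-v(y))}{|x-y|^{d+1+2s}}\,dx\,dy .$$ Let $u\in\mathbb V^g$ satisfy $a_u(u,v)=0$ for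 all $v\in\mathbb V^0$. **Discrete problem.** Let $\mathcal T_h$ be a conforming mesh of $\overline\Lambda$ by closed simplices that exactly meshes $\overline\Omega$, with $h=\max_T h_T$, $h_T=\operatorname{diam}T$. Suppose it is shape-regular with parameter $\sigma$: $h_T\le\sigma\rho_T$ for all $T\in\mathcal T_h$, where $\rho_T$ is the diameter of the largest ball contained in $T$; if $d=1$ (where this condition is void), suppose also $h_T\le\sigma h_{T'}$ whenever $T\cap T'\neq\emptyset$. Let $\mathbb V_h$ be the continuous functions on $\overline\Lambda$ that are affine on each $T$, extended by zero to $\mathbb R^d$. For each vertex $\mathtt x_i$ let $\varphi_i$ be its piecewise linear Lagrange basis function and $S_i=\operatorname{supp}\varphi_i$. Set $\Pi_h^cg=\sum_{\mathtt x_i\in\Omega^c}p_i(\mathtt x_i)\varphi_i$, where $p_i$ is the $L^2$-projection of $g|_{S_i\cap\Omega^c}$ onto the affine functions $\mathcal P_1(S_i\cap\Omega^c)$, and $\mathbb V_h^g=\{v\in\mathbb V_h: v=\Pi_h^cg\text{ on }\Lambda\setminus\Omega\}$. Let $u_h\in\mathbb V_h^g$ satisfy $a_{u_h}(u_h,v_h)=0$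 for all $v_h\in\mathbb V_h^0$. **Geometric error.** With $d_v(x,y)=\frac{v(x)-v(y)}{|x-y|}$, $C_{d,s}=\frac{1-2s}{\alpha_d}$ and $\alpha_d$ the volume of the unit ball of $\mathbb R^d$, set $$e_s(u,u_h)=\Big(C_{d,s}\iint_{Q_\Omega}\big(G_s(d_u(x,y))-G_s(d_{u_h}(x,y))\big)\frac{d_{u-u_h}(x,y)}{|x-y|^{d-1+2s}}\,dx\,dy\Big)^{1/2}.$$ **Claim.** There is a constant $C>0$, depending only on $d,s,t,\Omega,\Lambda,\sigma$, such that for all $g$, $\mathcal T_h$, $u$, $u_h$ as above with $u\in W^t_1(\Lambda)$, the integral defining $e_s(u,u_h)$ converges absolutely and $$e_s(u,u_h)\le C\,h^{t/2-s}\,|u|_{W^t_1(\Lambda)}^{1/2}.$$ Here $|u|_{W^t_1(\Lambda)}$ is the Gagliardo seminorm $\iint_{\Lambda\times\Lambda}\frac{|u(x)-u(y)|}{|x-y|^{d+t}}dx\,dy$ if $t<1$, the $L^1(\Lambda)$-norm of $\nabla u$ if $t=1$, the Gagliardo seminorm of order $t-1$ of $\nabla u$ if $1<t<2$, and the $L^1(\Lambda)$-norm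 of $D^2u$ if $t=2$, derivatives being weak derivatives. -/

import Mathlib

open MeasureTheory Set
open scoped ENNReal

namespace NonlocalMinimalGraph

noncomputable section

/-- The Euclidean space `ℝ^d`. -/
abbrev Rd (d : ℕ) : Type := EuclideanSpace ℝ (Fin d)

/-! ### Domains -/

/-- The boundary of `Ω` is locally the graph of a Lipschitz function, with `Ω` on one side of it:
near each boundary point there are a unit vector `e` and a Lipschitz function `ψ` (used only on the
hyperplane orthogonal to `e`) such that `Ω` is given by `x_e < ψ(x - x_e e)`, `x_e = ⟨e, x⟩`. -/
def HasLipschitzBoundary {d : ℕ} (Ω : Set (Rd d)) : Prop :=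
  ∀ x₀ ∈ frontier Ω, ∃ U : Set (Rd d), IsOpen U ∧ x₀ ∈ U ∧
    ∃ (e : Rd d) (ψ : Rd d → ℝ) (L : NNReal), ‖e‖ = 1 ∧ LipschitzWith L ψ ∧
      ∀ x ∈ U, (x ∈ Ω ↔ inner ℝ e x < ψ (x - (inner ℝ e x : ℝ) • e))

/-- Bounded open sets with Lipschitz boundary; connectedness is not asked for. -/
structure IsBoundedLipschitzDomain {d : ℕ} (Ω : Set (Rd d)) : Prop where
  isOpen : IsOpen Ω
  isBounded : Bornology.IsBounded Ω
  lipschitz : HasLipschitzBoundary Ω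

/-- `Q_Ω = (ℝ^d × ℝ^d) \ (Ω^c × Ω^c)`. -/
def QSet {d : ℕ} (Ω : Set (Rd d)) : Set (Rd d × Rd d) := (Ωᶜ ×ˢ Ωᶜ)ᶜ

/-! ### Sobolev spaces `W^t_1`, `0 < t ≤ 2` -/

/-- `f'` is the weak (Fréchet) derivative of `f` in the open set `U`. -/
structure IsWeakFDeriv {d : ℕ} {F : Type} [NormedAddCommGroup F] [NormedSpace ℝ F]
    (U : Set (Rd d)) (f : Rd d → F) (f' : Rd d → (Rd d →L[ℝ] F)) : Prop where
  locInt : LocallyIntegrableOn f U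
  locInt_deriv : LocallyIntegrableOn f' U
  integral_eq : ∀ φ : Rd d → ℝ, ContDiff ℝ ((⊤ : ℕ∞) : WithTop ℕ∞) φ → HasCompactSupport φ →
    tsupport φ ⊆ U → ∀ v : Rd d,
      ∫ x in U, (fderiv ℝ φ x v) • f x = - ∫ x in U, φ x • f' x v

/-- The Gagliardo seminorm of order `r ∈ (0,1)` and exponent `1` over `U`. -/
def gagliardo {d : ℕ} {F : Type} [NormedAddCommGroup F]
    (U : Set (Rd d)) (r : ℝ) (f : Rd d → F) : ℝ≥0∞ :=
  ∫⁻ p in U ×ˢ U, ENNReal.ofReal (‖f p.1 - f p.2‖ / ‖p.1 - p.2‖ ^ ((d : ℝ) + r))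

/-- The seminorm `|u|_{W^t_1(U)}` for `0 < t ≤ 2`, in the four cases `t < 1`, `t = 1`, `1 < t < 2`
and `t = 2`. Weak derivatives are unique up to null sets, so each infimum runs over at most one
value; it is `∞` if the weak derivative does not exist. -/
def sobolevSeminorm {d : ℕ} (U : Set (Rd d)) (t : ℝ) (u : Rd d → ℝ) : ℝ≥0∞ :=
  if t < 1 then gagliardo U t u
  else if t = 1 then
    ⨅ (u' : Rd d → (Rd d →L[ℝ] ℝ)) (_ : IsWeakFDeriv U u u'), ∫⁻ x in U, ‖u' x‖ₑ
  else if t < 2 then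
    ⨅ (u' : Rd d → (Rd d →L[ℝ] ℝ)) (_ : IsWeakFDeriv U u u'), gagliardo U (t - 1) u'
  else
    ⨅ (u' : Rd d → (Rd d →L[ℝ] ℝ)) (_ : IsWeakFDeriv U u u')
      (u'' : Rd d → (Rd d →L[ℝ] (Rd d →L[ℝ] ℝ))) (_ : IsWeakFDeriv U u' u''),
        ∫⁻ x in U, ‖u'' x‖ₑ

/-- `u ∈ W^t_1(U)`, for `0 < t ≤ 2`. -/
structure MemSobolev {d : ℕ} (U : Set (Rd d)) (t : ℝ) (u : Rd d → ℝ) : Prop where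
  integrable : IntegrableOn u U
  integrable_deriv : 1 < t →
    ∃ u' : Rd d → (Rd d →L[ℝ] ℝ), IsWeakFDeriv U u u' ∧ IntegrableOn u' U
  seminorm_lt_top : sobolevSeminorm U t u < ∞

/-! ### The continuous problem -/

/-- `|v|_{𝕍^g} = ∬_{Q_Ω} |v(x) - v(y)| / |x - y|^{d+2s} dx dy`. -/
def energySeminorm {d : ℕ} (s : ℝ) (Ω : Set (Rd d)) (v : Rd d → ℝ) : ℝ≥0∞ :=
  ∫⁻ p in QSet Ω, ENNReal.ofReal (|v p.1 - v p.2| / ‖p.1 - p.2‖ ^ ((d : ℝ) + 2 * s))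

/-- `v ∈ 𝕍^g`; equality in `Ω^c` is understood almost everywhere. -/
structure MemV {d : ℕ} (s : ℝ) (Ω : Set (Rd d)) (g v : Rd d → ℝ) : Prop where
  memSobolev : MemSobolev Ω (2 * s) v
  eq_exterior : v =ᵐ[volume.restrict Ωᶜ] g
  seminorm_lt_top : energySeminorm s Ω v < ∞

/-- `G_s(ρ) = ∫_0^ρ (1 + r²)^{-(d+1+2s)/2} dr`. -/
def Gs (d : ℕ) (s ρ : ℝ) : ℝ :=
  ∫ r in (0 : ℝ)..ρ, (1 + r ^ 2) ^ (-((d : ℝ) + 1 + 2 * s) / 2)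

/-- `G̃_s(ρ) = ∫_0^1 (1 + ρ² r²)^{-(d+1+2s)/2} dr`. -/
def GsTilde (d : ℕ) (s ρ : ℝ) : ℝ :=
  ∫ r in (0 : ℝ)..1, (1 + ρ ^ 2 * r ^ 2) ^ (-((d : ℝ) + 1 + 2 * s) / 2)

/-- The difference quotient `d_v(x, y)`. -/
def diffQuot {d : ℕ} (v : Rd d → ℝ) (x y : Rd d) : ℝ := (v x - v y) / ‖x - y‖

/-- The form `a_u(w, v)`. -/
def aForm {d : ℕ} (s : ℝ) (Ω : Set (Rd d)) (u w v : Rd d → ℝ) : ℝ :=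
  ∫ p in QSet Ω, GsTilde d s (diffQuot u p.1 p.2) *
    ((w p.1 - w p.2) * (v p.1 - v p.2) / ‖p.1 - p.2‖ ^ ((d : ℝ) + 1 + 2 * s))

/-- `u ∈ 𝕍^g` and `a_u(u, v) = 0` for all `v ∈ 𝕍^0`. -/
def IsWeakSolution {d : ℕ} (s : ℝ) (Ω : Set (Rd d)) (g u : Rd d → ℝ) : Prop :=
  MemV s Ω g u ∧ ∀ v : Rd d → ℝ, MemV s Ω 0 v → aForm s Ω u u v = 0

/-! ### Meshes -/

/-- The elements of a simplicial complex: its `d`-dimensional simplices, given by their `d + 1`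
vertices. -/
def cells {d : ℕ} (K : Geometry.SimplicialComplex ℝ (Rd d)) : Set (Finset (Rd d)) :=
  {T | T ∈ K.faces ∧ T.card = d + 1}

/-- The closed simplex with vertex set `T`. -/
def simplex {d : ℕ} (T : Finset (Rd d)) : Set (Rd d) := convexHull ℝ (T : Set (Rd d))

/-- A conforming simplicial mesh of `Λ` which exactly meshes `Ω`. Conformity is part of
`Geometry.SimplicialComplex`. -/
structure IsMesh {d : ℕ} (Ω Λ : Set (Rd d)) (K : Geometry.SimplicialComplex ℝ (Rd d)) : Prop where
  finite : K.faces.Finite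
  pure : ∀ S ∈ K.faces, ∃ T ∈ cells K, S ⊆ T
  covers : ⋃ T ∈ cells K, simplex T = closure Λ
  resolves : ⋃ T ∈ {T ∈ cells K | simplex T ⊆ closure Ω}, simplex T = closure Ω

/-- `h = max_T h_T`, with `h_T = diam T`. -/
def meshSize {d : ℕ} (K : Geometry.SimplicialComplex ℝ (Rd d)) : ℝ :=
  sSup ((fun T => Metric.diam (simplex T)) '' cells K)

/-- `ρ_T`, the diameter of the largest ball contained in `T`. -/
def ballDiam {d : ℕ} (T : Finset (Rd d)) : ℝ :=
  sSup {ρ : ℝ | ∃ (c : Rd d) (r : ℝ), 0 ≤ r ∧ ρ = 2 * r ∧ Metric.closedBall c r ⊆ simplex T}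

/-- Shape regularity with parameter `σ`. In dimension `d ≥ 2` this says `h_T ≤ σ ρ_T` for every
element `T`. In dimension one that condition is void (`h_T = ρ_T` for every interval), and shape
regularity is understood as comparability of the lengths of neighbouring elements. -/
structure IsShapeRegular {d : ℕ} (σ : ℝ) (K : Geometry.SimplicialComplex ℝ (Rd d)) : Prop where
  diam_le : ∀ T ∈ cells K, Metric.diam (simplex T) ≤ σ * ballDiam T
  neighbours : d = 1 → ∀ T ∈ cells K, ∀ T' ∈ cells K, (simplex T ∩ simplex T').Nonempty →
    Metric.diam (simplex T) ≤ σ * Metric.diam (simplex T')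

/-! ### Finite element spaces -/

/-- The star `S_z` of a vertex `z`: the union of the elements that have `z` as a vertex, that is,
the support of the basis function `hat K z`. -/
def vertexStar {d : ℕ} (K : Geometry.SimplicialComplex ℝ (Rd d)) (z : Rd d) : Set (Rd d) :=
  ⋃ T ∈ {T ∈ cells K | z ∈ T}, simplex T

open Classical in
/-- The barycentric coordinate of `x` with respect to the vertex `z` of an affinely independent
finite set `T` (junk value `0` if `x` is not in the affine span of `T`). -/
def baryCoord {d : ℕ} (T : Finset (Rd d)) (z x : Rd d) : ℝ :=
  if h : ∃ w : Rd d → ℝ, (∀ y ∉ T, w y = 0) ∧ ∑ y ∈ T, w y = 1 ∧ ∑ y ∈ T, w y • y = x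
  then h.choose z else 0

open Classical in
/-- The piecewise linear Lagrange basis function of the vertex `z`, extended by zero outside the
mesh. (Its value does not depend on the chosen element, by conformity.) -/
def hat {d : ℕ} (K : Geometry.SimplicialComplex ℝ (Rd d)) (z x : Rd d) : ℝ :=
  if h : ∃ T ∈ cells K, x ∈ simplex T then baryCoord h.choose z x else 0

/-- `p` is the `L²`-projection of `f` onto the space `𝒫₁(S)` of affine functions on `S`. -/
def IsL2ProjP1 {d : ℕ} (S : Set (Rd d)) (f : Rd d → ℝ) (p : Rd d →ᵃ[ℝ] ℝ) : Prop :=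
  ∀ q : Rd d →ᵃ[ℝ] ℝ, ∫ x in S, (f x - p x) * q x = 0

open Classical in
/-- The value at `z` of the `L²`-projection of `f` onto `𝒫₁(S)` (which exists and is unique for
`f` bounded and `S` bounded of positive measure). -/
def projValue {d : ℕ} (S : Set (Rd d)) (f : Rd d → ℝ) (z : Rd d) : ℝ :=
  if h : ∃ p : Rd d →ᵃ[ℝ] ℝ, IsL2ProjP1 S f p then h.choose z else 0

/-- The exterior Clément interpolant `Π_h^c g`, summing over the vertices in `Ω^c`. -/
def exteriorClement {d : ℕ} (Ω : Set (Rd d)) (K : Geometry.SimplicialComplex ℝ (Rd d))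
    (g : Rd d → ℝ) (x : Rd d) : ℝ :=
  ∑ᶠ z ∈ K.vertices ∩ Ωᶜ, projValue (vertexStar K z ∩ Ωᶜ) g z * hat K z x

/-- `v ∈ 𝕍_h`: continuous on (the closure of) `Λ`, affine on each element. Discrete functions are
regarded as functions on `ℝ^d` by extending them by zero. -/
structure MemVh {d : ℕ} (Λ : Set (Rd d)) (K : Geometry.SimplicialComplex ℝ (Rd d))
    (v : Rd d → ℝ) : Prop where
  continuousOn : ContinuousOn v (closure Λ)
  affine : ∀ T ∈ cells K, ∃ a : Rd d →ᵃ[ℝ] ℝ, EqOn v a (simplex T)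
  zero_outside : ∀ x ∉ closure Λ, v x = 0

/-- `v ∈ 𝕍_h^g`. -/
structure MemVhg {d : ℕ} (Ω Λ : Set (Rd d)) (K : Geometry.SimplicialComplex ℝ (Rd d))
    (g v : Rd d → ℝ) : Prop where
  memVh : MemVh Λ K v
  eq_exterior : EqOn v (exteriorClement Ω K g) (Λ \ Ω)

/-- `u_h ∈ 𝕍_h^g` and `a_{u_h}(u_h, v_h) = 0` for all `v_h ∈ 𝕍_h^0`. -/
def IsDiscreteSolution {d : ℕ} (s : ℝ) (Ω Λ : Set (Rd d))
    (K : Geometry.SimplicialComplex ℝ (Rd d)) (g uh : Rd d → ℝ) : Prop :=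
  MemVhg Ω Λ K g uh ∧ ∀ vh : Rd d → ℝ, MemVhg Ω Λ K 0 vh → aForm s Ω uh uh vh = 0

/-! ### The geometric error -/

/-- `C_{d,s} = (1 - 2s) / α_d`, with `α_d` the volume of the unit ball of `ℝ^d`. -/
def Cds (d : ℕ) (s : ℝ) : ℝ := (1 - 2 * s) / (volume (Metric.ball (0 : Rd d) 1)).toReal

/-- The integrand in the definition of `e_s(u, w)²`, without the constant. -/
def errorIntegrand {d : ℕ} (s : ℝ) (u w : Rd d → ℝ) (p : Rd d × Rd d) : ℝ :=
  (Gs d s (diffQuot u p.1 p.2) - Gs d s (diffQuot w p.1 p.2)) *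
    (diffQuot (u - w) p.1 p.2 / ‖p.1 - p.2‖ ^ ((d : ℝ) - 1 + 2 * s))

/-- The geometric error `e_s(u, w)`. -/
def geomError {d : ℕ} (s : ℝ) (Ω : Set (Rd d)) (u w : Rd d → ℝ) : ℝ :=
  Real.sqrt (Cds d s * ∫ p in QSet Ω, errorIntegrand s u w p)

end

end NonlocalMinimalGraph

open NonlocalMinimalGraph

/-! The function `G_s` is bounded, by `π / 2`. The integrand of the geometric error is therefore
dominated by a constant times `|(u - u_h)(x) - (u - u_h)(y)| / |x - y|^{d+2s}`, so the squared error
is controlled by a linear quantity, the energy seminorm. Write `u - u_h = (u - I) + (I - u_h)` with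
a discrete `I` having the prescribed exterior values. Then `I - u_h` is a test function of both
problems. Since `a_u(u, v)` is the integral of `G_s(d_u)` against the difference quotient of `v`,
the contribution of `I - u_h` vanishes. What remains is at most `π` times the energy seminorm of `u
- I` (`integral_errorIntegrand_le`). If that seminorm is `O(h^{t-2s})`, the square root produces the
rate `h^{t/2-s}`.

For `I` a Clément interpolant is taken: at vertices in `Ω` its nodal values come from the
`L²`-projection of `u` on the star, at the other vertices from the projection of `g` that defines
`Π_h^c g`. As `u = g` a.e. outside `Ω`, both are projections of `u` on a set containing a full
element. Such projections are stable in `L¹`, by the mean value property of affine functions and one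
test of the orthogonality relation.

The energy seminorm of the error is split by the distance of `x` and `y` relative to the local mesh
size, since the mesh need not be quasi-uniform (`exists_energySeminorm_le_sum`). If the points are
far apart at the scale of every element containing one of them, the integrated kernel contributes
`h_T^{-2s}` and the `L¹` error on elements suffices. Otherwise the whole segment between them lies
in the open star of one vertex. There `u` is compared with an affine function adapted to `u`
(`exists_isStarApprox`) and the interpolant is Lipschitz.

The remaining work is to make constants uniform over all shape regular meshes
(`exists_starRegular`). A star need not be convex or star-shaped, in particular at the boundary of
`Λ`. The cone property of `Λ` provides instead a ball in the star, the hub, which is joined by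
segments inside the open star to a small copy, shrunk towards the vertex, of each of its elements.
Poincaré inequalities on stars follow by chaining element, shrunk element and hub. Comparability of
the elements at a vertex is obtained for `d ≥ 2` by passing through elements with a common edge: by
the cone property, removing the vertex does not disconnect its star. -/

namespace NonlocalMinimalGraph

noncomputable section

/-! ### Mollification of weakly differentiable functions -/

section Mollify

variable {d : ℕ} {F : Type} [NormedAddCommGroup F] [NormedSpace ℝ F]

/-- The convolution of `v` with the normalized bump function `φ`. -/
def mollify (φ : ContDiffBump (0 : Rd d)) (v : Rd d → F) : Rd d → F :=
  convolution (φ.normed volume) v (ContinuousLinearMap.lsmul ℝ ℝ) volume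

theorem mollify_apply (φ : ContDiffBump (0 : Rd d)) (v : Rd d → F) (x : Rd d) :
    mollify φ v x = ∫ t, φ.normed volume t • v (x - t) := by
  simp [mollify, convolution_def]

theorem mollify_apply' (φ : ContDiffBump (0 : Rd d)) (v : Rd d → F) (x : Rd d) :
    mollify φ v x = ∫ t, φ.normed volume (x - t) • v t := by
  rw [mollify_apply, ← integral_sub_left_eq_self _ volume x]
  simp

theorem contDiff_mollify (φ : ContDiffBump (0 : Rd d)) {v : Rd d → F}
    (hv : LocallyIntegrable v) : ContDiff ℝ 1 (mollify φ v) := by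
  have := φ.hasCompactSupport_normed (μ := volume).contDiff_convolution_left (n := 1)
    (ContinuousLinearMap.lsmul ℝ ℝ) (φ.contDiff_normed) hv
  exact_mod_cast this

theorem bump_normed_eq_zero (φ : ContDiffBump (0 : Rd d)) {x t : Rd d}
    (ht : t ∉ Metric.closedBall x φ.rOut) : φ.normed volume (x - t) = 0 := by
  have h : x - t ∉ tsupport (φ.normed volume) := by
    rw [φ.tsupport_normed_eq]
    simpa [dist_eq_norm, norm_sub_rev] using ht
  exact image_eq_zero_of_notMem_tsupport h

theorem tsupport_bump_sub (φ : ContDiffBump (0 : Rd d)) (x : Rd d) :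
    tsupport (fun t => φ.normed volume (x - t)) ⊆ Metric.closedBall x φ.rOut := by
  refine closure_minimal (fun t ht => ?_) Metric.isClosed_closedBall
  by_contra h
  exact ht (bump_normed_eq_zero φ h)

/-- The derivative of the convolution falls on the bump, and `t ↦ φ(x - t)` is an admissible test
function, so the definition of the weak derivative moves it onto `v`. Truncating to the compact set
`K` makes the data integrable on the whole space; the ball condition ensures that the truncation is
not felt at `x`. -/
theorem hasFDerivAt_mollify [CompleteSpace F] {U K : Set (Rd d)} {v : Rd d → F}
    {v' : Rd d → (Rd d →L[ℝ] F)} (hv : IsWeakFDeriv U v v') (hK : IsCompact K) (hKU : K ⊆ U)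
    (φ : ContDiffBump (0 : Rd d)) {x : Rd d} (hx : Metric.closedBall x φ.rOut ⊆ K) :
    HasFDerivAt (mollify φ (K.indicator v)) (mollify φ (K.indicator v') x) x := by
  have hvK : LocallyIntegrable (K.indicator v) :=
    ((hv.locInt.mono_set hKU).integrableOn_isCompact hK |>.integrable_indicator
      hK.measurableSet).locallyIntegrable
  have hvK' : IntegrableOn v' K := (hv.locInt_deriv.mono_set hKU).integrableOn_isCompact hK
  have h1 := φ.hasCompactSupport_normed (μ := volume).hasFDerivAt_convolution_left
    (ContinuousLinearMap.lsmul ℝ ℝ) φ.contDiff_normed hvK x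
  refine h1.congr_fderiv ?_
  set ψ : Rd d → ℝ := fun t => φ.normed volume (x - t) with hψ
  have hψs : ContDiff ℝ ((⊤ : ℕ∞) : WithTop ℕ∞) ψ :=
    φ.contDiff_normed.comp (contDiff_const.sub contDiff_id)
  have hψc : HasCompactSupport ψ :=
    HasCompactSupport.intro (isCompact_closedBall x φ.rOut) fun t ht => bump_normed_eq_zero φ ht
  have hψt : tsupport ψ ⊆ K := (tsupport_bump_sub φ x).trans hx
  have hderiv : ∀ t y, fderiv ℝ ψ t y = - fderiv ℝ (φ.normed volume) (x - t) y := by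
    intro t y
    have h2 : HasFDerivAt (φ.normed volume) (fderiv ℝ (φ.normed volume) (x - t)) (x - t) :=
      ((φ.contDiff_normed (n := 1)).differentiable one_ne_zero _).hasFDerivAt
    have h3 : HasFDerivAt (fun t : Rd d => x - t) (-(ContinuousLinearMap.id ℝ (Rd d))) t :=
      (hasFDerivAt_id t).const_sub x
    rw [show ψ = (φ.normed volume) ∘ (fun t : Rd d => x - t) from rfl, (h2.comp t h3).fderiv]
    simp
  ext y
  have key := hv.integral_eq ψ hψs hψc (hψt.trans hKU) y
  have hcont : Continuous ψ := hψs.continuous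
  have hz : ∀ t, t ∉ K → ψ t = 0 := fun t ht =>
    image_eq_zero_of_notMem_tsupport fun h => ht (hψt h)
  have hz' : ∀ t, t ∉ K → fderiv ℝ ψ t = 0 := fun t ht =>
    image_eq_zero_of_notMem_tsupport fun h => ht (hψt (tsupport_fderiv_subset ℝ h))
  have e1 : ∫ t in U, (fderiv ℝ ψ t y) • v t = ∫ t, (fderiv ℝ ψ t y) • K.indicator v t := by
    rw [setIntegral_eq_integral_of_forall_compl_eq_zero]
    · refine integral_congr_ae (ae_of_all _ fun t => ?_)
      by_cases ht : t ∈ K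
      · simp [ht]
      · simp [hz' t ht]
    · intro t ht
      simp [hz' t fun h => ht (hKU h)]
  have e2 : ∫ t in U, ψ t • v' t y = (mollify φ (K.indicator v') x) y := by
    rw [setIntegral_eq_integral_of_forall_compl_eq_zero, mollify_apply',
      ContinuousLinearMap.integral_apply]
    · refine integral_congr_ae (ae_of_all _ fun t => ?_)
      by_cases ht : t ∈ K
      · simp [ht, ψ]
      · simp [ht, hz t ht]
    · have h4 : Integrable (fun t => ψ t • K.indicator v' t) := by
        have hKm : MeasurableSet K := hK.measurableSet
        have := IntegrableOn.integrable_indicator (μ := volume) (f := v') hvK' hKm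
        obtain ⟨C, hC⟩ := hψc.exists_bound_of_continuous hcont
        exact this.bdd_smul C hcont.aestronglyMeasurable (ae_of_all _ hC)
      exact h4
    · intro t ht
      simp [hz t fun h => ht (hKU h)]
  rw [← e2, ← neg_eq_iff_eq_neg.mpr key, e1]
  have hfd : HasCompactSupport (fderiv ℝ (φ.normed volume)) :=
    φ.hasCompactSupport_normed.fderiv ℝ
  have hfc : Continuous (fderiv ℝ (φ.normed volume)) :=
    (φ.contDiff_normed (n := 1)).continuous_fderiv one_ne_zero
  have hconv := hfd.convolutionExists_left
    (ContinuousLinearMap.precompL (Rd d) (ContinuousLinearMap.lsmul ℝ ℝ (E := F))) hfc hvK x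
  rw [convolution_def, ContinuousLinearMap.integral_apply hconv,
    ← integral_sub_left_eq_self _ volume x, ← integral_neg]
  refine integral_congr_ae (ae_of_all _ fun t => ?_)
  simp [hderiv, ContinuousLinearMap.precompL_apply]

theorem mollify_sub_const_enorm_le {K : Set (Rd d)} {w : Rd d → F} (hw : IntegrableOn w K)
    (hK : MeasurableSet K) [CompleteSpace F]
    (A : F) (φ : ContDiffBump (0 : Rd d)) {x : Rd d} (hx : Metric.closedBall x φ.rOut ⊆ K) :
    ‖mollify φ (K.indicator w) x - A‖ₑ ≤
      ∫⁻ t, ‖φ.normed volume t‖ₑ * K.indicator (fun z => ‖w z - A‖ₑ) (x - t) := by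
  have h1 : A = ∫ t, φ.normed volume t • A := by
    rw [integral_smul_const, φ.integral_normed, one_smul]
  have hb : ∃ C, ∀ t, ‖φ.normed volume t‖ ≤ C :=
    φ.hasCompactSupport_normed.exists_bound_of_continuous φ.continuous_normed
  obtain ⟨C, hC⟩ := hb
  have i1 : Integrable (fun t => φ.normed volume t • K.indicator w (x - t)) :=
    ((hw.integrable_indicator hK).comp_sub_left x).bdd_smul C
      φ.continuous_normed.aestronglyMeasurable (ae_of_all _ hC)
  have i2 : Integrable (fun t => φ.normed volume t • A) := φ.integrable_normed.smul_const A
  rw [mollify_apply]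
  nth_rewrite 1 [h1]
  rw [← integral_sub i1 i2]
  refine (enorm_integral_le_lintegral_enorm _).trans (lintegral_mono fun t => ?_)
  by_cases ht : t ∈ Metric.closedBall 0 φ.rOut
  · have : x - t ∈ K := hx (by simpa [dist_eq_norm] using ht)
    simp [this, ← smul_sub, enorm_smul]
  · have : φ.normed volume t = 0 := by
      have := bump_normed_eq_zero φ (x := 0) (t := -t) (by simpa using ht)
      simpa using this
    simp [this]

/-- Averaging against a probability density does not increase an `L¹` norm: Tonelli and translation
invariance. -/
theorem lintegral_mollify_sub_const_le {S K : Set (Rd d)} {w : Rd d → F} (hw : IntegrableOn w K)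
    (hK : MeasurableSet K) [CompleteSpace F]
    (A : F) (φ : ContDiffBump (0 : Rd d)) (hS : MeasurableSet S)
    (hx : ∀ x ∈ S, Metric.closedBall x φ.rOut ⊆ K) :
    ∫⁻ x in S, ‖mollify φ (K.indicator w) x - A‖ₑ ≤ ∫⁻ x in K, ‖w x - A‖ₑ := by
  have hm : AEMeasurable (K.indicator (fun z => ‖w z - A‖ₑ)) :=
    (aemeasurable_indicator_iff hK).2
      ((hw.aestronglyMeasurable.sub aestronglyMeasurable_const).enorm)
  have hφm : Measurable fun t => ‖φ.normed (volume : Measure (Rd d)) t‖ₑ :=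
    φ.continuous_normed.measurable.enorm
  calc ∫⁻ x in S, ‖mollify φ (K.indicator w) x - A‖ₑ
      ≤ ∫⁻ x in S, ∫⁻ t, ‖φ.normed volume t‖ₑ * K.indicator (fun z => ‖w z - A‖ₑ) (x - t) :=
        setLIntegral_mono' hS fun x h => mollify_sub_const_enorm_le hw hK A φ (hx x h)
    _ ≤ ∫⁻ x, ∫⁻ t, ‖φ.normed volume t‖ₑ * K.indicator (fun z => ‖w z - A‖ₑ) (x - t) :=
        setLIntegral_le_lintegral _ _
    _ = ∫⁻ t, ∫⁻ x, ‖φ.normed volume t‖ₑ * K.indicator (fun z => ‖w z - A‖ₑ) (x - t) := by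
        refine lintegral_lintegral_swap ?_
        refine (hφm.comp measurable_snd).aemeasurable.mul ?_
        exact hm.comp_quasiMeasurePreserving (quasiMeasurePreserving_sub volume volume)
    _ = ∫⁻ t, ‖φ.normed volume t‖ₑ * ∫⁻ x in K, ‖w x - A‖ₑ := by
        refine lintegral_congr fun t => ?_
        rw [lintegral_const_mul' _ _ enorm_ne_top,
          lintegral_sub_right_eq_self (fun x => K.indicator (fun z => ‖w z - A‖ₑ) x) t,
          lintegral_indicator hK]
    _ = (∫⁻ t, ‖φ.normed volume t‖ₑ) * ∫⁻ x in K, ‖w x - A‖ₑ := lintegral_mul_const _ hφm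
    _ = ∫⁻ x in K, ‖w x - A‖ₑ := by
        have : ∫⁻ t, ‖φ.normed (volume : Measure (Rd d)) t‖ₑ = 1 := by
          have h1 := ofReal_integral_eq_lintegral_ofReal (μ := volume) φ.integrable_normed
            (ae_of_all _ φ.nonneg_normed)
          rw [φ.integral_normed, ENNReal.ofReal_one] at h1
          rw [h1]
          exact lintegral_congr fun t => (Real.enorm_of_nonneg (φ.nonneg_normed t))
        rw [this, one_mul]

theorem isClosed_setOf_segment_subset {S : Set (Rd d)} (hS : IsClosed S) :
    IsClosed {p : Rd d × Rd d | segment ℝ p.1 p.2 ⊆ S} := by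
  have : {p : Rd d × Rd d | segment ℝ p.1 p.2 ⊆ S} =
      ⋂ τ ∈ Icc (0 : ℝ) 1, (fun p : Rd d × Rd d => p.1 + τ • (p.2 - p.1)) ⁻¹' S := by
    ext p
    simp only [segment_eq_image', Set.subset_def, mem_ofPred_eq, mem_iInter, mem_preimage, mem_image]
    exact ⟨fun h τ hτ => h _ ⟨τ, hτ, rfl⟩, fun h x ⟨τ, hτ, hx⟩ => hx ▸ h τ hτ⟩
  rw [this]
  exact isClosed_biInter fun τ _ => hS.preimage (by fun_prop)

theorem mem_segment_add_smul {x y : Rd d} {τ : ℝ} (hτ : τ ∈ Icc (0 : ℝ) 1) :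
    x + τ • (y - x) ∈ segment ℝ x y := by
  rw [segment_eq_image']
  exact ⟨τ, hτ, rfl⟩

/-- The fundamental theorem of calculus along the segment, applied to `f - A`. -/
theorem enorm_sub_le_lintegral_segment {f : Rd d → F} {f' : Rd d → (Rd d →L[ℝ] F)}
    (hf : ContDiff ℝ 1 f) (A : Rd d →L[ℝ] F) {x y : Rd d} [CompleteSpace F]
    (hf' : ∀ z ∈ segment ℝ x y, HasFDerivAt f (f' z) z) :
    ‖f x - f y - A (x - y)‖ₑ ≤
      ‖x - y‖ₑ * ∫⁻ τ in Icc (0 : ℝ) 1, ‖f' (x + τ • (y - x)) - A‖ₑ := by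
  set g : ℝ → F := fun τ => f (x + τ • (y - x)) - A (x + τ • (y - x)) with hg
  have hgc : ContDiff ℝ 1 g := by
    have h1 : ContDiff ℝ 1 (fun τ : ℝ => x + τ • (y - x)) := by fun_prop
    exact (hf.comp h1).sub (A.contDiff.comp h1)
  have h1 := enorm_sub_le_lintegral_deriv_of_contDiffOn_Icc (f := g) (a := 0) (b := 1)
    hgc.contDiffOn zero_le_one
  have h2 : ‖f x - f y - A (x - y)‖ₑ = ‖g 1 - g 0‖ₑ := by
    rw [← enorm_neg]
    simp [hg]
    congr 1
    abel
  rw [h2]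
  refine h1.trans ?_
  rw [← lintegral_const_mul' _ _ enorm_ne_top]
  refine setLIntegral_mono' measurableSet_Icc fun τ hτ => ?_
  have h3 : HasDerivAt (fun τ : ℝ => x + τ • (y - x)) (y - x) τ := by
    simpa using ((hasDerivAt_id τ).smul_const (y - x)).const_add x
  have h4 : HasDerivAt g (f' (x + τ • (y - x)) (y - x) - A (y - x)) τ :=
    ((hf' _ (mem_segment_add_smul hτ)).comp_hasDerivAt τ h3).sub
      (A.hasFDerivAt.comp_hasDerivAt τ h3)
  rw [h4.deriv, ← _root_.sub_apply, mul_comm, ← enorm_neg (x - y), neg_sub]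
  exact ContinuousLinearMap.le_opENorm _ _

/-- A transfer principle: a weighted bound `hB` for integrals of arbitrary functions along segments
becomes a Poincaré-type inequality for weakly differentiable functions. The mollified functions
satisfy the pointwise segment inequality, mollification does not increase the `L¹` norm of `v' - A`,
and Fatou's lemma passes to the limit along a.e. convergence. -/
theorem lintegral_segment_le_of_isCompact [CompleteSpace F] {U W S : Set (Rd d)} {v : Rd d → F}
    {v' : Rd d → (Rd d →L[ℝ] F)} (hW : IsOpen W) (hWU : W ⊆ U) (hv : IsWeakFDeriv U v v')
    (hS : IsCompact S) (hSW : S ⊆ W) (A : Rd d →L[ℝ] F)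
    {P : Set (Rd d × Rd d)} (hP : MeasurableSet P)
    (hPS : ∀ p ∈ P, segment ℝ p.1 p.2 ⊆ S) {k : Rd d × Rd d → ℝ≥0∞} (hk : Measurable k)
    (hk' : ∀ p, k p ≠ ∞) {B : ℝ≥0∞}
    (hB : ∀ f : Rd d → ℝ≥0∞, Measurable f → ∫⁻ p in P, k p * (‖p.1 - p.2‖ₑ *
      ∫⁻ τ in Icc (0 : ℝ) 1, f (p.1 + τ • (p.2 - p.1))) ≤ B * ∫⁻ x in W, f x) :
    ∫⁻ p in P, k p * ‖v p.1 - v p.2 - A (p.1 - p.2)‖ₑ ≤ B * ∫⁻ x in W, ‖v' x - A‖ₑ := by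
  obtain ⟨δ, hδ, hδW⟩ := hS.exists_cthickening_subset_open hW hSW
  set K := Metric.cthickening δ S with hK
  have hKc : IsCompact K := hS.cthickening
  have hKm : MeasurableSet K := hKc.measurableSet
  have hKU : K ⊆ U := hδW.trans hWU
  have hvK : IntegrableOn v K := (hv.locInt.mono_set hKU).integrableOn_isCompact hKc
  have hvK' : IntegrableOn v' K := (hv.locInt_deriv.mono_set hKU).integrableOn_isCompact hKc
  have hvl : LocallyIntegrable (K.indicator v) := (hvK.integrable_indicator hKm).locallyIntegrable
  have hvl' : LocallyIntegrable (K.indicator v') :=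
    (IntegrableOn.integrable_indicator (μ := volume) (f := v') hvK' hKm).locallyIntegrable
  let φ : ℕ → ContDiffBump (0 : Rd d) := fun n =>
    ⟨δ / (n + 1) / 2, δ / (n + 1), by positivity, half_lt_self (by positivity)⟩
  have hφ0 : Filter.Tendsto (fun n => (φ n).rOut) Filter.atTop (nhds 0) :=
    by simpa [φ, div_eq_mul_inv] using (tendsto_one_div_add_atTop_nhds_zero_nat (𝕜 := ℝ)).const_mul δ
  have hball : ∀ n, ∀ x ∈ S, Metric.closedBall x (φ n).rOut ⊆ K := by
    intro n x hx
    refine (Metric.closedBall_subset_cthickening hx _).trans (Metric.cthickening_mono ?_ _)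
    exact div_le_self hδ.le (by simp)
  have hlim := ContDiffBump.ae_convolution_tendsto_right_of_locallyIntegrable (φ := φ) (K := 2)
    hφ0 (Filter.Eventually.of_forall fun n => by simp [φ]; linarith) hvl
  have hlim' : ∀ᵐ p : Rd d × Rd d ∂(volume.restrict P),
      k p * ‖v p.1 - v p.2 - A (p.1 - p.2)‖ₑ = Filter.liminf (fun n =>
        k p * ‖mollify (φ n) (K.indicator v) p.1 - mollify (φ n) (K.indicator v) p.2
          - A (p.1 - p.2)‖ₑ) Filter.atTop := by
    have h1 := (Measure.quasiMeasurePreserving_fst (μ := (volume : Measure (Rd d)))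
      (ν := (volume : Measure (Rd d)))).ae hlim
    have h2 := (Measure.quasiMeasurePreserving_snd (μ := (volume : Measure (Rd d)))
      (ν := (volume : Measure (Rd d)))).ae hlim
    filter_upwards [ae_restrict_of_ae h1, ae_restrict_of_ae h2, ae_restrict_mem hP] with p h1 h2 hp
    have hp1 : p.1 ∈ K := Metric.self_subset_cthickening _ (hPS p hp (left_mem_segment ℝ _ _))
    have hp2 : p.2 ∈ K := Metric.self_subset_cthickening _ (hPS p hp (right_mem_segment ℝ _ _))
    rw [indicator_of_mem hp1] at h1
    rw [indicator_of_mem hp2] at h2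
    refine (Filter.Tendsto.liminf_eq ?_).symm
    exact ENNReal.Tendsto.const_mul (((h1.sub h2).sub_const _).enorm) (Or.inr (hk' p))
  rw [lintegral_congr_ae hlim']
  have hcd := fun n => contDiff_mollify (φ n) hvl
  have hcd' := fun n => contDiff_mollify (φ n) hvl'
  refine (lintegral_liminf_le fun n => ?_).trans ?_
  · have := (hcd n).continuous
    refine hk.mul (Continuous.measurable ?_)
    exact continuous_enorm.comp (by fun_prop)
  refine Filter.liminf_le_of_frequently_le' (Filter.Frequently.of_forall fun n => ?_)
  set f : Rd d → ℝ≥0∞ := S.indicator fun x => ‖mollify (φ n) (K.indicator v') x - A‖ₑ with hf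
  have hfm : Measurable f := by
    refine Measurable.indicator ?_ hS.measurableSet
    exact (continuous_enorm.comp ((hcd' n).continuous.sub continuous_const)).measurable
  calc ∫⁻ p in P, k p * ‖mollify (φ n) (K.indicator v) p.1 - mollify (φ n) (K.indicator v) p.2
          - A (p.1 - p.2)‖ₑ
      ≤ ∫⁻ p in P, k p * (‖p.1 - p.2‖ₑ *
          ∫⁻ τ in Icc (0 : ℝ) 1, f (p.1 + τ • (p.2 - p.1))) := by
        refine setLIntegral_mono' hP fun p hp => mul_le_mul_right ?_ _
        refine (enorm_sub_le_lintegral_segment (hcd n) A (fun z hz =>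
          hasFDerivAt_mollify hv hKc hKU (φ n) (hball n z (hPS p hp hz)))).trans_eq ?_
        congr 1
        refine setLIntegral_congr_fun measurableSet_Icc fun τ hτ => ?_
        simp only [hf]
        rw [indicator_of_mem (hPS p hp (mem_segment_add_smul hτ))]
    _ ≤ B * ∫⁻ x in W, f x := hB f hfm
    _ ≤ B * ∫⁻ x in W, ‖v' x - A‖ₑ := by
        refine mul_le_mul_right ?_ _
        calc ∫⁻ x in W, f x ≤ ∫⁻ x, f x := setLIntegral_le_lintegral _ _
          _ = ∫⁻ x in S, ‖mollify (φ n) (K.indicator v') x - A‖ₑ :=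
            lintegral_indicator hS.measurableSet _
          _ ≤ ∫⁻ x in K, ‖v' x - A‖ₑ :=
            lintegral_mollify_sub_const_le hvK' hKm A (φ n) hS.measurableSet (hball n)
          _ ≤ _ := lintegral_mono_set hδW

/-- Exhaustion of the open set `W` by compact sets. Each segment in `W` lies in one of them, so
monotone convergence over the corresponding sets of pairs applies. -/
theorem lintegral_segment_le [CompleteSpace F] {U W : Set (Rd d)} {v : Rd d → F}
    {v' : Rd d → (Rd d →L[ℝ] F)} (hW : IsOpen W) (hWU : W ⊆ U) (hv : IsWeakFDeriv U v v')
    (A : Rd d →L[ℝ] F) {P : Set (Rd d × Rd d)} (hP : MeasurableSet P)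
    (hPW : ∀ p ∈ P, segment ℝ p.1 p.2 ⊆ W) {k : Rd d × Rd d → ℝ≥0∞} (hk : Measurable k)
    (hk' : ∀ p, k p ≠ ∞) {B : ℝ≥0∞}
    (hB : ∀ f : Rd d → ℝ≥0∞, Measurable f → ∫⁻ p in P, k p * (‖p.1 - p.2‖ₑ *
      ∫⁻ τ in Icc (0 : ℝ) 1, f (p.1 + τ • (p.2 - p.1))) ≤ B * ∫⁻ x in W, f x) :
    ∫⁻ p in P, k p * ‖v p.1 - v p.2 - A (p.1 - p.2)‖ₑ ≤ B * ∫⁻ x in W, ‖v' x - A‖ₑ := by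
  set S : ℕ → Set (Rd d) := fun n =>
    (Metric.thickening (1 / ((n : ℝ) + 1)) Wᶜ)ᶜ ∩ Metric.closedBall 0 n with hS
  have hSc : ∀ n, IsCompact (S n) := fun n =>
    (isCompact_closedBall 0 _).inter_left Metric.isOpen_thickening.isClosed_compl
  have hSmono : Monotone S := by
    intro m n hmn
    refine inter_subset_inter (compl_subset_compl.2 (Metric.thickening_mono ?_ _))
      (Metric.closedBall_subset_closedBall (by exact_mod_cast hmn))
    gcongr
  have hSW : ∀ n, S n ⊆ W := by
    intro n x hx
    by_contra h
    exact hx.1 (Metric.self_subset_thickening (by positivity) _ h)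
  set Q : ℕ → Set (Rd d × Rd d) := fun n => P ∩ {p | segment ℝ p.1 p.2 ⊆ S n} with hQ
  have hQm : ∀ n, MeasurableSet (Q n) := fun n =>
    hP.inter (isClosed_setOf_segment_subset (hSc n).isClosed).measurableSet
  have hQmono : Monotone Q := fun m n hmn =>
    inter_subset_inter_right _ fun p (hp : segment ℝ p.1 p.2 ⊆ S m) => hp.trans (hSmono hmn)
  have hQU : P = ⋃ n, Q n := by
    refine subset_antisymm (fun p hp => ?_) (iUnion_subset fun n => inter_subset_left)
    have hc : IsCompact (segment ℝ p.1 p.2) := by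
      rw [segment_eq_image']
      exact isCompact_Icc.image (by fun_prop)
    obtain ⟨δ, hδ, hδW⟩ := hc.exists_cthickening_subset_open hW (hPW p hp)
    obtain ⟨R, hR⟩ := hc.isBounded.subset_closedBall (0 : Rd d)
    obtain ⟨n₁, hn₁⟩ := exists_nat_one_div_lt hδ
    obtain ⟨n₂, hn₂⟩ := exists_nat_ge R
    refine mem_iUnion.2 ⟨max n₁ n₂, hp, fun z hz => ⟨fun h => ?_, ?_⟩⟩
    · obtain ⟨y, hy, hzy⟩ := Metric.mem_thickening_iff.1 h
      refine hy (hδW (Metric.closedBall_subset_cthickening hz δ ?_))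
      rw [Metric.mem_closedBall, dist_comm]
      refine hzy.le.trans (le_trans ?_ hn₁.le)
      gcongr
      exact le_max_left _ _
    · refine Metric.closedBall_subset_closedBall ?_ (hR hz)
      exact hn₂.trans (by exact_mod_cast le_max_right _ _)
  conv_lhs => rw [hQU]
  rw [setLIntegral_iUnion_of_directed _ hQmono.directed_le]
  refine iSup_le fun n => ?_
  refine lintegral_segment_le_of_isCompact hW hWU hv (hSc n) (hSW n) A (hQm n)
    (fun p hp => hp.2) hk hk' fun f hf => ?_
  exact (lintegral_mono_set inter_subset_left).trans (hB f hf)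

end Mollify

/-! ### Kernels and integrals along segments -/

section Kernels

variable {d : ℕ}

/-- The kernel `|w|^{-α}`. -/
def rieszKernel (α : ℝ) (w : Rd d) : ℝ≥0∞ := ENNReal.ofReal (‖w‖ ^ (-α))

theorem measurable_rieszKernel (α : ℝ) : Measurable (rieszKernel (d := d) α) :=
  (measurable_norm.pow_const _).ennreal_ofReal

theorem rieszKernel_ne_top (α : ℝ) (w : Rd d) : rieszKernel α w ≠ ∞ := ENNReal.ofReal_ne_top

theorem ofReal_norm_div_rpow {F : Type} [NormedAddCommGroup F] (α : ℝ) (w : Rd d) (a : F) :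
    ENNReal.ofReal (‖a‖ / ‖w‖ ^ α) = rieszKernel α w * ‖a‖ₑ := by
  rw [rieszKernel, div_eq_mul_inv, ← Real.rpow_neg (norm_nonneg _), mul_comm,
    ENNReal.ofReal_mul (by positivity), ofReal_norm]

theorem rieszKernel_sub_comm (α : ℝ) (x y : Rd d) :
    rieszKernel α (x - y) = rieszKernel α (y - x) := by
  rw [rieszKernel, rieszKernel, norm_sub_rev]

theorem lintegral_comp_smul_add (a : ℝ) (ha : a ≠ 0) (c : Rd d) {f : Rd d → ℝ≥0∞}
    (hf : Measurable f) :
    ∫⁻ x, f (a • x + c) = ENNReal.ofReal |(a ^ d)⁻¹| * ∫⁻ x, f x := by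
  have h1 : ∫⁻ x, f (a • x + c) = ∫⁻ y, f (y + c) ∂(Measure.map (fun x : Rd d => a • x) volume) :=
    (lintegral_map (hf.comp (measurable_add_const c)) (measurable_const_smul a)).symm
  rw [h1, Measure.map_addHaar_smul volume ha, lintegral_smul_measure,
    lintegral_add_right_eq_self (fun x => f x) c]
  simp

/-- Homogeneity of the kernel; it reduces the following two bounds to radius one. -/
theorem lintegral_rieszKernel_scale (α ρ : ℝ) (hρ : 0 < ρ) {s : Set (Rd d)}
    (hs : MeasurableSet s) :
    ∫⁻ w in (fun x => ρ⁻¹ • x) ⁻¹' s, rieszKernel α w =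
      ENNReal.ofReal (ρ ^ ((d : ℝ) - α)) * ∫⁻ w in s, rieszKernel α w := by
  rw [← lintegral_indicator hs, ← lintegral_indicator (measurable_const_smul _ hs)]
  have h1 := lintegral_comp_smul_add (d := d) ρ⁻¹ (inv_ne_zero hρ.ne') 0
    (f := s.indicator (rieszKernel α)) ((measurable_rieszKernel α).indicator hs)
  simp only [add_zero] at h1
  have h2 : ∀ w : Rd d, ((fun x => ρ⁻¹ • x) ⁻¹' s).indicator (rieszKernel α) w =
      ENNReal.ofReal (ρ ^ (-α)) * s.indicator (rieszKernel α) (ρ⁻¹ • w) := by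
    intro w
    by_cases hw : ρ⁻¹ • w ∈ s
    · rw [indicator_of_mem hw, indicator_of_mem (by exact hw), rieszKernel, rieszKernel,
        ← ENNReal.ofReal_mul (by positivity), norm_smul, ← Real.mul_rpow hρ.le (by positivity)]
      congr 2
      rw [Real.norm_of_nonneg (by positivity)]
      field_simp
    · rw [indicator_of_notMem hw, indicator_of_notMem (by exact hw), mul_zero]
  simp_rw [h2]
  rw [lintegral_const_mul' _ _ ENNReal.ofReal_ne_top, h1, ← mul_assoc,
    ← ENNReal.ofReal_mul (by positivity)]
  congr 2
  rw [abs_of_nonneg (by positivity), inv_pow, inv_inv, sub_eq_neg_add, Real.rpow_add hρ,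
    Real.rpow_natCast]

theorem exists_lintegral_rieszKernel_closedBall_le (hd : 1 ≤ d) {α : ℝ} (hα : α < d) :
    ∃ C : ℝ, 0 < C ∧ ∀ ρ : ℝ, 0 < ρ → ∫⁻ w in Metric.closedBall (0 : Rd d) ρ, rieszKernel α w ≤
      ENNReal.ofReal (C * ρ ^ ((d : ℝ) - α)) := by
  have h1 : IntegrableOn (fun w : Rd d => ‖w‖ ^ (-α)) (Metric.ball 0 2) := by
    refine integrableOn_ball_of_norm_le_rpow (C := 1) (α := α) (by simpa using hd)
      (by simpa using hα) (ae_of_all _ fun x => ?_)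
      (measurable_norm.pow_const _).aestronglyMeasurable
    rw [Real.norm_of_nonneg (by positivity), one_mul]
  have h2 : ∫⁻ w in Metric.closedBall (0 : Rd d) 1, rieszKernel α w < ∞ := by
    refine lt_of_le_of_lt (lintegral_mono_set (t := Metric.ball 0 2)
      (Metric.closedBall_subset_ball (by norm_num))) ?_
    exact h1.lintegral_lt_top
  refine ⟨(∫⁻ w in Metric.closedBall (0 : Rd d) 1, rieszKernel α w).toReal + 1, by positivity,
    fun ρ hρ => ?_⟩
  have h3 := lintegral_rieszKernel_scale α ρ hρ (Metric.isClosed_closedBall (x := (0 : Rd d))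
    (ε := 1)).measurableSet
  have h4 : (fun x : Rd d => ρ⁻¹ • x) ⁻¹' (Metric.closedBall 0 1) = Metric.closedBall 0 ρ := by
    ext x
    simp [norm_smul, abs_of_pos hρ, inv_mul_le_iff₀ hρ]
  rw [h4] at h3
  rw [h3, mul_comm (_ + 1), ENNReal.ofReal_mul (by positivity)]
  gcongr
  rw [ENNReal.le_ofReal_iff_toReal_le h2.ne (by positivity)]
  linarith

theorem exists_lintegral_rieszKernel_compl_ball_le {α : ℝ} (hα : d < α) :
    ∃ C : ℝ, 0 < C ∧ ∀ ρ : ℝ, 0 < ρ → ∫⁻ w in (Metric.ball (0 : Rd d) ρ)ᶜ, rieszKernel α w ≤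
      ENNReal.ofReal (C * ρ ^ ((d : ℝ) - α)) := by
  have h1 : Integrable (fun w : Rd d => (2 : ℝ) ^ α * (1 + ‖w‖) ^ (-α)) :=
    (integrable_one_add_norm (by simpa using hα)).const_mul _
  have hα0 : 0 ≤ α := (Nat.cast_nonneg d).trans hα.le
  have h2 : ∫⁻ w in (Metric.ball (0 : Rd d) 1)ᶜ, rieszKernel α w < ∞ := by
    refine lt_of_le_of_lt (setLIntegral_mono' (g := fun w =>
      ENNReal.ofReal ((2 : ℝ) ^ α * (1 + ‖w‖) ^ (-α)))
      Metric.isOpen_ball.measurableSet.compl fun w hw => ?_)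
      (h1.integrableOn.lintegral_lt_top)
    refine ENNReal.ofReal_le_ofReal ?_
    have hw1 : 1 ≤ ‖w‖ := by simpa using hw
    -- Away from the unit ball `‖w‖` and `1 + ‖w‖` are comparable, which gives an integrable
    -- majorant without a singularity.
    have : (1 + ‖w‖) / 2 ≤ ‖w‖ := by linarith
    calc ‖w‖ ^ (-α) ≤ ((1 + ‖w‖) / 2) ^ (-α) :=
          Real.rpow_le_rpow_of_nonpos (by positivity) this (by linarith)
      _ = (2 : ℝ) ^ α * (1 + ‖w‖) ^ (-α) := by
          rw [Real.div_rpow (by positivity) (by positivity), Real.rpow_neg (x := 2) (by positivity)]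
          field_simp
  refine ⟨(∫⁻ w in (Metric.ball (0 : Rd d) 1)ᶜ, rieszKernel α w).toReal + 1, by positivity,
    fun ρ hρ => ?_⟩
  have h3 := lintegral_rieszKernel_scale α ρ hρ (Metric.isOpen_ball (x := (0 : Rd d))
    (ε := 1)).measurableSet.compl
  have h4 : (fun x : Rd d => ρ⁻¹ • x) ⁻¹' (Metric.ball 0 1)ᶜ = (Metric.ball 0 ρ)ᶜ := by
    ext x
    simp [norm_smul, abs_of_pos hρ, le_inv_mul_iff₀ hρ]
  rw [h4] at h3
  rw [h3, mul_comm (_ + 1), ENNReal.ofReal_mul (by positivity)]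
  gcongr
  rw [ENNReal.le_ofReal_iff_toReal_le h2.ne (by positivity)]
  linarith

theorem lintegral_comp_segment_le {a : ℝ} (ha : 1 / 2 ≤ a) (c : Rd d) {f : Rd d → ℝ≥0∞}
    (hf : Measurable f) (X : Set (Rd d)) :
    ∫⁻ x in X, f (a • x + c) ≤ 2 ^ d * ∫⁻ x, f x := by
  refine (setLIntegral_le_lintegral _ _).trans ?_
  rw [lintegral_comp_smul_add a (by linarith) c hf]
  gcongr
  rw [abs_of_nonneg (by positivity), ← inv_pow, ENNReal.ofReal_pow (by positivity)]
  gcongr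
  rw [show (2 : ℝ≥0∞) = ENNReal.ofReal 2 by simp]
  refine ENNReal.ofReal_le_ofReal ?_
  rw [inv_le_comm₀ (by linarith) (by norm_num)]
  linarith

/-- For fixed `τ` one of the weights `1 - τ` and `τ` is at least `1/2`. Integrating first in the
variable carrying that weight costs a Jacobian of at most `2 ^ d`. -/
theorem lintegral_prod_segment_le {X Y W : Set (Rd d)} (hX : MeasurableSet X)
    (hY : MeasurableSet Y) (hW : MeasurableSet W)
    (hseg : ∀ x ∈ X, ∀ y ∈ Y, segment ℝ x y ⊆ W) {f : Rd d → ℝ≥0∞} (hf : Measurable f) :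
    ∫⁻ p in X ×ˢ Y, ∫⁻ τ in Icc (0 : ℝ) 1, f (p.1 + τ • (p.2 - p.1)) ≤
      2 ^ d * (volume X + volume Y) * ∫⁻ x in W, f x := by
  set g := W.indicator f with hg
  have hgm : Measurable g := hf.indicator hW
  have hc : Measurable fun q : (Rd d × Rd d) × ℝ => g (q.1.1 + q.2 • (q.1.2 - q.1.1)) := by
    refine hgm.comp ?_
    exact Continuous.measurable (by fun_prop)
  have e1 : ∫⁻ p in X ×ˢ Y, ∫⁻ τ in Icc (0 : ℝ) 1, f (p.1 + τ • (p.2 - p.1)) =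
      ∫⁻ p in X ×ˢ Y, ∫⁻ τ in Icc (0 : ℝ) 1, g (p.1 + τ • (p.2 - p.1)) := by
    refine setLIntegral_congr_fun (hX.prod hY) fun p hp => ?_
    refine setLIntegral_congr_fun measurableSet_Icc fun τ hτ => ?_
    simp only [hg]
    rw [indicator_of_mem (hseg _ hp.1 _ hp.2 (mem_segment_add_smul hτ))]
  rw [e1, ← lintegral_indicator hW, ← hg]
  have e2 : ∫⁻ p in X ×ˢ Y, ∫⁻ τ in Icc (0 : ℝ) 1, g (p.1 + τ • (p.2 - p.1)) =
      ∫⁻ τ in Icc (0 : ℝ) 1, ∫⁻ p in X ×ˢ Y, g (p.1 + τ • (p.2 - p.1)) :=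
    lintegral_lintegral_swap hc.aemeasurable
  rw [e2]
  have hbound : ∀ τ ∈ Icc (0 : ℝ) 1, ∫⁻ p in X ×ˢ Y, g (p.1 + τ • (p.2 - p.1)) ≤
      2 ^ d * (volume X + volume Y) * ∫⁻ x, g x := by
    intro τ hτ
    have hm : Measurable fun p : Rd d × Rd d => g (p.1 + τ • (p.2 - p.1)) := by
      refine hgm.comp ?_
      exact Continuous.measurable (by fun_prop)
    rw [Measure.volume_eq_prod, ← Measure.prod_restrict]
    by_cases h : τ ≤ 1 / 2
    · rw [lintegral_prod_symm _ hm.aemeasurable]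
      calc _ ≤ ∫⁻ y in Y, 2 ^ d * ∫⁻ x, g x := by
            refine lintegral_mono fun y => ?_
            refine le_trans (le_of_eq ?_) (lintegral_comp_segment_le (a := 1 - τ) (by linarith)
              (τ • y) hgm X)
            refine lintegral_congr fun x => ?_
            congr 1
            module
        _ = 2 ^ d * volume Y * ∫⁻ x, g x := by
            rw [lintegral_const, Measure.restrict_apply_univ]
            ring
        _ ≤ _ := by gcongr; exact le_add_self
    · rw [lintegral_prod _ hm.aemeasurable]
      calc _ ≤ ∫⁻ x in X, 2 ^ d * ∫⁻ x, g x := by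
            refine lintegral_mono fun x => ?_
            refine le_trans (le_of_eq ?_) (lintegral_comp_segment_le (a := τ) (by linarith)
              ((1 - τ) • x) hgm Y)
            refine lintegral_congr fun y => ?_
            congr 1
            module
        _ = 2 ^ d * volume X * ∫⁻ x, g x := by
            rw [lintegral_const, Measure.restrict_apply_univ]
            ring
        _ ≤ _ := by gcongr; exact le_self_add
  calc _ ≤ ∫⁻ τ in Icc (0 : ℝ) 1, 2 ^ d * (volume X + volume Y) * ∫⁻ x, g x :=
        setLIntegral_mono' measurableSet_Icc hbound
    _ = _ := by simp

variable {F : Type} [NormedAddCommGroup F] [NormedSpace ℝ F] [CompleteSpace F]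

/-- A Poincaré inequality on a product of sets all of whose connecting segments lie in `W`. -/
theorem lintegral_prod_sub_le {U W X Y : Set (Rd d)} {v : Rd d → F}
    {v' : Rd d → (Rd d →L[ℝ] F)} (hW : IsOpen W) (hWU : W ⊆ U) (hv : IsWeakFDeriv U v v')
    (A : Rd d →L[ℝ] F) (hX : MeasurableSet X) (hY : MeasurableSet Y)
    (hseg : ∀ x ∈ X, ∀ y ∈ Y, segment ℝ x y ⊆ W) {D : ℝ}
    (hD : ∀ x ∈ X, ∀ y ∈ Y, ‖x - y‖ ≤ D) :
    ∫⁻ p in X ×ˢ Y, ‖v p.1 - v p.2 - A (p.1 - p.2)‖ₑ ≤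
      ENNReal.ofReal D * (2 ^ d * (volume X + volume Y)) * ∫⁻ x in W, ‖v' x - A‖ₑ := by
  have := lintegral_segment_le hW hWU hv A (hX.prod hY) (fun p hp => hseg _ hp.1 _ hp.2)
    (k := fun _ => 1) measurable_const (by simp)
    (B := ENNReal.ofReal D * (2 ^ d * (volume X + volume Y))) ?_
  · simpa using this
  intro f hf
  calc _ ≤ ∫⁻ p in X ×ˢ Y, ENNReal.ofReal D *
        ∫⁻ τ in Icc (0 : ℝ) 1, f (p.1 + τ • (p.2 - p.1)) := by
        refine setLIntegral_mono' (hX.prod hY) fun p hp => ?_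
        rw [one_mul]
        gcongr
        rw [← ofReal_norm]
        exact ENNReal.ofReal_le_ofReal (hD _ hp.1 _ hp.2)
    _ = ENNReal.ofReal D * ∫⁻ p in X ×ˢ Y,
        ∫⁻ τ in Icc (0 : ℝ) 1, f (p.1 + τ • (p.2 - p.1)) :=
        lintegral_const_mul' _ _ ENNReal.ofReal_ne_top
    _ ≤ _ := by
        rw [mul_assoc]
        gcongr
        exact lintegral_prod_segment_le hX hY hW.measurableSet hseg hf

/-- The fractional seminorm of `v - A` near the diagonal, by the `L¹` norm of its gradient. -/
theorem lintegral_rieszKernel_sub_le {U W : Set (Rd d)} {v : Rd d → F}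
    {v' : Rd d → (Rd d →L[ℝ] F)} (hW : IsOpen W) (hWU : W ⊆ U) (hv : IsWeakFDeriv U v v')
    (A : Rd d →L[ℝ] F) {P : Set (Rd d × Rd d)} (hP : MeasurableSet P)
    (hPW : ∀ p ∈ P, segment ℝ p.1 p.2 ⊆ W) {ρ : ℝ} (hρ : ∀ p ∈ P, ‖p.1 - p.2‖ ≤ ρ) (α : ℝ) :
    ∫⁻ p in P, rieszKernel (α + 1) (p.1 - p.2) * ‖v p.1 - v p.2 - A (p.1 - p.2)‖ₑ ≤
      (∫⁻ w in Metric.closedBall (0 : Rd d) ρ, rieszKernel α w) * ∫⁻ x in W, ‖v' x - A‖ₑ := by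
  refine lintegral_segment_le hW hWU hv A hP hPW
    ((measurable_rieszKernel _).comp (measurable_fst.sub measurable_snd))
    (fun p => rieszKernel_ne_top _ _) fun f hf => ?_
  set g := W.indicator f with hg
  have hgm : Measurable g := hf.indicator hW.measurableSet
  set κ : Rd d → ℝ≥0∞ := (Metric.closedBall (0 : Rd d) ρ).indicator (rieszKernel α) with hκ
  have hκm : Measurable κ := (measurable_rieszKernel α).indicator
    Metric.isClosed_closedBall.measurableSet
  have hc : Measurable fun q : (Rd d × Rd d) × ℝ => g (q.1.1 + q.2 • (q.1.2 - q.1.1)) := by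
    refine hgm.comp ?_
    exact Continuous.measurable (by fun_prop)
  -- The length of the segment lowers the order of the kernel by one. On the diagonal the left side
  -- is zero, whatever value the kernel takes there.
  have hle : ∀ p ∈ P, rieszKernel (α + 1) (p.1 - p.2) * (‖p.1 - p.2‖ₑ *
      ∫⁻ τ in Icc (0 : ℝ) 1, f (p.1 + τ • (p.2 - p.1))) ≤ κ (p.2 - p.1) *
      ∫⁻ τ in Icc (0 : ℝ) 1, g (p.1 + τ • (p.2 - p.1)) := by
    intro p hp
    rw [← mul_assoc]
    refine mul_le_mul' ?_ (le_of_eq ?_)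
    · have hmem : p.2 - p.1 ∈ Metric.closedBall (0 : Rd d) ρ := by
        simpa [norm_sub_rev] using hρ p hp
      rw [hκ, indicator_of_mem hmem, rieszKernel_sub_comm, rieszKernel, rieszKernel, ← ofReal_norm,
        norm_sub_rev p.1, ← ENNReal.ofReal_mul (by positivity)]
      refine ENNReal.ofReal_le_ofReal ?_
      rcases eq_or_ne ‖p.2 - p.1‖ 0 with h0 | h0
      · rw [h0, mul_zero]
        positivity
      · have hpos : 0 < ‖p.2 - p.1‖ := lt_of_le_of_ne (norm_nonneg _) h0.symm
        refine le_of_eq ?_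
        nth_rewrite 2 [← Real.rpow_one ‖p.2 - p.1‖]
        rw [← Real.rpow_add hpos]
        congr 1
        ring
    · refine setLIntegral_congr_fun measurableSet_Icc fun τ hτ => ?_
      simp only [hg]
      rw [indicator_of_mem (hPW p hp (mem_segment_add_smul hτ))]
  calc _ ≤ ∫⁻ p in P, κ (p.2 - p.1) *
      ∫⁻ τ in Icc (0 : ℝ) 1, g (p.1 + τ • (p.2 - p.1)) := setLIntegral_mono' hP hle
    _ ≤ ∫⁻ p : Rd d × Rd d, κ (p.2 - p.1) *
      ∫⁻ τ in Icc (0 : ℝ) 1, g (p.1 + τ • (p.2 - p.1)) := setLIntegral_le_lintegral _ _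
    _ = ∫⁻ x : Rd d, ∫⁻ y : Rd d, κ (y - x) *
      ∫⁻ τ in Icc (0 : ℝ) 1, g (x + τ • (y - x)) := by
        rw [Measure.volume_eq_prod, lintegral_prod]
        refine ((hκm.comp (measurable_snd.sub measurable_fst)).mul ?_).aemeasurable
        exact hc.lintegral_prod_right'
    _ = ∫⁻ x : Rd d, ∫⁻ w : Rd d, κ w * ∫⁻ τ in Icc (0 : ℝ) 1, g (x + τ • w) := by
        refine lintegral_congr fun x => ?_
        rw [← lintegral_add_right_eq_self _ x]
        simp
    _ = ∫⁻ w : Rd d, ∫⁻ x : Rd d, κ w * ∫⁻ τ in Icc (0 : ℝ) 1, g (x + τ • w) := by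
        refine lintegral_lintegral_swap ?_
        refine ((hκm.comp measurable_snd).mul ?_).aemeasurable
        refine Measurable.lintegral_prod_right' (f := fun q : (Rd d × Rd d) × ℝ =>
          g (q.1.1 + q.2 • q.1.2)) ?_
        refine hgm.comp ?_
        exact Continuous.measurable (by fun_prop)
    _ = ∫⁻ w : Rd d, κ w * ∫⁻ x, g x := by
        refine lintegral_congr fun w => ?_
        have hm : Measurable fun q : Rd d × ℝ => g (q.1 + q.2 • w) := by
          refine hgm.comp ?_
          exact Continuous.measurable (by fun_prop)
        rw [lintegral_const_mul]
        swap
        · exact hm.lintegral_prod_right'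
        congr 1
        rw [lintegral_lintegral_swap (f := fun x τ => g (x + τ • w)) hm.aemeasurable]
        simp [lintegral_add_right_eq_self (fun x => g x)]
    _ = _ := by
        rw [lintegral_mul_const _ hκm, hκ, hg, lintegral_indicator hW.measurableSet,
          lintegral_indicator Metric.isClosed_closedBall.measurableSet]

end Kernels

/-! ### Geometry of Lipschitz domains -/

section Domains

variable {d : ℕ}

/-- Near `z`, the set `Λ` is invariant under addition of vectors of a short cone of axis `e`. -/
def ConeAt (Λ : Set (Rd d)) (z e : Rd d) (r κ : ℝ) : Prop :=
  ∀ x ∈ Λ, dist x z < r → ∀ τ ∈ Icc 0 r, ∀ v : Rd d, ‖v - τ • e‖ ≤ κ * τ → x + v ∈ Λ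

theorem ConeAt.mono {Λ : Set (Rd d)} {z z' e : Rd d} {r r' κ κ' : ℝ} (h : ConeAt Λ z e r κ)
    (hz : dist z' z + r' ≤ r) (hκ : κ' ≤ κ) : ConeAt Λ z' e r' κ' := by
  intro x hx hxz τ hτ v hv
  have h0 : 0 ≤ dist z' z := dist_nonneg
  refine h x hx ?_ τ ⟨hτ.1, by linarith [hτ.2]⟩ v (hv.trans ?_)
  · linarith [dist_triangle x z' z]
  · exact mul_le_mul_of_nonneg_right hκ hτ.1

theorem exists_coneAt_of_mem (hd : 1 ≤ d) {Λ : Set (Rd d)} (hΛ : IsOpen Λ) {z : Rd d}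
    (hz : z ∈ Λ) : ∃ r κ : ℝ, 0 < r ∧ 0 < κ ∧ ∃ e : Rd d, ‖e‖ = 1 ∧ ConeAt Λ z e r κ := by
  obtain ⟨ε, hε, hball⟩ := Metric.isOpen_iff.1 hΛ z hz
  refine ⟨ε / 3, 1, by positivity, one_pos, EuclideanSpace.single ⟨0, hd⟩ 1, by simp, ?_⟩
  intro x _ hxz τ hτ v hv
  refine hball ?_
  set e : Rd d := EuclideanSpace.single ⟨0, hd⟩ 1
  have he : ‖τ • e‖ = τ := by simp [e, norm_smul, abs_of_nonneg hτ.1]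
  have h1 : ‖v‖ ≤ 2 * τ := by
    calc ‖v‖ = ‖(v - τ • e) + τ • e‖ := by simp
      _ ≤ ‖v - τ • e‖ + ‖τ • e‖ := norm_add_le _ _
      _ ≤ 2 * τ := by linarith
  rw [Metric.mem_ball, dist_eq_norm, show x + v - z = (x - z) + v by abel]
  rw [dist_eq_norm] at hxz
  linarith [norm_add_le (x - z) v, hτ.2]

/-- The cone points along `-e`, into the region below the graph. Moving by `τ` lowers the height by
`τ`; a perturbation `b` with `‖b‖ ≤ κ τ` raises it by at most `‖b‖` and changes `ψ` by at most `2 L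
‖b‖`. -/
theorem exists_coneAt_of_mem_frontier {Λ : Set (Rd d)} (hΛ : HasLipschitzBoundary Λ)
    {z : Rd d} (hz : z ∈ frontier Λ) :
    ∃ r κ : ℝ, 0 < r ∧ 0 < κ ∧ ∃ e : Rd d, ‖e‖ = 1 ∧ ConeAt Λ z e r κ := by
  obtain ⟨U, hU, hzU, e, ψ, L, he, hψ, hiff⟩ := hΛ z hz
  obtain ⟨ε, hε, hball⟩ := Metric.isOpen_iff.1 hU z hzU
  have hL : (0 : ℝ) ≤ L := L.2
  -- Chosen so that `κ (1 + 2 L) ≤ 1`: the total effect of the perturbation does not exceed the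
  -- descent `τ`, and the strict inequality at `x` survives.
  set κ : ℝ := 1 / (2 * (1 + L)) with hκ
  have hκ1 : κ * (1 + 2 * L) ≤ 1 := by
    rw [hκ, div_mul_eq_mul_div, one_mul, div_le_one (by positivity)]
    linarith
  have hκ0 : 0 < κ := by positivity
  have hκ2 : κ ≤ 1 := by nlinarith
  refine ⟨ε / 3, κ, by positivity, hκ0, -e, by simpa using he, ?_⟩
  intro x hx hxz τ hτ v hv
  set b := v - τ • (-e) with hb
  have hvb : v = b - τ • e := by rw [hb]; module
  have hτe : ‖τ • e‖ = τ := by rw [norm_smul, he, Real.norm_of_nonneg hτ.1, mul_one]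
  have h1 : ‖v‖ ≤ 2 * τ := by
    rw [hvb]
    have := norm_sub_le b (τ • e)
    nlinarith [hτ.1]
  rw [dist_eq_norm] at hxz
  have hxU : x ∈ U := hball (by rw [Metric.mem_ball, dist_eq_norm]; linarith)
  have hxvU : x + v ∈ U := hball (by
    rw [Metric.mem_ball, dist_eq_norm, show x + v - z = (x - z) + v by abel]
    linarith [norm_add_le (x - z) v, hτ.2])
  have hxlt := (hiff x hxU).1 hx
  rw [hiff _ hxvU]
  have hee : inner ℝ e e = (1 : ℝ) := by rw [real_inner_self_eq_norm_sq, he]; norm_num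
  have hin : inner ℝ e (x + v) = inner ℝ e x + inner ℝ e b - τ := by
    rw [hvb, inner_add_right, inner_sub_right, inner_smul_right, hee]
    ring
  have hbe : inner ℝ e b ≤ ‖b‖ := by simpa [he] using real_inner_le_norm e b
  have hbe' : ‖(inner ℝ e b : ℝ) • e‖ ≤ ‖b‖ := by
    rw [norm_smul, he, mul_one]
    simpa [he] using abs_real_inner_le_norm e b
  have hdiff : (x + v - (inner ℝ e (x + v) : ℝ) • e) - (x - (inner ℝ e x : ℝ) • e) =
      b - (inner ℝ e b : ℝ) • e := by
    rw [hin, hvb]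
    module
  have hψ' := hψ.dist_le_mul (x - (inner ℝ e x : ℝ) • e) (x + v - (inner ℝ e (x + v) : ℝ) • e)
  rw [dist_comm (x - _), dist_eq_norm (x + v - _), hdiff, Real.dist_eq] at hψ'
  have h3 := norm_sub_le b ((inner ℝ e b : ℝ) • e)
  have h4 := (abs_le.1 hψ').2
  have h5 : (L : ℝ) * ‖b - (inner ℝ e b : ℝ) • e‖ ≤ L * (2 * (κ * τ)) := by
    refine mul_le_mul_of_nonneg_left ?_ hL
    linarith
  rw [hin] at h4 ⊢
  have h6 := mul_le_mul_of_nonneg_right hκ1 hτ.1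
  nlinarith

/-- The uniform cone property of bounded Lipschitz domains. -/
theorem exists_uniform_coneAt (hd : 1 ≤ d) {Λ : Set (Rd d)} (hΛ : IsBoundedLipschitzDomain Λ) :
    ∃ r κ : ℝ, 0 < r ∧ 0 < κ ∧ κ ≤ 1 ∧ ∀ z ∈ closure Λ, ∃ e : Rd d, ‖e‖ = 1 ∧
      ConeAt Λ z e r κ := by
  have hc : IsCompact (closure Λ) := hΛ.isBounded.isCompact_closure
  have hloc : ∀ z ∈ closure Λ, ∃ r κ : ℝ, 0 < r ∧ 0 < κ ∧ ∃ e : Rd d, ‖e‖ = 1 ∧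
      ConeAt Λ z e r κ := by
    intro z hz
    by_cases h : z ∈ Λ
    · exact exists_coneAt_of_mem hd hΛ.isOpen h
    · exact exists_coneAt_of_mem_frontier hΛ.lipschitz ⟨hz, by rwa [hΛ.isOpen.interior_eq]⟩
  refine hc.induction_on (p := fun S => ∃ r κ : ℝ, 0 < r ∧ 0 < κ ∧ κ ≤ 1 ∧ ∀ z ∈ S,
    ∃ e : Rd d, ‖e‖ = 1 ∧ ConeAt Λ z e r κ) ?_ ?_ ?_ ?_
  · exact ⟨1, 1, one_pos, one_pos, le_rfl, by simp⟩
  · rintro s t hst ⟨r, κ, hr, hκ, hκ1, h⟩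
    exact ⟨r, κ, hr, hκ, hκ1, fun z hz => h z (hst hz)⟩
  · rintro s t ⟨r, κ, hr, hκ, hκ1, h⟩ ⟨r', κ', hr', hκ', hκ1', h'⟩
    refine ⟨min r r', min κ κ', lt_min hr hr', lt_min hκ hκ', min_le_of_left_le hκ1, ?_⟩
    rintro z (hz | hz)
    · obtain ⟨e, he, hcone⟩ := h z hz
      exact ⟨e, he, hcone.mono (by simp) (min_le_left _ _)⟩
    · obtain ⟨e, he, hcone⟩ := h' z hz
      exact ⟨e, he, hcone.mono (by simp) (min_le_right _ _)⟩
  · intro z hz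
    obtain ⟨r, κ, hr, hκ, e, he, hcone⟩ := hloc z hz
    refine ⟨Metric.ball z (r / 2), mem_nhdsWithin_of_mem_nhds (Metric.ball_mem_nhds z (half_pos hr)),
      r / 2, min κ 1, half_pos hr, lt_min hκ one_pos, min_le_right _ _, fun z' hz' =>
      ⟨e, he, hcone.mono ?_ (min_le_left _ _)⟩⟩
    linarith [Metric.mem_ball.1 hz']

/-- The domain lies on one side of its boundary: points `x + τ e` just above a boundary point are
strictly above the graph, hence outside the closure. This excludes slits, and is what decides on
which side of `∂Ω` vertices and elements lie. -/
theorem interior_closure_subset_of_lipschitz {Ω : Set (Rd d)} (hΩ : HasLipschitzBoundary Ω) :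
    interior (closure Ω) ⊆ Ω := by
  intro x hx
  by_contra hxΩ
  have hxf : x ∈ frontier Ω :=
    ⟨interior_subset hx, fun h => hxΩ (interior_subset h)⟩
  obtain ⟨U, hU, hxU, e, ψ, L, he, hψ, hiff⟩ := hΩ x hxf
  have hee : inner ℝ e e = (1 : ℝ) := by rw [real_inner_self_eq_norm_sq, he]; norm_num
  have hge : ψ (x - (inner ℝ e x : ℝ) • e) ≤ inner ℝ e x := by
    by_contra! h
    exact hxΩ ((hiff x hxU).2 h)
  set V : Set (Rd d) := U ∩ {y | ψ (y - (inner ℝ e y : ℝ) • e) < inner ℝ e y} with hV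
  have hVo : IsOpen V := by
    have := hψ.continuous
    exact hU.inter (isOpen_lt (by fun_prop) (by fun_prop))
  have hVΩ : ∀ y ∈ V, y ∉ closure Ω := by
    intro y hy hyc
    obtain ⟨w, hwV, hwΩ⟩ := mem_closure_iff.1 hyc V hVo hy
    exact lt_asymm ((hiff w hwV.1).1 hwΩ) hwV.2
  have hO : IsOpen (U ∩ interior (closure Ω)) := hU.inter isOpen_interior
  have hcont : Filter.Tendsto (fun τ : ℝ => x + τ • e) (nhdsWithin 0 (Ioi 0)) (nhds x) := by
    have : Continuous fun τ : ℝ => x + τ • e := by fun_prop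
    have h2 := this.tendsto 0
    simp only [zero_smul, add_zero] at h2
    exact h2.mono_left nhdsWithin_le_nhds
  have hev := (hcont.eventually (hO.mem_nhds ⟨hxU, hx⟩)).and self_mem_nhdsWithin
  obtain ⟨τ, ⟨hτU, hτc⟩, hτ⟩ := hev.exists
  refine hVΩ (x + τ • e) ⟨hτU, ?_⟩ (interior_subset hτc)
  have hin : inner ℝ e (x + τ • e) = inner ℝ e x + τ := by
    rw [inner_add_right, inner_smul_right, hee, mul_one]
  have harg : x + τ • e - (inner ℝ e x + τ : ℝ) • e = x - (inner ℝ e x : ℝ) • e := by module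
  simp only [mem_ofPred_eq, hin, harg]
  linarith [show (0:ℝ) < τ from hτ]

theorem IsBoundedLipschitzDomain.interior_closure {Ω : Set (Rd d)}
    (hΩ : IsBoundedLipschitzDomain Ω) : interior (closure Ω) = Ω :=
  (interior_closure_subset_of_lipschitz hΩ.lipschitz).antisymm
    (interior_maximal subset_closure hΩ.isOpen)

theorem exists_pos_forall_dist_lt_mem {Ω Λ : Set (Rd d)} (hΩ : Bornology.IsBounded Ω)
    (hΛ : IsOpen Λ) (h : closure Ω ⊆ Λ) :
    ∃ δ : ℝ, 0 < δ ∧ ∀ x ∈ closure Ω, Metric.ball x δ ⊆ Λ := by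
  obtain ⟨δ, hδ, hsub⟩ := hΩ.isCompact_closure.exists_cthickening_subset_open hΛ h
  exact ⟨δ, hδ, fun x hx => Metric.ball_subset_closedBall.trans
    ((Metric.closedBall_subset_cthickening hx δ).trans hsub)⟩

end Domains

/-! ### Barycentric coordinates of the elements of a mesh -/

section Cells

variable {d : ℕ} {K : Geometry.SimplicialComplex ℝ (Rd d)} {T T' : Finset (Rd d)}

theorem affineIndependent_of_mem_cells (hT : T ∈ cells K) :
    AffineIndependent ℝ ((↑) : T → Rd d) := K.indep hT.1

theorem affineSpan_eq_top_of_mem_cells (hT : T ∈ cells K) :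
    affineSpan ℝ (range ((↑) : T → Rd d)) = ⊤ := by
  rw [(affineIndependent_of_mem_cells hT).affineSpan_eq_top_iff_card_eq_finrank_add_one]
  simp [hT.2]

/-- The vertices of an element, as an affine basis. -/
def cellBasis (hT : T ∈ cells K) : AffineBasis T ℝ (Rd d) :=
  ⟨(↑), affineIndependent_of_mem_cells hT, affineSpan_eq_top_of_mem_cells hT⟩

@[simp]
theorem cellBasis_apply (hT : T ∈ cells K) (z : T) : cellBasis hT z = z := rfl

open Classical in
/-- The barycentric coordinate of the vertex `z` of the simplex with vertex set `T`, as an affine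
function; it is `0` if `z` is not in `T`. -/
def cellCoord (T : Finset (Rd d)) (z : Rd d) : Rd d →ᵃ[ℝ] ℝ :=
  if h : (AffineIndependent ℝ ((↑) : T → Rd d) ∧
    affineSpan ℝ (range ((↑) : T → Rd d)) = ⊤) ∧ z ∈ T then
    (⟨(↑), h.1.1, h.1.2⟩ : AffineBasis T ℝ (Rd d)).coord ⟨z, h.2⟩ else 0

theorem cellCoord_of_mem (hT : T ∈ cells K) {z : Rd d} (hz : z ∈ T) :
    cellCoord T z = (cellBasis hT).coord ⟨z, hz⟩ := by
  rw [cellCoord, dif_pos ⟨⟨affineIndependent_of_mem_cells hT, affineSpan_eq_top_of_mem_cells hT⟩,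
    hz⟩]
  rfl

theorem cellCoord_of_notMem {z : Rd d} (hz : z ∉ T) (x : Rd d) : cellCoord T z x = 0 := by
  rw [cellCoord, dif_neg fun h => hz h.2]
  rfl

open Classical in
theorem cellCoord_vertex (hT : T ∈ cells K) {z z' : Rd d} (hz' : z' ∈ T) :
    cellCoord T z z' = if z = z' then 1 else 0 := by
  by_cases hz : z ∈ T
  · rw [cellCoord_of_mem hT hz]
    have := (cellBasis hT).coord_apply ⟨z, hz⟩ ⟨z', hz'⟩
    simpa using this
  · rw [cellCoord_of_notMem hz, if_neg]
    rintro rfl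
    exact hz hz'

theorem sum_cellCoord (hT : T ∈ cells K) (x : Rd d) : ∑ z ∈ T, cellCoord T z x = 1 := by
  have := (cellBasis hT).sum_coord_apply_eq_one x
  rw [← Finset.sum_coe_sort T fun z => cellCoord T z x, ← this]
  exact Finset.sum_congr rfl fun z _ => by rw [cellCoord_of_mem hT z.2]

theorem sum_cellCoord_smul (hT : T ∈ cells K) (x : Rd d) :
    ∑ z ∈ T, cellCoord T z x • z = x := by
  have := (cellBasis hT).linear_combination_coord_eq_self x
  rw [← Finset.sum_coe_sort T fun z => cellCoord T z x • z]
  nth_rewrite 2 [← this]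
  exact Finset.sum_congr rfl fun z _ => by rw [cellCoord_of_mem hT z.2]; rfl

theorem affineMap_sum_smul (q : Rd d →ᵃ[ℝ] ℝ) (w : Rd d → ℝ) (hw : ∑ z ∈ T, w z = 1) :
    q (∑ z ∈ T, w z • z) = ∑ z ∈ T, w z * q z := by
  have hq : ∀ x, q x = q.linear x + q 0 := fun x => by rw [q.decomp']; simp
  rw [hq, map_sum]
  simp only [map_smul, smul_eq_mul]
  have : ∑ z ∈ T, w z * q z = ∑ z ∈ T, w z * q.linear z + (∑ z ∈ T, w z) * q 0 := by
    rw [Finset.sum_mul, ← Finset.sum_add_distrib]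
    exact Finset.sum_congr rfl fun z _ => by rw [hq z]; ring
  rw [this, hw, one_mul]

theorem affineMap_eq_sum_cellCoord (hT : T ∈ cells K) (q : Rd d →ᵃ[ℝ] ℝ) (x : Rd d) :
    q x = ∑ z ∈ T, cellCoord T z x * q z := by
  conv_lhs => rw [← sum_cellCoord_smul hT x]
  exact affineMap_sum_smul q _ (sum_cellCoord hT x)

theorem cellCoord_eq_of_weights (hT : T ∈ cells K) {w : Rd d → ℝ} {x : Rd d}
    (hw0 : ∀ y ∉ T, w y = 0) (hw : ∑ y ∈ T, w y = 1) (hwx : ∑ y ∈ T, w y • y = x) (z : Rd d) :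
    cellCoord T z x = w z := by
  classical
  rw [← hwx, affineMap_sum_smul _ _ hw]
  by_cases hz : z ∈ T
  · rw [Finset.sum_eq_single z]
    · rw [cellCoord_vertex hT hz]; simp
    · intro y hy hyz
      rw [cellCoord_vertex hT hy, if_neg hyz.symm, mul_zero]
    · exact fun h => absurd hz h
  · rw [hw0 z hz]
    exact Finset.sum_eq_zero fun y _ => by rw [cellCoord_of_notMem hz, mul_zero]

/-- Barycentric weights are unique, so the choice made in `baryCoord` is harmless. -/
theorem baryCoord_eq_cellCoord (hT : T ∈ cells K) (z x : Rd d) :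
    baryCoord T z x = cellCoord T z x := by
  have h : ∃ w : Rd d → ℝ, (∀ y ∉ T, w y = 0) ∧ ∑ y ∈ T, w y = 1 ∧ ∑ y ∈ T, w y • y = x :=
    ⟨fun z => cellCoord T z x, fun y hy => cellCoord_of_notMem hy x, sum_cellCoord hT x,
      sum_cellCoord_smul hT x⟩
  rw [baryCoord, dif_pos h]
  obtain ⟨h1, h2, h3⟩ := h.choose_spec
  exact (cellCoord_eq_of_weights hT h1 h2 h3 z).symm

theorem continuous_affineMap (q : Rd d →ᵃ[ℝ] ℝ) : Continuous q :=
  q.continuous_of_finiteDimensional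

theorem range_cellBasis (hT : T ∈ cells K) : range (cellBasis hT) = (T : Set (Rd d)) := by
  ext x
  simp [cellBasis_apply]

theorem mem_simplex_iff (hT : T ∈ cells K) {x : Rd d} :
    x ∈ simplex T ↔ ∀ z ∈ T, 0 ≤ cellCoord T z x := by
  have := (cellBasis hT).convexHull_eq_nonneg_coord
  rw [range_cellBasis hT] at this
  rw [simplex, this]
  simp only [mem_ofPred_eq, Subtype.forall]
  exact forall₂_congr fun z hz => by rw [cellCoord_of_mem hT hz]

theorem mem_interior_simplex_iff (hT : T ∈ cells K) {x : Rd d} :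
    x ∈ interior (simplex T) ↔ ∀ z ∈ T, 0 < cellCoord T z x := by
  have := (cellBasis hT).interior_convexHull
  rw [range_cellBasis hT] at this
  rw [simplex, this]
  simp only [mem_ofPred_eq, Subtype.forall]
  exact forall₂_congr fun z hz => by rw [cellCoord_of_mem hT hz]

theorem cellCoord_nonneg (hT : T ∈ cells K) {x : Rd d} (hx : x ∈ simplex T) (z : Rd d) :
    0 ≤ cellCoord T z x := by
  by_cases hz : z ∈ T
  · exact (mem_simplex_iff hT).1 hx z hz
  · rw [cellCoord_of_notMem hz]

theorem cellCoord_le_one (hT : T ∈ cells K) {x : Rd d} (hx : x ∈ simplex T) (z : Rd d) :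
    cellCoord T z x ≤ 1 := by
  by_cases hz : z ∈ T
  · rw [← sum_cellCoord hT x]
    exact Finset.single_le_sum (f := fun z => cellCoord T z x)
      (fun y _ => cellCoord_nonneg hT hx y) hz
  · rw [cellCoord_of_notMem hz]; exact zero_le_one

theorem convex_simplex (T : Finset (Rd d)) : Convex ℝ (simplex T) := convex_convexHull ℝ _

theorem isCompact_simplex (T : Finset (Rd d)) : IsCompact (simplex T) :=
  T.finite_toSet.isCompact_convexHull ℝ

theorem isClosed_simplex (T : Finset (Rd d)) : IsClosed (simplex T) :=
  (isCompact_simplex T).isClosed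

theorem measurableSet_simplex (T : Finset (Rd d)) : MeasurableSet (simplex T) :=
  (isClosed_simplex T).measurableSet

theorem vertex_mem_simplex {z : Rd d} (hz : z ∈ T) : z ∈ simplex T :=
  subset_convexHull ℝ _ hz

theorem interior_simplex_nonempty (hT : T ∈ cells K) : (interior (simplex T)).Nonempty := by
  have := interior_convexHull_nonempty_iff_affineSpan_eq_top.2
    (by simpa using affineSpan_eq_top_of_mem_cells hT : affineSpan ℝ (T : Set (Rd d)) = ⊤)
  exact this

theorem closure_interior_simplex (hT : T ∈ cells K) :
    closure (interior (simplex T)) = simplex T := by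
  rw [(convex_simplex T).closure_interior_eq_closure_of_nonempty_interior
    (interior_simplex_nonempty hT), (isClosed_simplex T).closure_eq]

theorem simplex_ae_eq_interior (T : Finset (Rd d)) :
    simplex T =ᵐ[volume] interior (simplex T) :=
  (interior_ae_eq_of_null_frontier ((convex_simplex T).addHaar_frontier volume)).symm

/-- Conformity: a point of two elements is a convex combination of their common vertices. Both
systems of coordinates are these weights extended by zero. -/
theorem cellCoord_eq_cellCoord (hT : T ∈ cells K) (hT' : T' ∈ cells K) {x : Rd d}
    (hx : x ∈ simplex T) (hx' : x ∈ simplex T') (z : Rd d) :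
    cellCoord T z x = cellCoord T' z x := by
  classical
  have h := K.inter_subset_convexHull hT.1 hT'.1 ⟨hx, hx'⟩
  rw [← Finset.coe_inter, Finset.mem_convexHull'] at h
  obtain ⟨w, -, hw1, hwx⟩ := h
  set w' : Rd d → ℝ := fun y => if y ∈ T ∩ T' then w y else 0
  have key : ∀ S : Finset (Rd d), T ∩ T' ⊆ S → S ∈ cells K → cellCoord S z x = w' z := by
    intro S hS hSK
    refine cellCoord_eq_of_weights hSK (fun y hy => if_neg fun h => hy (hS h)) ?_ ?_ z
    · rw [← hw1, ← Finset.sum_subset hS fun y _ hy => if_neg hy]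
      exact Finset.sum_congr rfl fun y hy => if_pos hy
    · rw [← hwx, ← Finset.sum_subset hS fun y _ hy => by simp only [if_neg hy, zero_smul]]
      exact Finset.sum_congr rfl fun y hy => by simp only [if_pos hy]
  rw [key T Finset.inter_subset_left hT, key T' Finset.inter_subset_right hT']

theorem hat_eq_cellCoord (hT : T ∈ cells K) {x : Rd d} (hx : x ∈ simplex T) (z : Rd d) :
    hat K z x = cellCoord T z x := by
  have h : ∃ T ∈ cells K, x ∈ simplex T := ⟨T, hT, hx⟩
  rw [hat, dif_pos h, baryCoord_eq_cellCoord h.choose_spec.1]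
  exact cellCoord_eq_cellCoord h.choose_spec.1 hT h.choose_spec.2 hx z

/-- Distinct elements have equally many vertices, so `T` has a vertex outside `T'`. Its coordinate
is positive in the interior of `T` and, by conformity, zero at points shared with `T'`. -/
theorem disjoint_interior_simplex (hT : T ∈ cells K) (hT' : T' ∈ cells K) (h : T ≠ T') :
    Disjoint (interior (simplex T)) (simplex T') := by
  rw [Set.disjoint_left]
  intro x hx hx'
  obtain ⟨z, hz, hz'⟩ : ∃ z ∈ T, z ∉ T' := by
    by_contra! hsub
    exact h (Finset.eq_of_subset_of_card_le hsub (by rw [hT.2, hT'.2]))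
  have h1 := (mem_interior_simplex_iff hT).1 hx z hz
  rw [cellCoord_eq_cellCoord hT hT' (interior_subset hx) hx', cellCoord_of_notMem hz'] at h1
  exact lt_irrefl _ h1

theorem hat_of_not_mem {x : Rd d} (h : ∀ T ∈ cells K, x ∉ simplex T) (z : Rd d) :
    hat K z x = 0 := by
  rw [hat, dif_neg]
  rintro ⟨T, hT, hx⟩
  exact h T hT hx

theorem hat_nonneg (z x : Rd d) : 0 ≤ hat K z x := by
  by_cases h : ∃ T ∈ cells K, x ∈ simplex T
  · obtain ⟨T, hT, hx⟩ := h
    rw [hat_eq_cellCoord hT hx]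
    exact cellCoord_nonneg hT hx z
  · rw [hat_of_not_mem fun T hT hx => h ⟨T, hT, hx⟩]

theorem mem_of_hat_pos {x z : Rd d} (hT : T ∈ cells K) (hx : x ∈ simplex T)
    (h : 0 < hat K z x) : z ∈ T := by
  by_contra hz
  rw [hat_eq_cellCoord hT hx, cellCoord_of_notMem hz] at h
  exact lt_irrefl _ h

theorem mem_vertexStar_of_hat_pos {x z : Rd d} (h : 0 < hat K z x) : x ∈ vertexStar K z := by
  by_cases h' : ∃ T ∈ cells K, x ∈ simplex T
  · obtain ⟨T, hT, hx⟩ := h'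
    exact mem_biUnion (show T ∈ {T ∈ cells K | z ∈ T} from ⟨hT, mem_of_hat_pos hT hx h⟩) hx
  · rw [hat_of_not_mem fun T hT hx => h' ⟨T, hT, hx⟩] at h
    exact absurd h (lt_irrefl _)

theorem simplex_subset_vertexStar {z : Rd d} (hT : T ∈ cells K) (hz : z ∈ T) :
    simplex T ⊆ vertexStar K z :=
  subset_biUnion_of_mem (u := fun T => simplex T) (show T ∈ {T ∈ cells K | z ∈ T} from ⟨hT, hz⟩)

theorem mem_vertexStar {z x : Rd d} :
    x ∈ vertexStar K z ↔ ∃ T ∈ cells K, z ∈ T ∧ x ∈ simplex T := by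
  simp [vertexStar, and_assoc]

theorem mem_of_vertex_mem_simplex {z : Rd d} (hT : T ∈ cells K) (hT' : T' ∈ cells K)
    (hz : z ∈ T) (hz' : z ∈ simplex T') : z ∈ T' := by
  classical
  by_contra h
  have := cellCoord_eq_cellCoord hT hT' (vertex_mem_simplex hz) hz' z
  rw [cellCoord_of_notMem h, cellCoord_vertex hT hz, if_pos rfl] at this
  exact one_ne_zero this

end Cells

/-! ### Meshes of Lipschitz domains -/

section Meshes

variable {d : ℕ} {K : Geometry.SimplicialComplex ℝ (Rd d)} {T T' : Finset (Rd d)}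
  {Ω Λ : Set (Rd d)}

theorem IsMesh.cells_finite (hK : IsMesh Ω Λ K) : (cells K).Finite :=
  hK.finite.subset fun _ h => h.1

/-- The elements of a mesh, as a finset. -/
def IsMesh.cellFinset (hK : IsMesh Ω Λ K) : Finset (Finset (Rd d)) := hK.cells_finite.toFinset

@[simp]
theorem IsMesh.mem_cellFinset (hK : IsMesh Ω Λ K) : T ∈ hK.cellFinset ↔ T ∈ cells K := by
  simp [IsMesh.cellFinset]

theorem IsMesh.mem_vertices_iff (hK : IsMesh Ω Λ K) {z : Rd d} :
    z ∈ K.vertices ↔ ∃ T ∈ cells K, z ∈ T := by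
  constructor
  · intro hz
    obtain ⟨T, hT, hzT⟩ := hK.pure _ hz
    exact ⟨T, hT, by simpa using hzT⟩
  · rintro ⟨T, hT, hz⟩
    exact K.down_closed hT.1 (by simpa using hz) (by simp)

theorem IsMesh.vertices_finite (hK : IsMesh Ω Λ K) : K.vertices.Finite := by
  have : K.vertices ⊆ ⋃ T ∈ cells K, (T : Set (Rd d)) := by
    intro z hz
    obtain ⟨T, hT, hzT⟩ := hK.mem_vertices_iff.1 hz
    exact mem_biUnion hT hzT
  exact (hK.cells_finite.biUnion fun T _ => T.finite_toSet).subset this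

/-- The vertices of a mesh, as a finset. -/
def IsMesh.vertFinset (hK : IsMesh Ω Λ K) : Finset (Rd d) := hK.vertices_finite.toFinset

theorem IsMesh.mem_vertFinset (hK : IsMesh Ω Λ K) {z : Rd d} :
    z ∈ hK.vertFinset ↔ ∃ T ∈ cells K, z ∈ T := by
  rw [IsMesh.vertFinset, Set.Finite.mem_toFinset, hK.mem_vertices_iff]

theorem IsMesh.exists_mem_simplex (hK : IsMesh Ω Λ K) {x : Rd d} (hx : x ∈ closure Λ) :
    ∃ T ∈ cells K, x ∈ simplex T := by
  rw [← hK.covers] at hx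
  simpa using hx

theorem IsMesh.simplex_subset (hK : IsMesh Ω Λ K) (hT : T ∈ cells K) : simplex T ⊆ closure Λ := by
  rw [← hK.covers]
  exact subset_biUnion_of_mem (u := fun T => simplex T) hT

theorem IsMesh.vertexStar_subset (hK : IsMesh Ω Λ K) (z : Rd d) : vertexStar K z ⊆ closure Λ :=
  iUnion₂_subset fun _ hT => hK.simplex_subset hT.1

theorem IsMesh.isClosed_vertexStar (hK : IsMesh Ω Λ K) (z : Rd d) : IsClosed (vertexStar K z) :=
  (hK.cells_finite.subset fun _ h => h.1).isClosed_biUnion fun T _ => isClosed_simplex T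

theorem IsMesh.measurableSet_vertexStar (hK : IsMesh Ω Λ K) (z : Rd d) :
    MeasurableSet (vertexStar K z) := (hK.isClosed_vertexStar z).measurableSet

theorem IsMesh.interior_simplex_subset (hK : IsMesh Ω Λ K) (hΛ : IsBoundedLipschitzDomain Λ)
    (hT : T ∈ cells K) : interior (simplex T) ⊆ Λ := by
  rw [← hΛ.interior_closure]
  exact interior_mono (hK.simplex_subset hT)

theorem IsMesh.hat_eq_zero_of_notMem (hK : IsMesh Ω Λ K) {x : Rd d} (hx : x ∉ closure Λ)
    (z : Rd d) : hat K z x = 0 :=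
  hat_of_not_mem (fun _ hT h => hx (hK.simplex_subset hT h)) z

theorem IsMesh.continuousOn_of_cells (hK : IsMesh Ω Λ K) {f : Rd d → ℝ}
    (hf : ∀ T ∈ cells K, ContinuousOn f (simplex T)) : ContinuousOn f (closure Λ) := by
  have := hK.cells_finite.to_subtype
  rw [← hK.covers, biUnion_eq_iUnion]
  exact (locallyFinite_of_finite _).continuousOn_iUnion (fun T => isClosed_simplex T.1)
    fun T => hf T.1 T.2

theorem IsMesh.continuousOn_hat (hK : IsMesh Ω Λ K) (z : Rd d) :
    ContinuousOn (hat K z) (closure Λ) :=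
  hK.continuousOn_of_cells fun _ hT => (continuous_affineMap _).continuousOn.congr
    fun _ hx => hat_eq_cellCoord hT hx z

/-- The part of `Λ` where the basis function of `z` is positive. -/
def openStar (Λ : Set (Rd d)) (K : Geometry.SimplicialComplex ℝ (Rd d)) (z : Rd d) : Set (Rd d) :=
  {x ∈ Λ | 0 < hat K z x}

theorem IsMesh.isOpen_openStar (hK : IsMesh Ω Λ K) (hΛ : IsOpen Λ) (z : Rd d) :
    IsOpen (openStar Λ K z) :=
  ((hK.continuousOn_hat z).mono subset_closure).isOpen_inter_preimage hΛ isOpen_Ioi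

theorem openStar_subset_vertexStar (z : Rd d) : openStar Λ K z ⊆ vertexStar K z :=
  fun _ hx => mem_vertexStar_of_hat_pos hx.2

theorem IsMesh.interior_simplex_subset_openStar (hK : IsMesh Ω Λ K)
    (hΛ : IsBoundedLipschitzDomain Λ) (hT : T ∈ cells K) {z : Rd d} (hz : z ∈ T) :
    interior (simplex T) ⊆ openStar Λ K z := fun x hx =>
  ⟨hK.interior_simplex_subset hΛ hT hx, by
    rw [hat_eq_cellCoord hT (interior_subset hx)]
    exact (mem_interior_simplex_iff hT).1 hx z hz⟩

theorem IsMesh.disjoint_interior_of_not_subset (hK : IsMesh Ω Λ K) (hT : T ∈ cells K)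
    (h : ¬ simplex T ⊆ closure Ω) : Disjoint (interior (simplex T)) (closure Ω) := by
  rw [← hK.resolves, Set.disjoint_iUnion₂_right]
  intro T' hT'
  refine disjoint_interior_simplex hT hT'.1 ?_
  rintro rfl
  exact h hT'.2

theorem IsMesh.simplex_subset_compl (hK : IsMesh Ω Λ K) (hΩ : IsOpen Ω) (hT : T ∈ cells K)
    (h : ¬ simplex T ⊆ closure Ω) : simplex T ⊆ Ωᶜ := by
  rw [← closure_interior_simplex hT]
  refine closure_minimal (fun x hx hxΩ => ?_) hΩ.isClosed_compl
  exact Set.disjoint_left.1 (hK.disjoint_interior_of_not_subset hT h) hx (subset_closure hxΩ)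

theorem IsMesh.simplex_subset_of_vertex_mem (hK : IsMesh Ω Λ K) (hΩ : IsOpen Ω)
    (hT : T ∈ cells K) {z : Rd d} (hz : z ∈ T) (hzΩ : z ∈ Ω) : simplex T ⊆ closure Ω := by
  by_contra h
  exact hK.simplex_subset_compl hΩ hT h (vertex_mem_simplex hz) hzΩ

/-- A vertex outside `Ω` may lie on `∂Ω`. It is then a limit of points of `Λ` outside the closure of
`Ω`, because the interior of that closure is `Ω`; the elements covering these points form a finite
closed union. Hence the set on which `g` is projected contains a whole element. -/
theorem IsMesh.exists_cell_subset_compl (hK : IsMesh Ω Λ K) (hΩ : IsBoundedLipschitzDomain Ω)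
    (hΛ : IsOpen Λ) (hΩΛ : closure Ω ⊆ Λ) (hT : T ∈ cells K) {z : Rd d} (hz : z ∈ T)
    (hzΩ : z ∉ Ω) : ∃ T' ∈ cells K, z ∈ T' ∧ simplex T' ⊆ Ωᶜ := by
  by_cases hzc : z ∈ closure Ω
  · have hfin : {T ∈ cells K | ¬ simplex T ⊆ closure Ω}.Finite :=
      hK.cells_finite.subset fun _ h => h.1
    have hcl : IsClosed (⋃ T ∈ {T ∈ cells K | ¬ simplex T ⊆ closure Ω}, simplex T) :=
      hfin.isClosed_biUnion fun T _ => isClosed_simplex T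
    have hsub : Λ ∩ (closure Ω)ᶜ ⊆ ⋃ T ∈ {T ∈ cells K | ¬ simplex T ⊆ closure Ω}, simplex T := by
      rintro x ⟨hxΛ, hxΩ⟩
      obtain ⟨T, hT, hx⟩ := hK.exists_mem_simplex (subset_closure hxΛ)
      exact mem_biUnion (show T ∈ {T ∈ cells K | ¬ simplex T ⊆ closure Ω} from
        ⟨hT, fun h => hxΩ (h hx)⟩) hx
    have hzcl : z ∈ closure (Λ ∩ (closure Ω)ᶜ) := by
      refine hΛ.inter_closure ⟨hΩΛ hzc, ?_⟩
      rw [closure_compl, hΩ.interior_closure]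
      exact hzΩ
    have := closure_minimal hsub hcl hzcl
    simp only [mem_iUnion, exists_prop] at this
    obtain ⟨T', hT', hzT'⟩ := this
    exact ⟨T', hT'.1, mem_of_vertex_mem_simplex hT hT'.1 hz hzT',
      hK.simplex_subset_compl hΩ.isOpen hT'.1 hT'.2⟩
  · exact ⟨T, hT, hz, hK.simplex_subset_compl hΩ.isOpen hT fun h => hzc (h (vertex_mem_simplex hz))⟩

/-- The star of an interior vertex lies in the closure of `Ω`, and its open star, being open, lies
in `Ω`. Interior nodal values therefore do not disturb the exterior data. -/
theorem IsMesh.hat_eq_zero_of_vertex_mem (hK : IsMesh Ω Λ K) (hΩ : IsBoundedLipschitzDomain Ω)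
    (hΛ : IsOpen Λ) (hΩΛ : closure Ω ⊆ Λ) {z x : Rd d} (hz : z ∈ Ω) (hx : x ∉ Ω) :
    hat K z x = 0 := by
  by_contra h
  have hpos : 0 < hat K z x := lt_of_le_of_ne (hat_nonneg z x) (Ne.symm h)
  have hstar : vertexStar K z ⊆ closure Ω :=
    iUnion₂_subset fun T hT => hK.simplex_subset_of_vertex_mem hΩ.isOpen hT.1 hT.2 hz
  have hxΛ : x ∈ openStar Λ K z := ⟨hΩΛ (hstar (mem_vertexStar_of_hat_pos hpos)), hpos⟩
  refine hx ?_
  rw [← hΩ.interior_closure]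
  exact interior_maximal ((openStar_subset_vertexStar z).trans hstar) (hK.isOpen_openStar hΛ z) hxΛ

theorem IsMesh.volume_closure_diff (hK : IsMesh Ω Λ K) :
    volume (closure Λ \ ⋃ T ∈ cells K, interior (simplex T)) = 0 := by
  have hsub : closure Λ \ ⋃ T ∈ cells K, interior (simplex T) ⊆
      ⋃ T ∈ cells K, frontier (simplex T) := by
    rintro x ⟨hx, hx'⟩
    obtain ⟨T, hT, hxT⟩ := hK.exists_mem_simplex hx
    refine mem_biUnion hT ⟨subset_closure hxT, fun h => hx' (mem_biUnion hT h)⟩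
  refine measure_mono_null hsub ?_
  exact (measure_biUnion_null_iff hK.cells_finite.countable).2 fun T _ =>
    (convex_simplex T).addHaar_frontier volume

/-- The mesh itself shows that `∂Λ` is null: it is contained in the union of finitely many frontiers
of convex sets. -/
theorem IsMesh.volume_frontier (hK : IsMesh Ω Λ K) (hΛ : IsBoundedLipschitzDomain Λ) :
    volume (closure Λ \ Λ) = 0 := by
  refine measure_mono_null (sdiff_subset_sdiff_right ?_) hK.volume_closure_diff
  exact iUnion₂_subset fun T hT => hK.interior_simplex_subset hΛ hT

/-- A function that is `L`-Lipschitz on each piece of a finite closed cover of a segment is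
`L`-Lipschitz along the segment. -/
theorem abs_sub_le_of_cover_segment {ι : Type*} {I : Set ι} (hI : I.Finite) {S : ι → Set (Rd d)}
    (hS : ∀ i ∈ I, IsClosed (S i)) {f : Rd d → ℝ} {L : ℝ}
    {x y : Rd d} (hf : ∀ i ∈ I, (segment ℝ x y ∩ S i).Nonempty →
      ∀ a ∈ S i, ∀ b ∈ S i, |f a - f b| ≤ L * ‖a - b‖)
    (hcov : segment ℝ x y ⊆ ⋃ i ∈ I, S i) : |f x - f y| ≤ L * ‖x - y‖ := by
  set γ : ℝ → Rd d := fun τ => x + τ • (y - x) with hγ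
  have hγc : Continuous γ := by fun_prop
  have hγs : ∀ τ ∈ Icc (0 : ℝ) 1, γ τ ∈ segment ℝ x y := fun τ hτ => mem_segment_add_smul hτ
  have hγd : ∀ τ τ', τ' ≤ τ → ‖γ τ - γ τ'‖ = (τ - τ') * ‖x - y‖ := by
    intro τ τ' h
    rw [show γ τ - γ τ' = (τ - τ') • (y - x) by simp only [hγ]; module, norm_smul,
      Real.norm_of_nonneg (by linarith), norm_sub_rev]
  have hfc : ContinuousOn f (segment ℝ x y) := by
    have := hI.to_subtype
    have hpos : 0 ≤ |L| := abs_nonneg L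
    have : ContinuousOn f (⋃ i : I, (segment ℝ x y ∩ S i)) := by
      refine (locallyFinite_of_finite _).continuousOn_iUnion (fun i => ?_) fun i => ?_
      · refine IsClosed.inter ?_ (hS i i.2)
        rw [segment_eq_image']
        exact (isCompact_Icc.image (by fun_prop)).isClosed
      · rcases (segment ℝ x y ∩ S i).eq_empty_or_nonempty with he | hne
        · rw [he]; exact continuousOn_empty _
        · refine LipschitzOnWith.continuousOn (K := Real.toNNReal |L|)
            (LipschitzOnWith.of_dist_le_mul fun a ha b hb => ?_)
          rw [Real.coe_toNNReal _ hpos, Real.dist_eq, dist_eq_norm]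
          exact (hf i i.2 hne a ha.2 b hb.2).trans
            (mul_le_mul_of_nonneg_right (le_abs_self L) (norm_nonneg _))
    refine this.mono fun z hz => ?_
    obtain ⟨i, hi, hzi⟩ := mem_iUnion₂.1 (hcov hz)
    exact mem_iUnion.2 ⟨⟨i, hi⟩, hz, hzi⟩
  have hfγ : ContinuousOn (fun τ => f (γ τ)) (Icc 0 1) := hfc.comp hγc.continuousOn hγs
  set G : Set ℝ := {τ | |f (γ τ) - f (γ 0)| ≤ L * (τ * ‖x - y‖)} with hG
  have hclosed : IsClosed (G ∩ Icc 0 1) := by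
    have h1 : ContinuousOn (fun τ => |f (γ τ) - f (γ 0)| - L * (τ * ‖x - y‖)) (Icc 0 1) :=
      ((hfγ.sub continuousOn_const).abs).sub (by fun_prop)
    have h2 := h1.preimage_isClosed_of_isClosed isClosed_Icc (isClosed_Iic (a := (0 : ℝ)))
    rw [inter_comm]
    convert h2 using 1
    ext τ
    simp [hG]
  -- Continuous induction: the set of parameters where the bound holds is closed, and from each of
  -- its points below `1` it extends further to the right.
  have hsub := hclosed.Icc_subset_of_forall_exists_gt (by simp [hG]) (fun τ hτ τ' hττ' => ?_)
  · have h1 := hsub (show (1 : ℝ) ∈ Icc 0 1 by simp)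
    simp only [hG, mem_ofPred_eq, hγ, one_smul, zero_smul, add_zero, one_mul] at h1
    rw [abs_sub_comm]
    simpa using h1
  · obtain ⟨hτG, hτ⟩ := hτ
    set b := min τ' 1 with hb
    have hτb : τ < b := lt_min hττ' hτ.2
    -- One of the finitely many pieces contains `γ t` for parameters `t` arbitrarily close to `τ`
    -- from the right; being closed, it contains `γ τ` too.
    have hev : ∃ i ∈ I, ∃ᶠ t in nhdsWithin τ (Ioi τ), γ t ∈ S i := by
      by_contra! hcon
      have h2 := (Filter.eventually_all_finite hI).2 hcon
      have h3 : ∀ᶠ t in nhdsWithin τ (Ioi τ), t ∈ Ioc τ b := Ioc_mem_nhdsGT hτb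
      obtain ⟨t, ht, ht'⟩ := (h2.and h3).exists
      have h4 : γ t ∈ segment ℝ x y := hγs t ⟨by linarith [hτ.1, ht'.1], ht'.2.trans (min_le_right _ _)⟩
      obtain ⟨i, hi, hzi⟩ := mem_iUnion₂.1 (hcov h4)
      exact ht i hi hzi
    obtain ⟨i, hi, hfreq⟩ := hev
    have hmem : γ τ ∈ S i := by
      refine (hS i hi).closure_eq ▸ (mem_closure_iff_frequently.2 ?_)
      refine Filter.Tendsto.frequently ?_ hfreq
      exact (hγc.tendsto τ).mono_left nhdsWithin_le_nhds
    have h3 : ∀ᶠ t in nhdsWithin τ (Ioi τ), t ∈ Ioc τ b := Ioc_mem_nhdsGT hτb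
    obtain ⟨t, htS, ht⟩ := (hfreq.and_eventually h3).exists
    refine ⟨t, ?_, ht.1, ht.2.trans (min_le_left _ _)⟩
    have h5 := hf i hi ⟨γ τ, hγs τ ⟨hτ.1, hτ.2.le⟩, hmem⟩ _ htS _ hmem
    rw [hγd t τ ht.1.le] at h5
    have h6 := abs_sub_le (f (γ t)) (f (γ τ)) (f (γ 0))
    simp only [hG, mem_ofPred_eq] at hτG ⊢
    nlinarith

theorem IsMesh.abs_sub_le_of_segment (hK : IsMesh Ω Λ K) {f : Rd d → ℝ} {L : ℝ} {x y : Rd d}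
    (hf : ∀ T ∈ cells K, (segment ℝ x y ∩ simplex T).Nonempty →
      ∀ a ∈ simplex T, ∀ b ∈ simplex T, |f a - f b| ≤ L * ‖a - b‖)
    (hxy : segment ℝ x y ⊆ closure Λ) : |f x - f y| ≤ L * ‖x - y‖ :=
  abs_sub_le_of_cover_segment hK.cells_finite (S := fun T => simplex T)
    (fun T _ => isClosed_simplex T) hf (by rwa [hK.covers])

end Meshes

/-! ### Shape regular meshes -/

section Regular

variable {d : ℕ} {K : Geometry.SimplicialComplex ℝ (Rd d)} {T T' : Finset (Rd d)}
  {Ω Λ : Set (Rd d)}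

/-- The slope of an affine function is constant, so it can be read off on any ball after rescaling
`x - y` to length `r`. -/
theorem abs_affineMap_sub_le (q : Rd d →ᵃ[ℝ] ℝ) {c : Rd d} {r M : ℝ} (hr : 0 < r)
    (h : ∀ a ∈ Metric.closedBall c r, |q a - q c| ≤ M) (x y : Rd d) :
    |q x - q y| ≤ M / r * ‖x - y‖ := by
  rcases eq_or_ne x y with rfl | hxy
  · simp
  have hn : 0 < ‖x - y‖ := norm_pos_iff.2 (sub_ne_zero.2 hxy)
  have h1 : q ((r / ‖x - y‖) • (x - y) + c) - q c = r / ‖x - y‖ * (q x - q y) := by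
    have e1 : q ((r / ‖x - y‖) • (x - y) + c) = q.linear ((r / ‖x - y‖) • (x - y)) + q c := by
      simpa using q.map_vadd c ((r / ‖x - y‖) • (x - y))
    have e2 : q x - q y = q.linear (x - y) := by simpa using (q.linearMap_vsub x y).symm
    rw [e1, e2, map_smul, smul_eq_mul]
    ring
  have h2 := h ((r / ‖x - y‖) • (x - y) + c) (by
    rw [Metric.mem_closedBall, dist_eq_norm, add_sub_cancel_right, norm_smul,
      Real.norm_of_nonneg (by positivity), div_mul_cancel₀ _ hn.ne'])
  rw [h1, abs_mul, abs_of_pos (by positivity)] at h2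
  rw [div_mul_eq_mul_div, le_div_iff₀ hr]
  rw [div_mul_eq_mul_div, div_le_iff₀ hn] at h2
  linarith

theorem abs_cellCoord_sub_le (hT : T ∈ cells K) {c : Rd d} {r : ℝ} (hr : 0 < r)
    (h : Metric.closedBall c r ⊆ simplex T) (z x y : Rd d) :
    |cellCoord T z x - cellCoord T z y| ≤ 1 / r * ‖x - y‖ := by
  refine abs_affineMap_sub_le (c := c) _ hr (fun a ha => ?_) x y
  have h1 := cellCoord_nonneg hT (h ha) z
  have h2 := cellCoord_le_one hT (h ha) z
  have h3 := cellCoord_nonneg hT (h (Metric.mem_closedBall_self hr.le)) z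
  have h4 := cellCoord_le_one hT (h (Metric.mem_closedBall_self hr.le)) z
  rw [abs_le]
  constructor <;> linarith

theorem norm_sub_le_diam_simplex {x y : Rd d} (hx : x ∈ simplex T) (hy : y ∈ simplex T) :
    ‖x - y‖ ≤ Metric.diam (simplex T) := by
  rw [← dist_eq_norm]
  exact Metric.dist_le_diam_of_mem (isCompact_simplex T).isBounded hx hy

theorem diam_simplex_pos (hd : 1 ≤ d) (hT : T ∈ cells K) : 0 < Metric.diam (simplex T) := by
  obtain ⟨a, ha, b, hb, hab⟩ := Finset.one_lt_card.1 (by rw [hT.2]; omega : 1 < T.card)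
  exact (norm_pos_iff.2 (sub_ne_zero.2 hab)).trans_le
    (norm_sub_le_diam_simplex (vertex_mem_simplex ha) (vertex_mem_simplex hb))

theorem ballDiam_nonneg (T : Finset (Rd d)) : 0 ≤ ballDiam T := by
  refine Real.sSup_nonneg ?_
  rintro ρ ⟨c, r, hr, rfl, -⟩
  positivity

theorem IsShapeRegular.mono {σ σ' : ℝ} (h : IsShapeRegular σ K) (hσ : σ ≤ σ') :
    IsShapeRegular σ' K where
  diam_le T hT := (h.diam_le T hT).trans (mul_le_mul_of_nonneg_right hσ (ballDiam_nonneg T))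
  neighbours hd T hT T' hT' hne := (h.neighbours hd T hT T' hT' hne).trans
    (mul_le_mul_of_nonneg_right hσ Metric.diam_nonneg)

/-- The supremum `ballDiam` need not be known to be attained. A ball with `2 r > ballDiam T / 2`
exists, and this loss of a factor two accounts for `4 σ`. -/
theorem IsShapeRegular.exists_closedBall_subset (hd : 1 ≤ d) {σ : ℝ} (hσ : 1 ≤ σ)
    (h : IsShapeRegular σ K) (hT : T ∈ cells K) :
    ∃ c, Metric.closedBall c (Metric.diam (simplex T) / (4 * σ)) ⊆ simplex T := by
  have h1 := diam_simplex_pos hd hT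
  have h2 := h.diam_le T hT
  have h3 : 0 < ballDiam T := by
    by_contra! h4
    nlinarith
  obtain ⟨ρ, ⟨c, r, hr, rfl, hsub⟩, hρ⟩ := exists_lt_of_lt_csSup (s := {ρ : ℝ | ∃ (c : Rd d) (r : ℝ),
    0 ≤ r ∧ ρ = 2 * r ∧ Metric.closedBall c r ⊆ simplex T}) (b := ballDiam T / 2) (by
      by_contra hne
      rw [Set.not_nonempty_iff_eq_empty] at hne
      rw [ballDiam, hne, Real.sSup_empty] at h3
      exact lt_irrefl _ h3) (half_lt_self h3)
  refine ⟨c, (Metric.closedBall_subset_closedBall ?_).trans hsub⟩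
  rw [div_le_iff₀ (by positivity)]
  nlinarith

/-- Cells sharing an edge have comparable diameters. -/
theorem diam_le_of_common_edge {c : Rd d} {κ : ℝ} (hκ : 0 < κ)
    (hT : T ∈ cells K) (hdiam : 0 < Metric.diam (simplex T))
    (hc : Metric.closedBall c (Metric.diam (simplex T) / κ) ⊆ simplex T) {z z' : Rd d}
    (hz : z ∈ T) (hz' : z' ∈ T) (hne : z ≠ z') (hzT' : z ∈ T') (hzT'' : z' ∈ T') :
    Metric.diam (simplex T) ≤ κ * Metric.diam (simplex T') := by
  classical
  -- The coordinate of `z` falls from `1` to `0` along the common edge. Its slope is at most `κ /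
  -- diam T`, so the edge, which also lies in `T'`, has length at least `diam T / κ`.
  have h1 := abs_cellCoord_sub_le hT (by positivity) hc z z z'
  rw [cellCoord_vertex hT hz, cellCoord_vertex hT hz', if_pos rfl, if_neg hne] at h1
  have h2 := norm_sub_le_diam_simplex (vertex_mem_simplex hzT') (vertex_mem_simplex hzT'')
  simp only [sub_zero, abs_one, one_div, inv_div] at h1
  rw [div_mul_eq_mul_div, le_div_iff₀ hdiam] at h1
  nlinarith

open Classical in
/-- The elements that have `z` as a vertex. -/
def IsMesh.starFinset (hK : IsMesh Ω Λ K) (z : Rd d) : Finset (Finset (Rd d)) :=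
  hK.cellFinset.filter fun T => z ∈ T

@[simp]
theorem IsMesh.mem_starFinset (hK : IsMesh Ω Λ K) {z : Rd d} :
    T ∈ hK.starFinset z ↔ T ∈ cells K ∧ z ∈ T := by
  simp [IsMesh.starFinset]

/-- The homothety centred at the vertex `z` with ratio `ρ / diam T` maps `T` into itself and shrinks
the inscribed ball to radius `ρ / κ`. -/
theorem exists_ball_subset_of_scale {κ : ℝ} (hκ : 0 < κ) {z : Rd d} (hz : z ∈ T)
    {c : Rd d} (hdiam : 0 < Metric.diam (simplex T))
    (hc : Metric.closedBall c (Metric.diam (simplex T) / κ) ⊆ simplex T) {ρ : ℝ} (hρ : 0 < ρ)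
    (hρT : ρ ≤ Metric.diam (simplex T)) :
    ∃ c', Metric.ball c' (ρ / κ) ⊆ interior (simplex T) ∩ Metric.closedBall z ρ := by
  set h := Metric.diam (simplex T)
  refine ⟨z + (ρ / h) • (c - z), fun p hp => ?_⟩
  have key : ∀ p ∈ Metric.ball (z + (ρ / h) • (c - z)) (ρ / κ),
      ∃ a ∈ simplex T, p = z + (ρ / h) • (a - z) := by
    intro p hp
    refine ⟨z + (h / ρ) • (p - z), hc ?_, ?_⟩
    · rw [Metric.mem_ball, dist_eq_norm] at hp
      rw [Metric.mem_closedBall, dist_eq_norm]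
      have : z + (h / ρ) • (p - z) - c = (h / ρ) • (p - (z + (ρ / h) • (c - z))) := by
        have e : (h / ρ) * (ρ / h) = 1 := by field_simp
        rw [show (h / ρ) • (p - (z + (ρ / h) • (c - z))) =
          (h / ρ) • (p - z) - ((h / ρ) * (ρ / h)) • (c - z) by module, e]
        module
      rw [this, norm_smul, Real.norm_of_nonneg (by positivity)]
      calc h / ρ * _ ≤ h / ρ * (ρ / κ) := by gcongr
        _ = h / κ := by field_simp
    · have e : (ρ / h) * (h / ρ) = 1 := by field_simp
      rw [add_sub_cancel_left, smul_smul, e]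
      module
  constructor
  · refine interior_maximal (fun p hp => ?_) Metric.isOpen_ball hp
    obtain ⟨a, ha, rfl⟩ := key p hp
    refine (convex_simplex T).starConvex (vertex_mem_simplex hz) |>.add_smul_sub_mem ha
      (by positivity) ?_
    exact (div_le_one hdiam).2 hρT
  · obtain ⟨a, ha, rfl⟩ := key p hp
    rw [Metric.mem_closedBall, dist_eq_norm, add_sub_cancel_left, norm_smul,
      Real.norm_of_nonneg (by positivity)]
    calc ρ / h * ‖a - z‖ ≤ ρ / h * h := by
          gcongr
          exact norm_sub_le_diam_simplex ha (vertex_mem_simplex hz)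
      _ = ρ := by field_simp

/-- A packing argument at the scale `ρ` of the smallest element of the star: each element contains a
ball of radius `ρ / κ` within distance `ρ` of `z`, and these balls are disjoint. Comparability of
the elements is not needed, so it can be deduced from this bound. -/
theorem IsMesh.card_starFinset_le (hd : 1 ≤ d) (hK : IsMesh Ω Λ K) {κ : ℝ} (hκ : 0 < κ)
    (hin : ∀ T ∈ cells K, ∃ c, Metric.closedBall c (Metric.diam (simplex T) / κ) ⊆ simplex T)
    (z : Rd d) : ((hK.starFinset z).card : ℝ) ≤ κ ^ d := by
  have : Nontrivial (Rd d) := Module.nontrivial_of_finrank_pos (R := ℝ) (by simp; omega)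
  rcases (hK.starFinset z).eq_empty_or_nonempty with he | hne
  · rw [he]; simp; positivity
  obtain ⟨T₀, hT₀, hmin⟩ := (hK.starFinset z).exists_min_image
    (fun T => Metric.diam (simplex T)) hne
  set ρ := Metric.diam (simplex T₀)
  have hρ : 0 < ρ := diam_simplex_pos hd (hK.mem_starFinset.1 hT₀).1
  have hex : ∀ T : Finset (Rd d), ∃ c', T ∈ hK.starFinset z →
      Metric.ball c' (ρ / κ) ⊆ interior (simplex T) ∩ Metric.closedBall z ρ := by
    intro T
    by_cases hT : T ∈ hK.starFinset z
    · obtain ⟨hTK, hzT⟩ := hK.mem_starFinset.1 hT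
      obtain ⟨c, hc⟩ := hin T hTK
      obtain ⟨c', hc'⟩ := exists_ball_subset_of_scale hκ hzT (diam_simplex_pos hd hTK) hc hρ
        (hmin T hT)
      exact ⟨c', fun _ => hc'⟩
    · exact ⟨0, fun h => absurd h hT⟩
  choose c' hc' using hex
  have hdisj : Set.PairwiseDisjoint (hK.starFinset z : Set (Finset (Rd d)))
      fun T => Metric.ball (c' T) (ρ / κ) := by
    intro T hT T' hT' hne
    refine (disjoint_interior_simplex (hK.mem_starFinset.1 hT).1 (hK.mem_starFinset.1 hT').1
      hne).mono ?_ ?_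
    · exact fun p hp => (hc' T hT hp).1
    · exact fun p hp => interior_subset (hc' T' hT' hp).1
  have hvol := measure_biUnion_finset (μ := volume) hdisj fun T _ => measurableSet_ball
  have hle : volume (⋃ T ∈ hK.starFinset z, Metric.ball (c' T) (ρ / κ)) ≤
      volume (Metric.closedBall z ρ) :=
    measure_mono (iUnion₂_subset fun T hT p hp => (hc' T hT hp).2)
  rw [hvol] at hle
  simp only [Measure.addHaar_ball_of_pos volume _ (show 0 < ρ / κ by positivity), Finset.sum_const,
    nsmul_eq_mul, Measure.addHaar_closedBall volume z hρ.le, finrank_euclideanSpace_fin] at hle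
  have hb0 : volume (Metric.ball (0 : Rd d) 1) ≠ 0 :=
    (Metric.measure_ball_pos volume 0 one_pos).ne'
  have hbt : volume (Metric.ball (0 : Rd d) 1) ≠ ∞ := measure_ball_lt_top.ne
  rw [← mul_assoc, ENNReal.mul_le_mul_iff_left hb0 hbt, ← ENNReal.ofReal_natCast,
    ← ENNReal.ofReal_mul (by positivity), ENNReal.ofReal_le_ofReal_iff (by positivity),
    div_pow, mul_div_assoc', div_le_iff₀ (by positivity), mul_comm (ρ ^ d)] at hle
  exact le_of_mul_le_mul_right hle (by positivity)

/-- A chaining argument. -/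
theorem le_pow_mul_of_chain {α : Type*} (F : Finset α) (h : α → ℝ) (hpos : ∀ a ∈ F, 0 ≤ h a)
    {q : ℝ} (hq : 1 ≤ q) (hstep : ∀ A ⊆ F, A.Nonempty → A ≠ F → ∃ a ∈ A, ∃ b ∈ F, b ∉ A ∧
      h a ≤ q * h b) {a b : α} (ha : a ∈ F) (hb : b ∈ F) {N : ℕ} (hN : F.card ≤ N) :
    h a ≤ q ^ N * h b := by
  classical
  set A : ℕ → Finset α := fun k => F.filter fun c => h a ≤ q ^ k * h c with hA
  have hsub : ∀ k, A k ⊆ F := fun k => Finset.filter_subset _ _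
  have haA : ∀ k, a ∈ A k := fun k => Finset.mem_filter.2 ⟨ha,
    le_mul_of_one_le_left (hpos a ha) (one_le_pow₀ hq)⟩
  have hmono : ∀ k, A k ⊆ A (k + 1) := by
    intro k c hc
    obtain ⟨hcF, hc⟩ := Finset.mem_filter.1 hc
    refine Finset.mem_filter.2 ⟨hcF, hc.trans ?_⟩
    exact mul_le_mul_of_nonneg_right (pow_le_pow_right₀ hq (Nat.le_succ k)) (hpos c hcF)
  -- `A k` consists of the elements reached from `a` with loss `q ^ k`. It gains at least one
  -- element per step until it is all of `F`.
  have hcard : ∀ k, min (k + 1) F.card ≤ (A k).card := by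
    intro k
    induction k with
    | zero => exact (min_le_left _ _).trans (Finset.card_pos.2 ⟨a, haA 0⟩)
    | succ k ih =>
      by_cases hAF : A k = F
      · exact (min_le_right _ _).trans (Finset.card_le_card (hAF ▸ hmono k))
      · obtain ⟨e, he, c, hc, hcA, hle⟩ := hstep (A k) (hsub k) ⟨a, haA k⟩ hAF
        have hcA' : c ∈ A (k + 1) := by
          refine Finset.mem_filter.2 ⟨hc, ((Finset.mem_filter.1 he).2).trans ?_⟩
          rw [pow_succ, mul_assoc]
          exact mul_le_mul_of_nonneg_left hle (by positivity)
        have h1 : insert c (A k) ⊆ A (k + 1) := Finset.insert_subset hcA' (hmono k)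
        have h2 := Finset.card_le_card h1
        rw [Finset.card_insert_of_notMem hcA] at h2
        omega
  have hAN : A N = F := Finset.eq_of_subset_of_card_le (hsub N) (by have := hcard N; omega)
  exact (Finset.mem_filter.1 (hAN ▸ hb : b ∈ A N)).2

end Regular

/-! ### Uniform properties of the stars of a shape regular mesh -/

section Stars

variable {d : ℕ} {K : Geometry.SimplicialComplex ℝ (Rd d)} {T T' : Finset (Rd d)}
  {Ω Λ : Set (Rd d)}

/-- For `d ≥ 2` the line through `z` in direction `e` is a null set, whereas the part of the element
near `z` has positive volume. Such a point can be moved along `e` without hitting `z`. -/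
theorem exists_mem_interior_off_line (hd : 2 ≤ d) (hT : T ∈ cells K) {z : Rd d} (hz : z ∈ T)
    (e : Rd d) {η : ℝ} (hη : 0 < η) :
    ∃ x ∈ interior (simplex T), dist x z < η ∧ ∀ τ : ℝ, x + τ • e ≠ z := by
  set S : AffineSubspace ℝ (Rd d) := AffineSubspace.mk' z (Submodule.span ℝ {e}) with hS
  have hStop : S ≠ ⊤ := by
    intro h
    have h1 : S.direction = ⊤ := by rw [h, AffineSubspace.direction_top]
    rw [hS, AffineSubspace.direction_mk'] at h1
    have h2 := finrank_span_le_card (R := ℝ) ({e} : Set (Rd d))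
    rw [h1, finrank_top] at h2
    simp at h2
    omega
  have h0 : volume (S : Set (Rd d)) = 0 := Measure.addHaar_affineSubspace volume S hStop
  have hzc : z ∈ closure (interior (simplex T)) := by
    rw [closure_interior_simplex hT]; exact vertex_mem_simplex hz
  have hne : (interior (simplex T) ∩ Metric.ball z η).Nonempty := by
    rw [inter_comm]
    exact mem_closure_iff.1 hzc _ Metric.isOpen_ball (Metric.mem_ball_self hη)
  have hpos := (isOpen_interior.inter Metric.isOpen_ball).measure_pos volume hne
  have : ¬ (interior (simplex T) ∩ Metric.ball z η ⊆ (S : Set (Rd d))) := fun h =>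
    hpos.ne' (measure_mono_null h h0)
  obtain ⟨x, hx, hxS⟩ := Set.not_subset.1 this
  refine ⟨x, hx.1, hx.2, fun τ hτ => hxS ?_⟩
  rw [hS, SetLike.mem_coe, AffineSubspace.mem_mk', Submodule.mem_span_singleton]
  refine ⟨-τ, ?_⟩
  rw [← hτ, vsub_eq_sub]
  module

/-- In dimension at least two, the star of a vertex cannot be split into two parts that share no
other vertex. -/
theorem IsMesh.exists_common_edge (hd : 2 ≤ d) (hK : IsMesh Ω Λ K)
    (hΛ : IsBoundedLipschitzDomain Λ) {z e : Rd d} (he : ‖e‖ = 1) {r κ : ℝ} (hr : 0 < r)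
    (hκ : 0 < κ) (hκ1 : κ ≤ 1) (hcone : ConeAt Λ z e r κ) {A : Finset (Finset (Rd d))}
    (hA : A ⊆ hK.starFinset z) (hne : A.Nonempty) (hA' : A ≠ hK.starFinset z) :
    ∃ T ∈ A, ∃ T' ∈ hK.starFinset z, T' ∉ A ∧ ∃ z' ≠ z, z' ∈ T ∧ z' ∈ T' := by
  classical
  by_contra! hcon
  -- If no further vertex is shared, the two closed unions meet only in `z`. The contradiction is a
  -- connected path from one to the other that stays in their union and avoids `z`.
  set SA : Set (Rd d) := ⋃ T ∈ A, simplex T with hSA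
  set SB : Set (Rd d) := ⋃ T ∈ hK.starFinset z \ A, simplex T with hSB
  have hAc : IsClosed SA := isClosed_biUnion_finset fun T _ => isClosed_simplex T
  have hBc : IsClosed SB := isClosed_biUnion_finset fun T _ => isClosed_simplex T
  have hAB : ∀ x ∈ SA, x ∈ SB → x = z := by
    intro x hxA hxB
    obtain ⟨T, hT, hxT⟩ := mem_iUnion₂.1 hxA
    obtain ⟨T', hT', hxT'⟩ := mem_iUnion₂.1 hxB
    obtain ⟨hT'F, hT'A⟩ := Finset.mem_sdiff.1 hT'
    have h1 := K.inter_subset_convexHull (hK.mem_starFinset.1 (hA hT)).1.1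
      (hK.mem_starFinset.1 hT'F).1.1 ⟨hxT, hxT'⟩
    have h2 : ((T : Set (Rd d)) ∩ T') ⊆ {z} := by
      rintro y ⟨hy, hy'⟩
      by_contra hyz
      exact hcon T hT T' hT'F hT'A y hyz hy hy'
    simpa using convexHull_mono h2 h1
  obtain ⟨r₁, hr₁, hcover⟩ : ∃ r₁ > 0, ∀ x ∈ closure Λ, dist x z < r₁ → x ∈ SA ∪ SB := by
    set C : Set (Rd d) := ⋃ T ∈ {T ∈ cells K | z ∉ T}, simplex T with hC
    obtain ⟨T₀, hT₀⟩ := hne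
    have hzT₀ := hK.mem_starFinset.1 (hA hT₀)
    have hCc : IsClosed C := (hK.cells_finite.subset fun _ h => h.1).isClosed_biUnion
      fun T _ => isClosed_simplex T
    have hzC : z ∈ Cᶜ := by
      intro h
      obtain ⟨T, hT, hzT⟩ := mem_iUnion₂.1 h
      exact hT.2 (mem_of_vertex_mem_simplex hzT₀.1 hT.1 hzT₀.2 hzT)
    obtain ⟨r₁, hr₁, hball⟩ := Metric.isOpen_iff.1 hCc.isOpen_compl z hzC
    refine ⟨r₁, hr₁, fun x hx hxz => ?_⟩
    obtain ⟨T, hT, hxT⟩ := hK.exists_mem_simplex hx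
    have hzT : z ∈ T := by
      by_contra h
      exact hball hxz (mem_biUnion (show T ∈ {T ∈ cells K | z ∉ T} from ⟨hT, h⟩) hxT)
    by_cases hTA : T ∈ A
    · exact Or.inl (mem_biUnion hTA hxT)
    · exact Or.inr (mem_biUnion (show T ∈ hK.starFinset z \ A from
        Finset.mem_sdiff.2 ⟨hK.mem_starFinset.2 ⟨hT, hzT⟩, hTA⟩) hxT)
  -- The path must stay within the reach `r` of the cone and within distance `r₁` of `z`, where only
  -- elements with vertex `z` occur.
  set ρ := min r (r₁ / 4) with hρdef
  have hρ : 0 < ρ := lt_min hr (by positivity)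
  have hρr : ρ ≤ r := min_le_left _ _
  have hρr₁ : 4 * ρ ≤ r₁ := by linarith [min_le_right r (r₁ / 4)]
  have hκρ : κ * ρ ≤ ρ := by nlinarith
  obtain ⟨T, hT⟩ := hne
  obtain ⟨T', hT'F, hT'A⟩ : ∃ T' ∈ hK.starFinset z, T' ∉ A := by
    by_contra! h
    exact hA' (hA.antisymm h)
  obtain ⟨hTK, hzT⟩ := hK.mem_starFinset.1 (hA hT)
  obtain ⟨hTK', hzT'⟩ := hK.mem_starFinset.1 hT'F
  obtain ⟨x, hxT, hxz, hxe⟩ := exists_mem_interior_off_line hd hTK hzT e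
    (show 0 < κ * ρ / 2 by positivity)
  obtain ⟨x', hxT', hxz', hxe'⟩ := exists_mem_interior_off_line hd hTK' hzT' e
    (show 0 < κ * ρ / 2 by positivity)
  rw [dist_eq_norm] at hxz hxz'
  have hgood : ∀ y ∈ Λ, ‖y - z‖ < 3 * ρ → y ∈ SA ∪ SB := fun y hy hyz =>
    hcover y (subset_closure hy) (by rw [dist_eq_norm]; linarith)
  have hvert : ∀ y ∈ Λ, ‖y - z‖ < κ * ρ / 2 → (∀ τ : ℝ, y + τ • e ≠ z) →
      ∀ w ∈ segment ℝ y (y + ρ • e), w ∈ SA ∪ SB ∧ w ≠ z := by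
    intro y hy hyz hye w hw
    rw [segment_eq_image'] at hw
    obtain ⟨θ, hθ, rfl⟩ := hw
    have e1 : y + θ • (y + ρ • e - y) = y + (θ * ρ) • e := by module
    have h0 : 0 ≤ θ * ρ := mul_nonneg hθ.1 hρ.le
    have h1 : θ * ρ ≤ ρ := mul_le_of_le_one_left hρ.le hθ.2
    simp only [e1]
    refine ⟨hgood _ ?_ ?_, hye _⟩
    · refine hcone y hy (by rw [dist_eq_norm]; linarith) (θ * ρ) ⟨h0, h1.trans hρr⟩ _ ?_
      simpa using mul_nonneg hκ.le h0
    · calc ‖y + (θ * ρ) • e - z‖ = ‖(y - z) + (θ * ρ) • e‖ := by congr 1; abel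
        _ ≤ ‖y - z‖ + ‖(θ * ρ) • e‖ := norm_add_le _ _
        _ < 3 * ρ := by
          rw [norm_smul, he, Real.norm_of_nonneg h0]
          linarith
  have hhor : ∀ w ∈ segment ℝ (x + ρ • e) (x' + ρ • e), w ∈ SA ∪ SB ∧ w ≠ z := by
    intro w hw
    rw [segment_eq_image'] at hw
    obtain ⟨θ, hθ, rfl⟩ := hw
    have e1 : x + ρ • e + θ • (x' + ρ • e - (x + ρ • e)) = x + (θ • (x' - x) + ρ • e) := by module
    have e2 : x + (θ • (x' - x) + ρ • e) - z = ((1 - θ) • (x - z) + θ • (x' - z)) + ρ • e := by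
      module
    have hb : ‖(1 - θ) • (x - z) + θ • (x' - z)‖ ≤ κ * ρ / 2 := by
      refine (norm_add_le _ _).trans ?_
      rw [norm_smul, norm_smul, Real.norm_of_nonneg hθ.1, Real.norm_of_nonneg (by linarith [hθ.2])]
      nlinarith [hθ.1, hθ.2, norm_nonneg (x - z), norm_nonneg (x' - z)]
    have hρe : ‖ρ • e‖ = ρ := by rw [norm_smul, he, Real.norm_of_nonneg hρ.le, mul_one]
    simp only [e1]
    refine ⟨hgood _ ?_ ?_, fun hz => ?_⟩
    · refine hcone x (hK.interior_simplex_subset hΛ hTK hxT) (by rw [dist_eq_norm]; linarith) ρ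
        ⟨hρ.le, hρr⟩ _ ?_
      rw [add_sub_cancel_right, norm_smul, Real.norm_of_nonneg hθ.1]
      have : ‖x' - x‖ ≤ κ * ρ := by
        rw [show x' - x = (x' - z) - (x - z) by abel]
        linarith [norm_sub_le (x' - z) (x - z)]
      nlinarith [hθ.2, norm_nonneg (x' - x), hθ.1]
    · rw [e2]
      linarith [norm_add_le ((1 - θ) • (x - z) + θ • (x' - z)) (ρ • e)]
    · rw [← sub_eq_zero, e2, add_eq_zero_iff_eq_neg] at hz
      rw [hz, norm_neg, hρe] at hb
      linarith
  -- Up along the cone axis, across, and down again. The vertical parts avoid `z` because their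
  -- endpoints are off the axis line through `z`; the horizontal part does because its distance to
  -- `z` is at least `ρ - κ ρ / 2`.
  set Γ : Set (Rd d) := segment ℝ x (x + ρ • e) ∪
    (segment ℝ (x + ρ • e) (x' + ρ • e) ∪ segment ℝ x' (x' + ρ • e)) with hΓ
  have hΓc : IsPreconnected Γ := by
    refine IsPreconnected.union (x + ρ • e) (right_mem_segment ℝ _ _)
      (Or.inl (left_mem_segment ℝ _ _)) (convex_segment _ _).isPreconnected ?_
    exact IsPreconnected.union (x' + ρ • e) (right_mem_segment ℝ _ _)
      (right_mem_segment ℝ _ _) (convex_segment _ _).isPreconnected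
      (convex_segment _ _).isPreconnected
  have hΓg : ∀ w ∈ Γ, w ∈ SA ∪ SB ∧ w ≠ z := by
    rintro w (hw | hw | hw)
    · exact hvert x (hK.interior_simplex_subset hΛ hTK hxT) hxz hxe w hw
    · exact hhor w hw
    · exact hvert x' (hK.interior_simplex_subset hΛ hTK' hxT') hxz' hxe' w hw
  obtain ⟨w, hwΓ, hwA, hwB⟩ := isPreconnected_closed_iff.1 hΓc SA SB hAc hBc (fun w hw => (hΓg w hw).1)
    ⟨x, Or.inl (left_mem_segment ℝ _ _), mem_biUnion hT (interior_subset hxT)⟩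
    ⟨x', Or.inr (Or.inr (left_mem_segment ℝ _ _)), mem_biUnion (show T' ∈ hK.starFinset z \ A from
        Finset.mem_sdiff.2 ⟨hT'F, hT'A⟩) (interior_subset hxT')⟩
  exact (hΓg w hwΓ).2 (hAB w hwA hwB)

/-- The properties of a shape regular mesh that the interpolation estimates use, with a uniform
constant `R`. -/
structure StarRegular (Λ : Set (Rd d)) (K : Geometry.SimplicialComplex ℝ (Rd d)) (R : ℝ) :
    Prop where
  one_le : 1 ≤ R
  diam_pos : ∀ T ∈ cells K, 0 < Metric.diam (simplex T)
  star_le : ∀ T ∈ cells K, ∀ z ∈ T,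
    Metric.diam (vertexStar K z) ≤ R * Metric.diam (simplex T)
  inball : ∀ T ∈ cells K, ∃ c, Metric.closedBall c (Metric.diam (simplex T) / R) ⊆ simplex T
  card_le : ∀ (z : Rd d) (F : Finset (Finset (Rd d))), (∀ T ∈ F, T ∈ cells K ∧ z ∈ T) →
    (F.card : ℝ) ≤ R
  -- A substitute for star-shapedness. The points of each element, contracted towards `z` by the
  -- factor `1 / R`, see a common ball of size comparable to the star along segments inside the open
  -- star.
  hub : ∀ T₀ ∈ cells K, ∀ z ∈ T₀, ∃ b, ∀ T ∈ cells K, z ∈ T → ∀ x ∈ interior (simplex T),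
    ∀ y ∈ Metric.ball b (Metric.diam (vertexStar K z) / R),
      segment ℝ (z + R⁻¹ • (x - z)) y ⊆ openStar Λ K z

theorem IsMesh.isBounded_vertexStar (hK : IsMesh Ω Λ K) (hΛ : Bornology.IsBounded Λ) (z : Rd d) :
    Bornology.IsBounded (vertexStar K z) := hΛ.closure.subset (hK.vertexStar_subset z)

theorem IsMesh.diam_simplex_le_star (hK : IsMesh Ω Λ K) (hΛ : Bornology.IsBounded Λ)
    (hT : T ∈ cells K) {z : Rd d} (hz : z ∈ T) :
    Metric.diam (simplex T) ≤ Metric.diam (vertexStar K z) :=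
  Metric.diam_mono (simplex_subset_vertexStar hT hz) (hK.isBounded_vertexStar hΛ z)

theorem diam_vertexStar_le {z : Rd d} {M : ℝ} (hM : 0 ≤ M)
    (h : ∀ T ∈ cells K, z ∈ T → Metric.diam (simplex T) ≤ M) :
    Metric.diam (vertexStar K z) ≤ 2 * M := by
  refine Metric.diam_le_of_forall_dist_le (by positivity) fun x hx y hy => ?_
  obtain ⟨T, hT, hzT, hxT⟩ := mem_vertexStar.1 hx
  obtain ⟨T', hT', hzT', hyT'⟩ := mem_vertexStar.1 hy
  have h1 := (norm_sub_le_diam_simplex hxT (vertex_mem_simplex hzT)).trans (h T hT hzT)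
  have h2 := (norm_sub_le_diam_simplex (vertex_mem_simplex hzT') hyT').trans (h T' hT' hzT')
  rw [dist_eq_norm, show x - y = (x - z) + (z - y) by abel]
  linarith [norm_add_le (x - z) (z - y)]

theorem abs_hat_sub_le_of_mem_simplex {R : ℝ} (hR : 0 < R) (hpos : 0 < Metric.diam (simplex T))
    {z : Rd d} (hT : T ∈ cells K)
    (hstar : z ∈ T → Metric.diam (vertexStar K z) ≤ R * Metric.diam (simplex T))
    (hS : 0 < Metric.diam (vertexStar K z))
    (hin : ∃ c, Metric.closedBall c (Metric.diam (simplex T) / R) ⊆ simplex T) {x y : Rd d}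
    (hx : x ∈ simplex T) (hy : y ∈ simplex T) :
    |hat K z x - hat K z y| ≤ R ^ 2 / Metric.diam (vertexStar K z) * ‖x - y‖ := by
  rw [hat_eq_cellCoord hT hx, hat_eq_cellCoord hT hy]
  by_cases hz : z ∈ T
  · obtain ⟨c, hc⟩ := hin
    refine (abs_cellCoord_sub_le hT (by positivity) hc z x y).trans
      (mul_le_mul_of_nonneg_right ?_ (norm_nonneg _))
    rw [one_div, inv_div, div_le_div_iff₀ hpos hS]
    nlinarith [hstar hz]
  · rw [cellCoord_of_notMem hz, cellCoord_of_notMem hz, sub_zero, abs_zero]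
    positivity

/-- In dimension one this is part of shape regularity. Otherwise elements of the star are chained
through common edges; each link costs `4 σ`, and the number of links is bounded by the number of
elements in the star. -/
theorem IsMesh.diam_le_of_common_vertex (hd : 1 ≤ d) (hK : IsMesh Ω Λ K)
    (hΛ : IsBoundedLipschitzDomain Λ) {σ : ℝ} (hσ : 1 ≤ σ) (hKσ : IsShapeRegular σ K)
    (hT : T ∈ cells K) (hT' : T' ∈ cells K) {z : Rd d} (hz : z ∈ T) (hz' : z ∈ T') :
    Metric.diam (simplex T) ≤ (4 * σ) ^ (⌈(4 * σ) ^ d⌉₊ + 1) * Metric.diam (simplex T') := by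
  have hin := fun T hT => hKσ.exists_closedBall_subset hd hσ (T := T) hT
  have hq : 1 ≤ 4 * σ := by linarith
  rcases hd.eq_or_lt with h1 | h2
  · refine (hKσ.neighbours h1.symm T hT T' hT' ⟨z, vertex_mem_simplex hz,
      vertex_mem_simplex hz'⟩).trans ?_
    refine mul_le_mul_of_nonneg_right ?_ Metric.diam_nonneg
    calc σ ≤ 4 * σ := by linarith
      _ ≤ _ := le_self_pow₀ hq (by omega)
  · obtain ⟨r, κ, hr, hκ, hκ1, hcone⟩ := exists_uniform_coneAt hd hΛ
    obtain ⟨e, he, hcone⟩ := hcone z (hK.simplex_subset hT (vertex_mem_simplex hz))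
    refine le_pow_mul_of_chain (hK.starFinset z) (fun T => Metric.diam (simplex T))
      (fun _ _ => Metric.diam_nonneg) hq (fun A hA hne hAF => ?_) (hK.mem_starFinset.2 ⟨hT, hz⟩)
      (hK.mem_starFinset.2 ⟨hT', hz'⟩) ?_
    · obtain ⟨S, hS, S', hS', hS'A, z', hzz', hzS, hzS'⟩ :=
        hK.exists_common_edge h2 hΛ he hr hκ hκ1 hcone hA hne hAF
      obtain ⟨hSK, hS1⟩ := hK.mem_starFinset.1 (hA hS)
      obtain ⟨c, hc⟩ := hin S hSK
      exact ⟨S, hS, S', hS', hS'A, diam_le_of_common_edge (by positivity) hSK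
        (diam_simplex_pos hd hSK) hc hzS hS1 hzz' hzS' (hK.mem_starFinset.1 hS').2⟩
    · have h3 := hK.card_starFinset_le hd (by positivity) hin z
      have h4 := h3.trans (Nat.le_ceil _)
      have h5 : (hK.starFinset z).card ≤ ⌈(4 * σ) ^ d⌉₊ := by exact_mod_cast h4
      omega

-- The hub of `z` is a small ball around `z + ρ e`, with `e` the cone axis at `z` and `ρ` a small
-- multiple of the diameter `H` of the star. A contracted point is within `κ ρ / 2` of `z`, so its
-- difference to any hub point lies in the cone and the segment stays in `Λ`. The hat function of
-- `z` is at least `1/2` at the contracted point and varies by at most `1/4` along the segment, so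
-- the segment stays in the open star.
set_option maxHeartbeats 800000 in
theorem exists_starRegular (hd : 1 ≤ d) (hΛ : IsBoundedLipschitzDomain Λ) (σ : ℝ) :
    ∃ R : ℝ, ∀ K : Geometry.SimplicialComplex ℝ (Rd d), IsMesh Ω Λ K → IsShapeRegular σ K →
      StarRegular Λ K R := by
  -- No lower bound on `σ` is assumed; enlarging it only weakens shape regularity.
  set σ' := max σ 1 with hσ'
  have hσ1 : 1 ≤ σ' := le_max_right _ _
  obtain ⟨r, κ, hr, hκ, hκ1, hcone⟩ := exists_uniform_coneAt hd hΛ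
  set D := Metric.diam (closure Λ)
  have hD : 0 ≤ D := Metric.diam_nonneg
  set Q := (4 * σ') ^ (⌈(4 * σ') ^ d⌉₊ + 1) with hQ
  have hQ0 : 0 < Q := by positivity
  set R₁ := 2 * Q + 4 * σ' + (4 * σ') ^ d with hR₁
  have hd0 : 0 < (4 * σ') ^ d := by positivity
  have hR₁1 : 1 ≤ R₁ := by linarith
  -- The first entry keeps `ρ = α H` below `r / 2`. The second limits the variation of the hat
  -- function, of slope at most `R₁ ^ 2 / H`, over a length `2 ρ` to `1/4`.
  set α := min (r / (2 * (D + 1))) (1 / (8 * R₁ ^ 2)) with hα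
  have hα0 : 0 < α := lt_min (by positivity) (by positivity)
  have hα1 : α * (2 * (D + 1)) ≤ r := (le_div_iff₀ (by positivity)).1 (min_le_left _ _)
  have hα2 : α * (8 * R₁ ^ 2) ≤ 1 := (le_div_iff₀ (by positivity)).1 (min_le_right _ _)
  have hα3 : α ≤ 1 / 8 := by nlinarith [one_le_pow₀ hR₁1 (n := 2)]
  -- Makes both the contracted star and the hub smaller than `κ ρ / 2`, half the width of the cone
  -- at height `ρ`.
  set R := max R₁ (2 / (κ * α)) with hRdef
  have hRR₁ : R₁ ≤ R := le_max_left _ _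
  have hR0 : 0 < R := by linarith
  have hRinv : R⁻¹ ≤ κ * α / 2 := by
    rw [inv_le_comm₀ hR0 (by positivity), inv_div]
    exact le_max_right _ _
  have hRinv0 : 0 < R⁻¹ := inv_pos.2 hR0
  have hκα : κ * α ≤ α := mul_le_of_le_one_left hα0.le hκ1
  refine ⟨R, fun K hK hKσ => ?_⟩
  have hKσ' := hKσ.mono (le_max_left σ 1)
  have hpos : ∀ T ∈ cells K, 0 < Metric.diam (simplex T) := fun T hT => diam_simplex_pos hd hT
  have hin : ∀ T ∈ cells K, ∀ R', 4 * σ' ≤ R' →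
      ∃ c, Metric.closedBall c (Metric.diam (simplex T) / R') ⊆ simplex T := by
    intro T hT R' hR'
    obtain ⟨c, hc⟩ := hKσ'.exists_closedBall_subset hd hσ1 hT
    refine ⟨c, (Metric.closedBall_subset_closedBall ?_).trans hc⟩
    have := (hpos T hT).le
    gcongr
  have hstar : ∀ T ∈ cells K, ∀ z ∈ T,
      Metric.diam (vertexStar K z) ≤ R₁ * Metric.diam (simplex T) := by
    intro T hT z hz
    refine (diam_vertexStar_le (M := Q * Metric.diam (simplex T)) (by positivity)
      fun T' hT' hz' => hK.diam_le_of_common_vertex hd hΛ hσ1 hKσ' hT' hT hz' hz).trans ?_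
    have := (hpos T hT).le
    rw [← mul_assoc]
    gcongr
    linarith
  refine ⟨hR₁1.trans hRR₁, hpos, fun T hT z hz => (hstar T hT z hz).trans
    (mul_le_mul_of_nonneg_right hRR₁ Metric.diam_nonneg), fun T hT => hin T hT R (by linarith),
    fun z F hF => ?_, fun T₀ hT₀ z hz₀ => ?_⟩
  · have h1 := hK.card_starFinset_le hd (by positivity) (fun T hT => hin T hT _ le_rfl) z
    have h2 : F ⊆ hK.starFinset z := fun T hT => hK.mem_starFinset.2 (hF T hT)
    have h3 : (F.card : ℝ) ≤ (hK.starFinset z).card := by exact_mod_cast Finset.card_le_card h2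
    linarith
  · obtain ⟨e, he, hcz⟩ := hcone z (hK.simplex_subset hT₀ (vertex_mem_simplex hz₀))
    set H := Metric.diam (vertexStar K z) with hH
    have hH0 : 0 < H := (hpos T₀ hT₀).trans_le (hK.diam_simplex_le_star hΛ.isBounded hT₀ hz₀)
    have hHD : H ≤ D := Metric.diam_mono (hK.vertexStar_subset z) hΛ.isBounded.closure
    set ρ := α * H with hρ
    have hρ0 : 0 < ρ := by positivity
    have hρr : ρ ≤ r / 2 := by nlinarith
    have hHR : H * R⁻¹ ≤ κ * ρ / 2 := by
      calc H * R⁻¹ ≤ H * (κ * α / 2) := by gcongr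
        _ = κ * ρ / 2 := by rw [hρ]; ring
    have hκρ : κ * ρ ≤ ρ := mul_le_of_le_one_left hρ0.le hκ1
    refine ⟨z + ρ • e, fun T hT hz x hx y hy => ?_⟩
    set x' := z + R⁻¹ • (x - z) with hx'
    have hx'T : x' ∈ interior (simplex T) :=
      (convex_simplex T).add_smul_sub_mem_interior' (subset_closure (vertex_mem_simplex hz)) hx
        ⟨hRinv0, by linarith⟩
    have hx'Λ := hK.interior_simplex_subset hΛ hT hx'T
    have hxz : ‖x' - z‖ ≤ κ * ρ / 2 := by
      rw [hx', add_sub_cancel_left, norm_smul, Real.norm_of_nonneg hRinv0.le, mul_comm]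
      refine le_trans ?_ hHR
      gcongr
      exact (norm_sub_le_diam_simplex (interior_subset hx) (vertex_mem_simplex hz)).trans
        (hK.diam_simplex_le_star hΛ.isBounded hT hz)
    have hyb : ‖y - (z + ρ • e)‖ ≤ κ * ρ / 2 := by
      rw [Metric.mem_ball, dist_eq_norm, div_eq_mul_inv] at hy
      linarith
    have hdir : ‖y - x' - ρ • e‖ ≤ κ * ρ := by
      rw [show y - x' - ρ • e = (y - (z + ρ • e)) - (x' - z) by abel]
      linarith [norm_sub_le (y - (z + ρ • e)) (x' - z)]
    have hlen : ‖y - x'‖ ≤ 2 * ρ := by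
      have h1 : ‖ρ • e‖ = ρ := by rw [norm_smul, he, Real.norm_of_nonneg hρ0.le, mul_one]
      have h2 := norm_add_le (y - x' - ρ • e) (ρ • e)
      rw [sub_add_cancel] at h2
      linarith
    have hsegΛ : ∀ θ ∈ Icc (0 : ℝ) 1, x' + θ • (y - x') ∈ Λ := by
      intro θ hθ
      refine hcz x' hx'Λ (by rw [dist_eq_norm]; linarith) (θ * ρ)
        ⟨mul_nonneg hθ.1 hρ0.le, by nlinarith [hθ.2]⟩ _ ?_
      rw [mul_smul, ← smul_sub, norm_smul, Real.norm_of_nonneg hθ.1]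
      calc θ * ‖y - x' - ρ • e‖ ≤ θ * (κ * ρ) := mul_le_mul_of_nonneg_left hdir hθ.1
        _ = _ := by ring
    intro p hp
    rw [segment_eq_image'] at hp
    obtain ⟨θ, hθ, rfl⟩ := hp
    refine ⟨hsegΛ θ hθ, ?_⟩
    have hLip := hK.abs_sub_le_of_segment (f := hat K z) (L := R₁ ^ 2 / H) (x := x')
      (y := x' + θ • (y - x')) (fun S hS _ a ha b hb => abs_hat_sub_le_of_mem_simplex
        (by linarith) (hpos S hS) hS (fun h => hstar S hS z h) hH0
        (hin S hS R₁ (by linarith)) ha hb) (by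
        intro w hw
        rw [segment_eq_image'] at hw
        obtain ⟨θ', hθ', rfl⟩ := hw
        have : x' + θ' • (x' + θ • (y - x') - x') = x' + (θ' * θ) • (y - x') := by module
        simp only [this]
        exact subset_closure (hsegΛ _ ⟨mul_nonneg hθ'.1 hθ.1, mul_le_one₀ hθ'.2 hθ.1 hθ.2⟩))
    have h1 : ‖x' - (x' + θ • (y - x'))‖ ≤ 2 * ρ := by
      rw [sub_add_cancel_left, norm_neg, norm_smul, Real.norm_of_nonneg hθ.1]
      exact (mul_le_of_le_one_left (norm_nonneg _) hθ.2).trans hlen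
    have h2 : R₁ ^ 2 / H * ‖x' - (x' + θ • (y - x'))‖ ≤ 1 / 4 := by
      calc R₁ ^ 2 / H * ‖x' - (x' + θ • (y - x'))‖ ≤ R₁ ^ 2 / H * (2 * ρ) := by gcongr
        _ = 2 * (α * R₁ ^ 2) := by rw [hρ]; field_simp
        _ ≤ 1 / 4 := by linarith
    have h3 : 1 / 2 ≤ hat K z x' := by
      classical
      rw [hat_eq_cellCoord hT (interior_subset hx'T)]
      have e1 : x' = AffineMap.lineMap z x R⁻¹ := by
        rw [hx', AffineMap.lineMap_apply]
        simp [add_comm]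
      rw [e1, AffineMap.apply_lineMap, AffineMap.lineMap_apply, cellCoord_vertex hT hz, if_pos rfl]
      have h4 := (mem_interior_simplex_iff hT).1 hx z hz
      simp only [vsub_eq_sub, smul_eq_mul, vadd_eq_add]
      have h5 := mul_nonneg hRinv0.le h4.le
      linarith
    have h4 := (abs_le.1 (hLip.trans h2)).2
    linarith

end Stars

/-! ### Poincaré inequalities on stars -/

section Poincare

variable {d : ℕ} {K : Geometry.SimplicialComplex ℝ (Rd d)} {T T' : Finset (Rd d)}
  {Ω Λ : Set (Rd d)} {F : Type} [NormedAddCommGroup F] [NormedSpace ℝ F]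

/-- The complement is the projection of a closed set along the compact interval `[0, 1]`. -/
theorem isOpen_setOf_segment_subset {W : Set (Rd d)} (hW : IsOpen W) :
    IsOpen {p : Rd d × Rd d | segment ℝ p.1 p.2 ⊆ W} := by
  set γ : (Rd d × Rd d) × Icc (0 : ℝ) 1 → Rd d := fun q => q.1.1 + (q.2 : ℝ) • (q.1.2 - q.1.1)
  have hγ : Continuous γ := by fun_prop
  have h1 : IsClosed (Prod.fst '' (γ ⁻¹' Wᶜ)) :=
    isClosedMap_fst_of_compactSpace _ (hW.isClosed_compl.preimage hγ)
  convert h1.isOpen_compl using 1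
  ext p
  constructor
  · rintro hp ⟨⟨p', τ⟩, hq, rfl⟩
    exact hq (hp (mem_segment_add_smul τ.2))
  · intro hp w hw
    rw [segment_eq_image'] at hw
    obtain ⟨τ, hτ, rfl⟩ := hw
    by_contra h
    exact hp ⟨(p, ⟨τ, hτ⟩), h, rfl⟩

theorem IsWeakFDeriv.congr_ae {U : Set (Rd d)} {v w : Rd d → F} {v' : Rd d → (Rd d →L[ℝ] F)}
    (hU : IsOpen U) (h : IsWeakFDeriv U v v') (hvw : v =ᵐ[volume.restrict U] w) :
    IsWeakFDeriv U w v' where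
  locInt := by
    have h1 := (locallyIntegrableOn_iff hU.isLocallyClosed).1 h.locInt
    refine (locallyIntegrableOn_iff hU.isLocallyClosed).2 fun k hk hkc => ?_
    exact (h1 k hk hkc).congr (ae_restrict_of_ae_restrict_of_subset hk hvw)
  locInt_deriv := h.locInt_deriv
  integral_eq φ hφ hφc hφs y := by
    rw [← h.integral_eq φ hφ hφc hφs y]
    refine integral_congr_ae ?_
    filter_upwards [hvw] with x hx
    rw [hx]

/-- Some `y` does no worse than the average over `B`; this produces the constants in the Poincaré
inequalities. -/
theorem exists_mul_lintegral_le {S B : Set (Rd d)} (hB0 : volume B ≠ 0) (hBt : volume B ≠ ∞)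
    {f : Rd d × Rd d → ℝ≥0∞}
    (hf : AEMeasurable f ((volume.restrict S).prod (volume.restrict B))) :
    ∃ y ∈ B, volume B * ∫⁻ x in S, f (x, y) ≤ ∫⁻ p in S ×ˢ B, f p := by
  obtain ⟨y, hy, hle⟩ := exists_le_setLAverage (μ := volume) (s := B) hB0 hBt
    (f := fun y => ∫⁻ x in S, f (x, y)) hf.lintegral_prod_left'
  refine ⟨y, hy, ?_⟩
  rw [setLAverage_eq, ENNReal.le_div_iff_mul_le (Or.inl hB0) (Or.inl hBt)] at hle
  rw [mul_comm]
  refine hle.trans (le_of_eq ?_)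
  rw [Measure.volume_eq_prod, ← Measure.prod_restrict, lintegral_prod_symm _ hf]

/-- The triangle inequality integrated over the intermediate point in `Y`. It links two regions
whose connecting segments are not under control. -/
theorem mul_lintegral_prod_le_chain {X Y Z : Set (Rd d)} {f : Rd d × Rd d → ℝ≥0∞}
    (hf : Measurable f) (htri : ∀ x y z, f (x, z) ≤ f (x, y) + f (y, z)) :
    volume Y * ∫⁻ p in X ×ˢ Z, f p ≤
      volume Z * (∫⁻ p in X ×ˢ Y, f p) + volume X * ∫⁻ p in Y ×ˢ Z, f p := by
  have hg : Measurable fun x => ∫⁻ y in Y, f (x, y) := hf.lintegral_prod_right'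
  have hh : Measurable fun z => ∫⁻ y in Y, f (y, z) := hf.lintegral_prod_left'
  simp only [Measure.volume_eq_prod, ← Measure.prod_restrict]
  rw [lintegral_prod _ hf.aemeasurable, lintegral_prod _ hf.aemeasurable,
    lintegral_prod_symm _ hf.aemeasurable (μ := volume.restrict Y)]
  calc volume Y * ∫⁻ x in X, ∫⁻ z in Z, f (x, z)
      = ∫⁻ x in X, ∫⁻ z in Z, volume Y * f (x, z) := by
        have h1 : ∀ x, ∫⁻ z in Z, volume Y * f (x, z) = volume Y * ∫⁻ z in Z, f (x, z) :=
          fun x => lintegral_const_mul _ (hf.comp measurable_prodMk_left)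
        simp only [h1]
        exact (lintegral_const_mul _ hf.lintegral_prod_right').symm
    _ ≤ ∫⁻ x in X, ∫⁻ z in Z, ((∫⁻ y in Y, f (x, y)) + ∫⁻ y in Y, f (y, z)) := by
        refine lintegral_mono fun x => lintegral_mono fun z => ?_
        have hm : Measurable fun y => f (x, y) := hf.comp measurable_prodMk_left
        rw [← lintegral_add_left hm]
        calc volume Y * f (x, z) = ∫⁻ _ in Y, f (x, z) := by
              rw [lintegral_const, Measure.restrict_apply_univ, mul_comm]
          _ ≤ _ := lintegral_mono fun y => htri x y z
    _ = _ := by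
        have h1 : ∀ x, ∫⁻ z in Z, ((∫⁻ y in Y, f (x, y)) + ∫⁻ y in Y, f (y, z)) =
            volume Z * (∫⁻ y in Y, f (x, y)) + ∫⁻ z in Z, ∫⁻ y in Y, f (y, z) := by
          intro x
          rw [lintegral_add_left measurable_const, lintegral_const, Measure.restrict_apply_univ,
            mul_comm]
        simp only [h1]
        rw [lintegral_add_left (hg.const_mul _), lintegral_const_mul _ hg, lintegral_const,
          Measure.restrict_apply_univ, mul_comm (volume X)]

theorem IsMesh.vertexStar_ae_eq (hK : IsMesh Ω Λ K) (z : Rd d) :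
    vertexStar K z =ᵐ[volume] ⋃ T ∈ hK.starFinset z, interior (simplex T) := by
  have h1 : vertexStar K z = ⋃ T ∈ hK.starFinset z, simplex T := by
    ext x
    simp only [mem_vertexStar, mem_iUnion, hK.mem_starFinset, exists_prop, and_assoc]
  rw [h1]
  exact Filter.EventuallyEq.biUnion (hK.starFinset z).finite_toSet fun T _ => simplex_ae_eq_interior T

theorem IsMesh.openStar_ae_eq (hK : IsMesh Ω Λ K) (hΛ : IsBoundedLipschitzDomain Λ) (z : Rd d) :
    openStar Λ K z =ᵐ[volume] vertexStar K z := by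
  refine Filter.EventuallyLE.antisymm
    (LE.le.eventuallyLE (openStar_subset_vertexStar z)) ?_
  refine (hK.vertexStar_ae_eq z).le.trans (LE.le.eventuallyLE ?_)
  refine iUnion₂_subset fun T hT => ?_
  obtain ⟨hTK, hz⟩ := hK.mem_starFinset.1 hT
  exact hK.interior_simplex_subset_openStar hΛ hTK hz

/-- Double counting: every element belongs to the stars of exactly `d + 1` vertices. -/
theorem IsMesh.sum_star_lintegral_le (hK : IsMesh Ω Λ K) {α : Type*} [MeasurableSpace α]
    (μ : Measure α) (A : Finset (Rd d) → Set α) (hA : ∀ T ∈ cells K, MeasurableSet (A T))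
    (hdisj : (cells K).PairwiseDisjoint A) {E : Set α} (hE : ∀ T ∈ cells K, A T ⊆ E)
    (f : α → ℝ≥0∞) :
    ∑ z ∈ hK.vertFinset, ∫⁻ x in ⋃ T ∈ hK.starFinset z, A T, f x ∂μ ≤
      (d + 1) * ∫⁻ x in E, f x ∂μ := by
  classical
  have hsub : ∀ z, ∀ T ∈ hK.starFinset z, T ∈ cells K := fun z T hT => (hK.mem_starFinset.1 hT).1
  calc _ = ∑ z ∈ hK.vertFinset, ∑ T ∈ hK.starFinset z, ∫⁻ x in A T, f x ∂μ := by
        refine Finset.sum_congr rfl fun z _ => lintegral_biUnion_finset (hdisj.subset (hsub z))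
          (fun T hT => hA T (hsub z T hT)) f
    _ = ∑ T ∈ hK.cellFinset, ∑ z ∈ T, ∫⁻ x in A T, f x ∂μ := by
        refine Finset.sum_comm' fun z T => ?_
        simp only [hK.mem_vertFinset, hK.mem_starFinset, hK.mem_cellFinset]
        exact ⟨fun h => ⟨h.2.2, h.2.1⟩, fun h => ⟨⟨T, h.2, h.1⟩, h.2, h.1⟩⟩
    _ = ∑ T ∈ hK.cellFinset, (d + 1) * ∫⁻ x in A T, f x ∂μ := by
        refine Finset.sum_congr rfl fun T hT => ?_
        rw [Finset.sum_const, (hK.mem_cellFinset.1 hT).2, nsmul_eq_mul]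
        push_cast
        rfl
    _ = (d + 1) * ∫⁻ x in ⋃ T ∈ hK.cellFinset, A T, f x ∂μ := by
        rw [← Finset.mul_sum, lintegral_biUnion_finset]
        · exact hdisj.subset fun T hT => hK.mem_cellFinset.1 hT
        · exact fun T hT => hA T (hK.mem_cellFinset.1 hT)
    _ ≤ _ := by
        gcongr
        exact iUnion₂_subset fun T hT => hE T (hK.mem_cellFinset.1 hT)

theorem IsMesh.sum_lintegral_vertexStar_le (hK : IsMesh Ω Λ K) (hΛ : IsBoundedLipschitzDomain Λ)
    (f : Rd d → ℝ≥0∞) :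
    ∑ z ∈ hK.vertFinset, ∫⁻ x in vertexStar K z, f x ≤ (d + 1) * ∫⁻ x in Λ, f x := by
  have := hK.sum_star_lintegral_le volume (fun T => interior (simplex T))
    (fun T _ => isOpen_interior.measurableSet) (fun T hT T' hT' h =>
      (disjoint_interior_simplex hT hT' h).mono_right interior_subset)
    (fun T hT => hK.interior_simplex_subset hΛ hT) f
  refine le_trans (le_of_eq (Finset.sum_congr rfl fun z _ => ?_)) this
  exact setLIntegral_congr (hK.vertexStar_ae_eq z)

/-- Only the first factor needs to be decomposed into elements; the second is simply enlarged to
`Λ`. -/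
theorem IsMesh.sum_lintegral_vertexStar_prod_le (hK : IsMesh Ω Λ K)
    (hΛ : IsBoundedLipschitzDomain Λ) (f : Rd d × Rd d → ℝ≥0∞) :
    ∑ z ∈ hK.vertFinset, ∫⁻ p in vertexStar K z ×ˢ vertexStar K z, f p ≤
      (d + 1) * ∫⁻ p in Λ ×ˢ Λ, f p := by
  have := hK.sum_star_lintegral_le volume (fun T => interior (simplex T) ×ˢ Λ)
    (fun T _ => (isOpen_interior.prod hΛ.isOpen).measurableSet) (fun T hT T' hT' h =>
      Disjoint.set_prod_left ((disjoint_interior_simplex hT hT' h).mono_right interior_subset) _ _)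
    (E := Λ ×ˢ Λ) (fun T hT => prod_mono (hK.interior_simplex_subset hΛ hT) subset_rfl) f
  refine le_trans (Finset.sum_le_sum fun z _ => ?_) this
  have h1 : vertexStar K z ×ˢ vertexStar K z =ᵐ[(volume : Measure (Rd d × Rd d))]
      (⋃ T ∈ hK.starFinset z, interior (simplex T)) ×ˢ
      (⋃ T ∈ hK.starFinset z, interior (simplex T)) :=
    Measure.set_prod_ae_eq (hK.vertexStar_ae_eq z) (hK.vertexStar_ae_eq z)
  rw [setLIntegral_congr h1]
  refine lintegral_mono_set ?_
  rintro ⟨x, y⟩ ⟨hx, hy⟩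
  obtain ⟨T, hT, hxT⟩ := mem_iUnion₂.1 hx
  obtain ⟨T', hT', hyT⟩ := mem_iUnion₂.1 hy
  exact mem_biUnion hT ⟨hxT, hK.interior_simplex_subset hΛ (hK.mem_starFinset.1 hT').1 hyT⟩

/-! #### Volumes -/

theorem volume_closedBall_eq (hd : 1 ≤ d) (b : Rd d) {H c : ℝ} (hH : 0 ≤ H) (hc : 0 ≤ c) :
    volume (Metric.closedBall b (c * H)) = ENNReal.ofReal c ^ d * volume (Metric.closedBall b H) := by
  have : Nontrivial (Rd d) := Module.nontrivial_of_finrank_pos (R := ℝ) (by simp; omega)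
  rw [Measure.addHaar_closedBall volume b hH, Measure.addHaar_closedBall volume b (by positivity),
    finrank_euclideanSpace_fin, mul_pow, ENNReal.ofReal_mul (by positivity), mul_assoc,
    ENNReal.ofReal_pow hc]

theorem volume_closedBall_center (b b' : Rd d) (H : ℝ) :
    volume (Metric.closedBall b H) = volume (Metric.closedBall b' H) :=
  (Measure.addHaar_closedBall_center volume b H).trans
    (Measure.addHaar_closedBall_center volume b' H).symm

variable {R : ℝ}

theorem StarRegular.star_pos (hR : StarRegular Λ K R) (hK : IsMesh Ω Λ K)
    (hΛ : Bornology.IsBounded Λ) (hT : T ∈ cells K) {z : Rd d} (hz : z ∈ T) :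
    0 < Metric.diam (vertexStar K z) :=
  (hR.diam_pos T hT).trans_le (hK.diam_simplex_le_star hΛ hT hz)

theorem IsMesh.vertexStar_subset_closedBall (hK : IsMesh Ω Λ K)
    (hΛ : Bornology.IsBounded Λ) (hT : T ∈ cells K) {z : Rd d} (hz : z ∈ T) :
    vertexStar K z ⊆ Metric.closedBall z (Metric.diam (vertexStar K z)) := fun _ hx =>
  Metric.dist_le_diam_of_mem (hK.isBounded_vertexStar hΛ z) hx
    (simplex_subset_vertexStar hT hz (vertex_mem_simplex hz))

/-- The volume of an element is comparable to that of a ball around the star of a vertex. -/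
theorem StarRegular.volume_closedBall_le (hd : 1 ≤ d) (hR : StarRegular Λ K R)
    (hT : T ∈ cells K) {z : Rd d} (hz : z ∈ T) :
    volume (Metric.closedBall z (Metric.diam (vertexStar K z))) ≤
      ENNReal.ofReal R ^ (2 * d) * volume (simplex T) := by
  have hR0 : 0 < R := one_pos.trans_le hR.one_le
  obtain ⟨c, hc⟩ := hR.inball T hT
  have h1 := hR.star_le T hT z hz
  have h2 := hR.diam_pos T hT
  calc _ ≤ volume (Metric.closedBall z (R ^ 2 * (Metric.diam (simplex T) / R))) := by
        refine measure_mono (Metric.closedBall_subset_closedBall (h1.trans (le_of_eq ?_)))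
        field_simp
    _ = ENNReal.ofReal R ^ (2 * d) *
        volume (Metric.closedBall c (Metric.diam (simplex T) / R)) := by
        rw [volume_closedBall_eq hd z (by positivity) (by positivity), ENNReal.ofReal_pow hR0.le,
          ← pow_mul, volume_closedBall_center z c]
    _ ≤ _ := by gcongr

theorem enorm_sub_triangle (w : Rd d → F) (A : Rd d →L[ℝ] F) (x y z : Rd d) :
    ‖w x - w z - A (x - z)‖ₑ ≤ ‖w x - w y - A (x - y)‖ₑ + ‖w y - w z - A (y - z)‖ₑ := by
  refine le_trans (le_of_eq ?_) (enorm_add_le _ _)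
  congr 1
  simp only [map_sub]
  abel

/-- The element is linked to the ball `B` through its contraction `X'` towards `z`: segments from
`X` to `X'` stay in the element by convexity, those from `X'` to `B` stay in the open star by `hb`.
In `R ^ (3 * d)`, `2 * d` comes from comparing the ball around the star with the element and `d`
from the contraction. -/
theorem StarRegular.lintegral_cell_prod_le [CompleteSpace F] (hd : 1 ≤ d)
    (hR : StarRegular Λ K R) (hK : IsMesh Ω Λ K) (hΛ : IsBoundedLipschitzDomain Λ)
    {v : Rd d → F} (hvm : StronglyMeasurable v)
    {v' : Rd d → (Rd d →L[ℝ] F)} (hv : IsWeakFDeriv Λ v v') (A : Rd d →L[ℝ] F)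
    (hT : T ∈ cells K) {z b : Rd d} (hz : z ∈ T)
    (hb : ∀ x ∈ interior (simplex T), ∀ y ∈ Metric.ball b (Metric.diam (vertexStar K z) / R),
      segment ℝ (z + R⁻¹ • (x - z)) y ⊆ openStar Λ K z) :
    ∫⁻ p in simplex T ×ˢ Metric.ball b (Metric.diam (vertexStar K z) / R),
      ‖v p.1 - v p.2 - A (p.1 - p.2)‖ₑ ≤ ENNReal.ofReal R ^ (3 * d) * 2 ^ (d + 2) *
        ENNReal.ofReal (Metric.diam (vertexStar K z)) *
        volume (Metric.closedBall z (Metric.diam (vertexStar K z))) *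
        ∫⁻ x in vertexStar K z, ‖v' x - A‖ₑ := by
  have : Nontrivial (Rd d) := Module.nontrivial_of_finrank_pos (R := ℝ) (by simp; omega)
  have hR0 : 0 < R := one_pos.trans_le hR.one_le
  set H := Metric.diam (vertexStar K z) with hH
  have hH0 : 0 < H := hR.star_pos hK hΛ.isBounded hT hz
  set B := Metric.ball b (H / R) with hB
  set V := volume (Metric.closedBall z H) with hV
  have hV0 : V ≠ 0 := (Metric.measure_closedBall_pos volume z hH0).ne'
  have hVt : V ≠ ∞ := measure_closedBall_lt_top.ne
  set X := interior (simplex T) with hX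
  set X' := (AffineMap.homothety z R⁻¹) '' X with hX'
  have hRinv : R⁻¹ ∈ Ioc (0 : ℝ) 1 := ⟨inv_pos.2 hR0, inv_le_one_of_one_le₀ hR.one_le⟩
  have hhom : ∀ x, AffineMap.homothety z R⁻¹ x = z + R⁻¹ • (x - z) := fun x => by
    rw [AffineMap.homothety_apply, vsub_eq_sub, vadd_eq_add, add_comm]
  have hX'X : X' ⊆ X := by
    rintro _ ⟨x, hx, rfl⟩
    rw [hhom]
    exact (convex_simplex T).add_smul_sub_mem_interior' (subset_closure (vertex_mem_simplex hz)) hx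
      hRinv
  have hX'm : MeasurableSet X' := by
    refine IsOpen.measurableSet ?_
    exact AffineMap.homothety_isOpenMap z R⁻¹ hRinv.1.ne' _ isOpen_interior
  have hXm : MeasurableSet X := isOpen_interior.measurableSet
  have hBm : MeasurableSet B := Metric.isOpen_ball.measurableSet
  set W := openStar Λ K z with hW
  have hWo : IsOpen W := hK.isOpen_openStar hΛ.isOpen z
  have hWS : W ⊆ vertexStar K z := openStar_subset_vertexStar z
  have hXW : X ⊆ W := hK.interior_simplex_subset_openStar hΛ hT hz
  have hXne : X.Nonempty := interior_simplex_nonempty hT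
  have hBW : B ⊆ W := fun y hy => by
    obtain ⟨x, hx⟩ := hXne
    exact hb x hx y hy (right_mem_segment ℝ _ _)
  have hdist : ∀ x ∈ W, ∀ y ∈ W, ‖x - y‖ ≤ H := fun x hx y hy => by
    rw [← dist_eq_norm]
    exact Metric.dist_le_diam_of_mem (hK.isBounded_vertexStar hΛ.isBounded z) (hWS hx) (hWS hy)
  have hWV : volume W ≤ V := measure_mono (hWS.trans
    (hK.vertexStar_subset_closedBall hΛ.isBounded hT hz))
  set J := ∫⁻ x in W, ‖v' x - A‖ₑ with hJ
  set f : Rd d × Rd d → ℝ≥0∞ := fun p => ‖v p.1 - v p.2 - A (p.1 - p.2)‖ₑ with hf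
  have hfm : Measurable f := by
    refine StronglyMeasurable.enorm ?_
    refine ((hvm.comp_measurable measurable_fst).sub (hvm.comp_measurable measurable_snd)).sub ?_
    exact (A.continuous.comp (continuous_fst.sub continuous_snd)).stronglyMeasurable
  have h1 : ∫⁻ p in X ×ˢ X', f p ≤ ENNReal.ofReal H * (2 ^ d * (V + V)) * J := by
    refine (lintegral_prod_sub_le hWo (fun x hx => hx.1) hv A hXm hX'm (fun x hx y hy => ?_)
      (D := H) fun x hx y hy => hdist x (hXW hx) y (hXW (hX'X hy))).trans ?_
    · exact ((convex_simplex T).interior.segment_subset hx (hX'X hy)).trans hXW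
    · gcongr
      · exact (measure_mono hXW).trans hWV
      · exact (measure_mono (hX'X.trans hXW)).trans hWV
  have h2 : ∫⁻ p in X' ×ˢ B, f p ≤ ENNReal.ofReal H * (2 ^ d * (V + V)) * J := by
    refine (lintegral_prod_sub_le hWo (fun x hx => hx.1) hv A hX'm hBm (fun x hx y hy => ?_)
      (D := H) fun x hx y hy => hdist x (hXW (hX'X hx)) y (hBW hy)).trans ?_
    · obtain ⟨x₀, hx₀, rfl⟩ := hx
      rw [hhom]
      exact hb x₀ hx₀ y hy
    · gcongr
      · exact (measure_mono (hX'X.trans hXW)).trans hWV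
      · exact (measure_mono hBW).trans hWV
  have h3 := mul_lintegral_prod_le_chain (X := X) (Y := X') (Z := B) hfm
    (enorm_sub_triangle v A)
  have hVX' : V ≤ ENNReal.ofReal R ^ (3 * d) * volume X' := by
    refine (hR.volume_closedBall_le hd hT hz).trans ?_
    rw [hX', Measure.addHaar_image_homothety, finrank_euclideanSpace_fin,
      abs_of_nonneg (by positivity), measure_congr (simplex_ae_eq_interior T), ← mul_assoc]
    refine mul_le_mul_left (le_of_eq ?_) _
    rw [show 3 * d = 2 * d + d by ring, pow_add, mul_assoc, ENNReal.ofReal_pow hRinv.1.le, ← mul_pow,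
      ← ENNReal.ofReal_mul hR0.le, mul_inv_cancel₀ hR0.ne', ENNReal.ofReal_one, one_pow, mul_one]
  have h4 : ∫⁻ p in simplex T ×ˢ B, f p = ∫⁻ p in X ×ˢ B, f p :=
    setLIntegral_congr (Measure.set_prod_ae_eq (simplex_ae_eq_interior T)
      (Filter.EventuallyEq.rfl))
  have h5 : V * ∫⁻ p in X ×ˢ B, f p ≤ V * (ENNReal.ofReal R ^ (3 * d) * 2 ^ (d + 2) *
        ENNReal.ofReal H * V * J) := by
    calc V * ∫⁻ p in X ×ˢ B, f p
        ≤ ENNReal.ofReal R ^ (3 * d) * (volume X' * ∫⁻ p in X ×ˢ B, f p) := by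
          rw [← mul_assoc]; gcongr
      _ ≤ ENNReal.ofReal R ^ (3 * d) * (V * (ENNReal.ofReal H * (2 ^ d * (V + V)) * J) +
          V * (ENNReal.ofReal H * (2 ^ d * (V + V)) * J)) := by
          refine mul_le_mul_right (h3.trans ?_) _
          gcongr
          · exact (measure_mono hBW).trans hWV
          · exact (measure_mono hXW).trans hWV
      _ = _ := by ring
  rw [ENNReal.mul_le_mul_iff_right hV0 hVt] at h5
  rw [h4]
  refine h5.trans (mul_le_mul_right ?_ _)
  exact lintegral_mono_set hWS

theorem IsMesh.lintegral_star_prod_le (hK : IsMesh Ω Λ K) {z : Rd d} {B : Set (Rd d)}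
    {f : Rd d × Rd d → ℝ≥0∞} {M : ℝ≥0∞} (hR : StarRegular Λ K R)
    (h : ∀ T ∈ cells K, z ∈ T → ∫⁻ p in simplex T ×ˢ B, f p ≤ M) :
    ∫⁻ p in vertexStar K z ×ˢ B, f p ≤ ENNReal.ofReal R * M := by
  have h1 : vertexStar K z ×ˢ B = ⋃ T : hK.starFinset z, simplex T.1 ×ˢ B := by
    ext p
    simp only [mem_prod, mem_vertexStar, mem_iUnion, Subtype.exists, hK.mem_starFinset, exists_prop]
    tauto
  rw [h1]
  refine (lintegral_iUnion_le _ _).trans ?_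
  rw [tsum_fintype]
  calc _ ≤ ∑ _T : hK.starFinset z, M := Finset.sum_le_sum fun T _ => by
        obtain ⟨hT, hz⟩ := hK.mem_starFinset.1 T.2
        exact h T hT hz
    _ = ((hK.starFinset z).card : ℝ≥0∞) * M := by simp
    _ ≤ _ := by
        gcongr
        rw [← ENNReal.ofReal_natCast]
        exact ENNReal.ofReal_le_ofReal (hR.card_le z _ fun T hT => hK.mem_starFinset.1 hT)

theorem StarRegular.volume_closedBall_le_hub (hd : 1 ≤ d) (hR : StarRegular Λ K R) (z b : Rd d) :
    volume (Metric.closedBall z (Metric.diam (vertexStar K z))) ≤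
      ENNReal.ofReal R ^ d * volume (Metric.ball b (Metric.diam (vertexStar K z) / R)) := by
  have : Nontrivial (Rd d) := Module.nontrivial_of_finrank_pos (R := ℝ) (by simp; omega)
  have hR0 : 0 < R := one_pos.trans_le hR.one_le
  rw [← Measure.addHaar_closedBall_eq_addHaar_ball volume, volume_closedBall_center b z,
    ← volume_closedBall_eq hd z (by positivity) hR0.le]
  refine le_of_eq ?_
  congr 2
  field_simp

/-- The Poincaré inequality on the star of a vertex. -/
theorem StarRegular.poincare [CompleteSpace F] (hd : 1 ≤ d)
    (hR : StarRegular Λ K R) (hK : IsMesh Ω Λ K) (hΛ : IsBoundedLipschitzDomain Λ)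
    {v : Rd d → F} {v' : Rd d → (Rd d →L[ℝ] F)} (hv : IsWeakFDeriv Λ v v') (A : Rd d →L[ℝ] F)
    (hT : T ∈ cells K) {z : Rd d} (hz : z ∈ T) :
    ∃ c : F, ∫⁻ x in vertexStar K z, ‖v x - A x - c‖ₑ ≤ ENNReal.ofReal (R ^ (4 * d + 1) *
      2 ^ (d + 2) * Metric.diam (vertexStar K z)) * ∫⁻ x in vertexStar K z, ‖v' x - A‖ₑ := by
  have : Nontrivial (Rd d) := Module.nontrivial_of_finrank_pos (R := ℝ) (by simp; omega)
  have hR0 : 0 < R := one_pos.trans_le hR.one_le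
  have hvl : AEStronglyMeasurable v (volume.restrict Λ) := by
    exact hv.locInt.aestronglyMeasurable
  -- A strongly measurable representative, so that the integrand on pairs is measurable everywhere.
  -- It has the same weak derivative.
  set w := hvl.mk v with hw
  have hvw : v =ᵐ[volume.restrict Λ] w := hvl.ae_eq_mk
  have hwm : StronglyMeasurable w := hvl.stronglyMeasurable_mk
  have hw' := hv.congr_ae hΛ.isOpen hvw
  set H := Metric.diam (vertexStar K z) with hH
  have hH0 : 0 < H := hR.star_pos hK hΛ.isBounded hT hz
  obtain ⟨b, hb⟩ := hR.hub T hT z hz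
  set B := Metric.ball b (H / R) with hB
  have hB0 : volume B ≠ 0 := (Metric.measure_ball_pos volume b (by positivity)).ne'
  have hBt : volume B ≠ ∞ := measure_ball_lt_top.ne
  set V := volume (Metric.closedBall z H) with hV
  have hV0 : V ≠ 0 := (Metric.measure_closedBall_pos volume z hH0).ne'
  have hVt : V ≠ ∞ := measure_closedBall_lt_top.ne
  set f : Rd d × Rd d → ℝ≥0∞ := fun p => ‖w p.1 - w p.2 - A (p.1 - p.2)‖ₑ with hf
  have hfm : Measurable f := by
    refine StronglyMeasurable.enorm ?_
    refine ((hwm.comp_measurable measurable_fst).sub (hwm.comp_measurable measurable_snd)).sub ?_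
    exact (A.continuous.comp (continuous_fst.sub continuous_snd)).stronglyMeasurable
  have h1 := hK.lintegral_star_prod_le (B := B) (f := f) hR fun S hS hzS =>
    hR.lintegral_cell_prod_le hd hK hΛ hwm hw' A hS hzS (hb S hS hzS)
  obtain ⟨y, -, hy⟩ := exists_mul_lintegral_le (S := vertexStar K z) hB0 hBt hfm.aemeasurable
  refine ⟨w y - A y, ?_⟩
  set I := ∫⁻ x in vertexStar K z, ‖v x - A x - (w y - A y)‖ₑ with hI
  have hIeq : I = ∫⁻ x in vertexStar K z, f (x, y) := by
    rw [hI, ← setLIntegral_congr (hK.openStar_ae_eq hΛ z),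
      ← setLIntegral_congr (hK.openStar_ae_eq hΛ z)]
    refine lintegral_congr_ae ?_
    filter_upwards [ae_restrict_of_ae_restrict_of_subset (fun x hx => hx.1 : openStar Λ K z ⊆ Λ) hvw]
      with x hx
    rw [hx, hf]
    simp only [map_sub]
    congr 1
    abel
  -- The exponent `4 * d + 1` collects `3 * d` from one element, `1` from the number of elements in
  -- the star and `d` from the volume of the hub.
  have h2 : V * I ≤ V * (ENNReal.ofReal (R ^ (4 * d + 1) * 2 ^ (d + 2) * H) *
      ∫⁻ x in vertexStar K z, ‖v' x - A‖ₑ) := by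
    calc V * I ≤ ENNReal.ofReal R ^ d * (volume B * I) := by
          rw [← mul_assoc]
          exact mul_le_mul_left (hR.volume_closedBall_le_hub hd z b) _
      _ ≤ ENNReal.ofReal R ^ d * _ := mul_le_mul_right ((hIeq ▸ hy).trans h1) _
      _ = _ := by
          rw [ENNReal.ofReal_mul (by positivity), ENNReal.ofReal_mul (by positivity),
            ENNReal.ofReal_pow hR0.le, ENNReal.ofReal_pow zero_le_two, ENNReal.ofReal_ofNat]
          ring
  rwa [ENNReal.mul_le_mul_iff_right hV0 hVt] at h2

/-- The fractional Poincaré inequality on the star of a vertex. -/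
theorem StarRegular.fractional_poincare (hd : 1 ≤ d)
    (hR : StarRegular Λ K R) (hK : IsMesh Ω Λ K) (hΛ : IsBoundedLipschitzDomain Λ)
    {E : Type} [NormedAddCommGroup E] {v : Rd d → E}
    (hv : AEStronglyMeasurable v (volume.restrict Λ)) {r : ℝ} (hr : 0 < r)
    (hT : T ∈ cells K) {z : Rd d} (hz : z ∈ T) :
    ∃ c : E, ∫⁻ x in vertexStar K z, ‖v x - c‖ₑ ≤
      ENNReal.ofReal (R ^ d * ((volume (Metric.closedBall (0 : Rd d) 1)).toReal)⁻¹ *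
        Metric.diam (vertexStar K z) ^ r) * gagliardo (vertexStar K z) r v := by
  have : Nontrivial (Rd d) := Module.nontrivial_of_finrank_pos (R := ℝ) (by simp; omega)
  have hR0 : 0 < R := one_pos.trans_le hR.one_le
  set H := Metric.diam (vertexStar K z) with hH
  have hH0 : 0 < H := hR.star_pos hK hΛ.isBounded hT hz
  obtain ⟨b, hb⟩ := hR.hub T hT z hz
  set B := Metric.ball b (H / R) with hB
  have hB0 : volume B ≠ 0 := (Metric.measure_ball_pos volume b (by positivity)).ne'
  have hBt : volume B ≠ ∞ := measure_ball_lt_top.ne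
  have hBS : B ⊆ openStar Λ K z := fun y hy => by
    obtain ⟨x, hx⟩ := interior_simplex_nonempty hT
    exact hb T hT hz x hx y hy (right_mem_segment ℝ _ _)
  set ω := volume (Metric.closedBall (0 : Rd d) 1) with hω
  have hω0 : ω ≠ 0 := (Metric.measure_closedBall_pos volume 0 one_pos).ne'
  have hωt : ω ≠ ∞ := measure_closedBall_lt_top.ne
  set V := volume (Metric.closedBall z H) with hV
  have hV0 : V ≠ 0 := (Metric.measure_closedBall_pos volume z hH0).ne'
  have hVt : V ≠ ∞ := measure_closedBall_lt_top.ne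
  have hVω : V = ENNReal.ofReal (H ^ d) * ω := by
    rw [hV, ← mul_one H, volume_closedBall_eq hd z zero_le_one hH0.le,
      volume_closedBall_center z 0, ENNReal.ofReal_pow (by positivity), mul_one]
  have hvS : AEStronglyMeasurable v (volume.restrict (vertexStar K z)) := by
    rw [← Measure.restrict_congr_set (hK.openStar_ae_eq hΛ z)]
    exact hv.mono_set fun x hx => hx.1
  have hvB : AEStronglyMeasurable v (volume.restrict B) := hv.mono_set fun x hx => (hBS hx).1
  set f : Rd d × Rd d → ℝ≥0∞ := fun p => ‖v p.1 - v p.2‖ₑ with hf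
  have hfm : AEMeasurable f ((volume.restrict (vertexStar K z)).prod (volume.restrict B)) := by
    exact (hvS.comp_fst.sub hvB.comp_snd).enorm
  obtain ⟨y, -, hy⟩ := exists_mul_lintegral_le (S := vertexStar K z) hB0 hBt hfm
  refine ⟨v y, ?_⟩
  set I := ∫⁻ x in vertexStar K z, ‖v x - v y‖ₑ with hI
  -- Points of the star are at distance at most `H`, so the weight `(H / ‖x - y‖) ^ (d + r)` is at
  -- least one and may be inserted.
  have h1 : ∫⁻ p in vertexStar K z ×ˢ B, f p ≤
      ENNReal.ofReal (H ^ ((d : ℝ) + r)) * gagliardo (vertexStar K z) r v := by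
    rw [gagliardo, ← lintegral_const_mul' _ _ ENNReal.ofReal_ne_top]
    refine (setLIntegral_mono' ((hK.measurableSet_vertexStar z).prod
      Metric.isOpen_ball.measurableSet) fun p hp => ?_).trans (lintegral_mono_set
      (prod_mono subset_rfl (hBS.trans (openStar_subset_vertexStar z))))
    rw [← ENNReal.ofReal_mul (by positivity), hf]
    simp only
    rw [← ofReal_norm]
    refine ENNReal.ofReal_le_ofReal ?_
    have hdist : ‖p.1 - p.2‖ ≤ H := by
      rw [← dist_eq_norm]
      exact Metric.dist_le_diam_of_mem (hK.isBounded_vertexStar hΛ.isBounded z) hp.1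
        (openStar_subset_vertexStar z (hBS hp.2))
    rcases eq_or_ne p.1 p.2 with he | he
    · simp [he]
    · have hn : 0 < ‖p.1 - p.2‖ := norm_pos_iff.2 (sub_ne_zero.2 he)
      rw [mul_div_assoc', le_div_iff₀ (by positivity), mul_comm]
      gcongr
  have h2 : V * I ≤ V * (ENNReal.ofReal (R ^ d * (ω.toReal)⁻¹ * H ^ r) *
      gagliardo (vertexStar K z) r v) := by
    calc V * I ≤ ENNReal.ofReal R ^ d * (volume B * I) := by
          rw [← mul_assoc]
          exact mul_le_mul_left (hR.volume_closedBall_le_hub hd z b) _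
      _ ≤ ENNReal.ofReal R ^ d * _ := mul_le_mul_right (hy.trans h1) _
      _ = ENNReal.ofReal (R ^ d * H ^ ((d : ℝ) + r)) * gagliardo (vertexStar K z) r v := by
          rw [← mul_assoc, ← ENNReal.ofReal_pow hR0.le, ← ENNReal.ofReal_mul (by positivity)]
      _ = _ := by
          rw [hVω, ← mul_assoc]
          congr 1
          have hωpos : 0 < ω.toReal := ENNReal.toReal_pos hω0 hωt
          nth_rewrite 1 [← ENNReal.ofReal_toReal hωt]
          rw [← ENNReal.ofReal_mul (by positivity), ← ENNReal.ofReal_mul (by positivity)]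
          congr 1
          rw [Real.rpow_add hH0, Real.rpow_natCast]
          field_simp
  rwa [ENNReal.mul_le_mul_iff_right hV0 hVt] at h2

end Poincare

/-! ### Local affine approximation -/

section StarApprox

variable {d : ℕ} {K : Geometry.SimplicialComplex ℝ (Rd d)} {T : Finset (Rd d)}
  {Ω Λ : Set (Rd d)} {R s t : ℝ}

/-- On the star of `z`, the affine function `q` approximates `u` to order `t` in `L¹`, and to order
`t - 2s` in the fractional seminorm of order `2s` near the diagonal. -/
structure IsStarApprox (Λ : Set (Rd d)) (K : Geometry.SimplicialComplex ℝ (Rd d)) (s t C : ℝ)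
    (u : Rd d → ℝ) (z : Rd d) (q : Rd d →ᵃ[ℝ] ℝ) (N : ℝ≥0∞) : Prop where
  norm_le : ∫⁻ x in vertexStar K z, ‖u x - q x‖ₑ ≤
    ENNReal.ofReal (C * Metric.diam (vertexStar K z) ^ t) * N
  near_le : ∫⁻ p in {p : Rd d × Rd d | segment ℝ p.1 p.2 ⊆ openStar Λ K z},
    rieszKernel (d + 2 * s) (p.1 - p.2) * ‖(u p.1 - q p.1) - (u p.2 - q p.2)‖ₑ ≤
      ENNReal.ofReal (C * Metric.diam (vertexStar K z) ^ (t - 2 * s)) * N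

theorem IsMesh.norm_sub_le_of_segment_subset (hK : IsMesh Ω Λ K)
    (hΛ : IsBoundedLipschitzDomain Λ) {z : Rd d} {p : Rd d × Rd d}
    (hp : segment ℝ p.1 p.2 ⊆ openStar Λ K z) : ‖p.1 - p.2‖ ≤ Metric.diam (vertexStar K z) := by
  rw [← dist_eq_norm]
  exact Metric.dist_le_diam_of_mem (hK.isBounded_vertexStar hΛ.isBounded z)
    (openStar_subset_vertexStar z (hp (left_mem_segment ℝ _ _)))
    (openStar_subset_vertexStar z (hp (right_mem_segment ℝ _ _)))

/-- A constant suffices. It cancels in differences, and since `‖x - y‖ ≤ H` the kernel of order `2s`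
is at most `H ^ (t - 2s)` times that of order `t`. -/
theorem exists_isStarApprox_of_lt_one (hd : 1 ≤ d) (hs₀ : 0 < s) (hst : 2 * s < t)
    (R : ℝ)  (Ω : Set (Rd d)) {Λ : Set (Rd d)} (hΛ : IsBoundedLipschitzDomain Λ) :
    ∃ C : ℝ, 0 < C ∧ ∀ K : Geometry.SimplicialComplex ℝ (Rd d), IsMesh Ω Λ K →
      StarRegular Λ K R → ∀ u : Rd d → ℝ, AEStronglyMeasurable u (volume.restrict Λ) →
      ∀ T ∈ cells K, ∀ z ∈ T, ∃ q : Rd d →ᵃ[ℝ] ℝ,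
        IsStarApprox Λ K s t C u z q (gagliardo (vertexStar K z) t u) := by
  set C₁ := R ^ d * ((volume (Metric.closedBall (0 : Rd d) 1)).toReal)⁻¹ with hC₁
  refine ⟨max C₁ 1, lt_max_of_lt_right one_pos, fun K hK hR u hu T hT z hz => ?_⟩
  have hH0 := hR.star_pos hK hΛ.isBounded hT hz
  obtain ⟨c, hc⟩ := hR.fractional_poincare hd hK hΛ hu (by linarith : 0 < t) hT hz
  refine ⟨AffineMap.const ℝ _ c, ?_, ?_⟩
  · refine hc.trans (mul_le_mul_left (ENNReal.ofReal_le_ofReal ?_) _)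
    gcongr
    exact le_max_left _ _
  · set H := Metric.diam (vertexStar K z)
    have h1 : ENNReal.ofReal (H ^ (t - 2 * s)) * gagliardo (vertexStar K z) t u ≤
        ENNReal.ofReal (max C₁ 1 * H ^ (t - 2 * s)) * gagliardo (vertexStar K z) t u := by
      gcongr
      exact le_mul_of_one_le_left (by positivity) (le_max_right _ _)
    refine le_trans ?_ h1
    rw [gagliardo, ← lintegral_const_mul' _ _ ENNReal.ofReal_ne_top]
    refine (setLIntegral_mono' (isOpen_setOf_segment_subset
      (hK.isOpen_openStar hΛ.isOpen z)).measurableSet fun p hp => ?_).trans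
      (lintegral_mono_set (fun p hp => ⟨?_, ?_⟩))
    · rw [← ENNReal.ofReal_mul (by positivity), rieszKernel, ← ofReal_norm,
        ← ENNReal.ofReal_mul (by positivity)]
      refine ENNReal.ofReal_le_ofReal ?_
      simp only [AffineMap.const_apply, sub_sub_sub_cancel_right]
      rcases eq_or_ne p.1 p.2 with he | he
      · simp [he]
      · have hn : 0 < ‖p.1 - p.2‖ := norm_pos_iff.2 (sub_ne_zero.2 he)
        have hle := hK.norm_sub_le_of_segment_subset hΛ hp
        rw [div_eq_mul_inv, ← Real.rpow_neg hn.le]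
        calc ‖p.1 - p.2‖ ^ (-((d : ℝ) + 2 * s)) * ‖u p.1 - u p.2‖
            = ‖p.1 - p.2‖ ^ (t - 2 * s) * (‖u p.1 - u p.2‖ * ‖p.1 - p.2‖ ^ (-((d : ℝ) + t))) := by
              rw [show -((d : ℝ) + 2 * s) = (t - 2 * s) + -((d : ℝ) + t) by ring,
                Real.rpow_add hn]
              ring
          _ ≤ _ := by
              gcongr
    · exact openStar_subset_vertexStar z (hp (left_mem_segment ℝ _ _))
    · exact openStar_subset_vertexStar z (hp (right_mem_segment ℝ _ _))

/-- Reduces affine approximation of `u` to approximation of its gradient by a constant `A`. The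
affine function is `A + c` with `c` from the Poincaré inequality, which gains a factor `H`. Near the
diagonal the gain is the integral of `|w|^{-(d+2s-1)}` over a ball of radius `H`, of order `H ^ (1 -
2s)`; it is finite because `s < 1/2`. -/
theorem exists_isStarApprox_of_weakFDeriv (hd : 1 ≤ d) (hs₁ : s < 1 / 2)
    (t R C₁ : ℝ) (hR1 : 1 ≤ R) (hC₁ : 0 < C₁) (Ω : Set (Rd d)) {Λ : Set (Rd d)}
    (hΛ : IsBoundedLipschitzDomain Λ) :
    ∃ C : ℝ, 0 < C ∧ ∀ K : Geometry.SimplicialComplex ℝ (Rd d), IsMesh Ω Λ K →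
      StarRegular Λ K R → ∀ (u : Rd d → ℝ) (u' : Rd d → (Rd d →L[ℝ] ℝ)), IsWeakFDeriv Λ u u' →
      ∀ T ∈ cells K, ∀ z ∈ T, ∀ (A : Rd d →L[ℝ] ℝ) (N : ℝ≥0∞),
        ∫⁻ x in vertexStar K z, ‖u' x - A‖ₑ ≤
          ENNReal.ofReal (C₁ * Metric.diam (vertexStar K z) ^ (t - 1)) * N →
        ∃ q : Rd d →ᵃ[ℝ] ℝ, IsStarApprox Λ K s t C u z q N := by
  obtain ⟨C₃, hC₃, hker⟩ := exists_lintegral_rieszKernel_closedBall_le hd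
    (show (d : ℝ) + 2 * s - 1 < d by linarith)
  set C₂ := R ^ (4 * d + 1) * 2 ^ (d + 2) with hC₂
  have hC₂0 : 0 < C₂ := by positivity
  refine ⟨(C₂ + C₃) * C₁, by positivity, fun K hK hR u u' hu T hT z hz A N hN => ?_⟩
  have hH0 := hR.star_pos hK hΛ.isBounded hT hz
  obtain ⟨c, hc⟩ := hR.poincare hd hK hΛ hu A hT hz
  set H := Metric.diam (vertexStar K z)
  set q : Rd d →ᵃ[ℝ] ℝ := A.toLinearMap.toAffineMap + AffineMap.const ℝ (Rd d) c with hq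
  have hqx : ∀ x, q x = A x + c := fun x => by simp [hq]
  refine ⟨q, ?_, ?_⟩
  · have h1 : ∀ x, u x - q x = u x - A x - c := fun x => by rw [hqx]; ring
    simp only [h1]
    refine (hc.trans (mul_le_mul_right hN _)).trans ?_
    rw [← mul_assoc, ← ENNReal.ofReal_mul (by positivity)]
    refine mul_le_mul_left (ENNReal.ofReal_le_ofReal ?_) _
    have h2 : H ^ t = H * H ^ (t - 1) := by
      nth_rewrite 2 [← Real.rpow_one H]
      rw [← Real.rpow_add hH0]
      congr 1
      ring
    rw [h2]
    have : 0 ≤ C₃ * C₁ * (H * H ^ (t - 1)) := by positivity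
    linarith
  · have h1 : ∀ p : Rd d × Rd d, (u p.1 - q p.1) - (u p.2 - q p.2) =
        u p.1 - u p.2 - A (p.1 - p.2) := fun p => by rw [hqx, hqx, map_sub]; ring
    simp only [h1]
    have h2 := lintegral_rieszKernel_sub_le (hK.isOpen_openStar hΛ.isOpen z) (fun x hx => hx.1) hu A
      (isOpen_setOf_segment_subset (hK.isOpen_openStar hΛ.isOpen z)).measurableSet
      (fun p hp => hp) (fun p hp => hK.norm_sub_le_of_segment_subset hΛ hp) ((d : ℝ) + 2 * s - 1)
    rw [sub_add_cancel] at h2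
    refine (h2.trans (mul_le_mul' (hker H hH0)
      ((lintegral_mono_set (openStar_subset_vertexStar z)).trans hN))).trans ?_
    rw [← mul_assoc, ← ENNReal.ofReal_mul (by positivity)]
    refine mul_le_mul_left (ENNReal.ofReal_le_ofReal ?_) _
    have h3 : H ^ (t - 2 * s) = H ^ ((d : ℝ) - (d + 2 * s - 1)) * H ^ (t - 1) := by
      rw [← Real.rpow_add hH0]
      congr 1
      ring
    rw [h3]
    have : 0 ≤ C₂ * C₁ * (H ^ ((d : ℝ) - (d + 2 * s - 1)) * H ^ (t - 1)) := by positivity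
    linarith

/-- The gradient is approximated by `0` for `t = 1`, by the fractional Poincaré inequality for `1 <
t < 2` and by the Poincaré inequality for `t = 2`. The local quantities `S z` add up with overlap `d
+ 1`. For `t ≥ 1` the seminorm is an infimum over weak derivatives, so a strict upper bound `N` is
used to pick one. -/
theorem exists_isStarApprox (hd : 1 ≤ d) (hs₀ : 0 < s) (hs₁ : s < 1 / 2) (hst : 2 * s < t)
    (ht : t ≤ 2) (R : ℝ) (hR1 : 1 ≤ R) (Ω : Set (Rd d)) {Λ : Set (Rd d)}
    (hΛ : IsBoundedLipschitzDomain Λ) :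
    ∃ C : ℝ, 0 < C ∧ ∀ (K : Geometry.SimplicialComplex ℝ (Rd d)) (hK : IsMesh Ω Λ K),
      StarRegular Λ K R → ∀ u : Rd d → ℝ, MemSobolev Λ t u →
      ∀ N : ℝ≥0∞, sobolevSeminorm Λ t u < N →
      ∃ (q : Rd d → (Rd d →ᵃ[ℝ] ℝ)) (S : Rd d → ℝ≥0∞),
        (∀ z ∈ hK.vertFinset, IsStarApprox Λ K s t C u z (q z) (S z)) ∧
        ∑ z ∈ hK.vertFinset, S z ≤ (d + 1) * N := by
  have choice : ∀ (K : Geometry.SimplicialComplex ℝ (Rd d)) (hK : IsMesh Ω Λ K) (C : ℝ)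
      (u : Rd d → ℝ) (S : Rd d → ℝ≥0∞), (∀ T ∈ cells K, ∀ z ∈ T, ∃ q : Rd d →ᵃ[ℝ] ℝ,
        IsStarApprox Λ K s t C u z q (S z)) → ∃ q : Rd d → (Rd d →ᵃ[ℝ] ℝ),
        ∀ z ∈ hK.vertFinset, IsStarApprox Λ K s t C u z (q z) (S z) := by
    intro K hK C u S h
    have : ∀ z, ∃ q : Rd d →ᵃ[ℝ] ℝ, z ∈ hK.vertFinset → IsStarApprox Λ K s t C u z q (S z) := by
      intro z
      by_cases hz : z ∈ hK.vertFinset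
      · obtain ⟨T, hT, hzT⟩ := hK.mem_vertFinset.1 hz
        obtain ⟨q, hq⟩ := h T hT z hzT
        exact ⟨q, fun _ => hq⟩
      · exact ⟨0, fun h => absurd h hz⟩
    choose q hq using this
    exact ⟨q, hq⟩
  rcases lt_trichotomy t 1 with h | h | h
  · obtain ⟨C, hC, hmain⟩ := exists_isStarApprox_of_lt_one hd hs₀ hst R Ω hΛ
    refine ⟨C, hC, fun K hK hR u hu N hN => ?_⟩
    obtain ⟨q, hq⟩ := choice K hK C u (fun z => gagliardo (vertexStar K z) t u)
      (hmain K hK hR u hu.integrable.aestronglyMeasurable)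
    refine ⟨q, _, hq, (hK.sum_lintegral_vertexStar_prod_le hΛ _).trans ?_⟩
    rw [sobolevSeminorm, if_pos h] at hN
    exact mul_le_mul_right hN.le _
  · obtain ⟨C, hC, hmain⟩ := exists_isStarApprox_of_weakFDeriv hd hs₁ t R 1 hR1 one_pos Ω hΛ
    refine ⟨C, hC, fun K hK hR u hu N hN => ?_⟩
    rw [sobolevSeminorm, if_neg (by linarith), if_pos h] at hN
    simp only [iInf_lt_iff] at hN
    obtain ⟨u', hu', hN⟩ := hN
    obtain ⟨q, hq⟩ := choice K hK C u (fun z => ∫⁻ x in vertexStar K z, ‖u' x‖ₑ)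
      fun T hT z hz => hmain K hK hR u u' hu' T hT z hz 0 _ (by simp [h])
    exact ⟨q, _, hq, (hK.sum_lintegral_vertexStar_le hΛ _).trans (mul_le_mul_right hN.le _)⟩
  · rcases ht.lt_or_eq with h2 | h2
    · have hball : 0 < (volume (Metric.closedBall (0 : Rd d) 1)).toReal :=
        ENNReal.toReal_pos (Metric.measure_closedBall_pos volume 0 one_pos).ne'
          measure_closedBall_lt_top.ne
      obtain ⟨C, hC, hmain⟩ := exists_isStarApprox_of_weakFDeriv hd hs₁ t R
        (R ^ d * ((volume (Metric.closedBall (0 : Rd d) 1)).toReal)⁻¹) hR1 (by positivity) Ω hΛ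
      refine ⟨C, hC, fun K hK hR u hu N hN => ?_⟩
      rw [sobolevSeminorm, if_neg (by linarith), if_neg (by linarith), if_pos h2] at hN
      simp only [iInf_lt_iff] at hN
      obtain ⟨u', hu', hN⟩ := hN
      have hu'm : AEStronglyMeasurable u' (volume.restrict Λ) :=
        hu'.locInt_deriv.aestronglyMeasurable
      obtain ⟨q, hq⟩ := choice K hK C u (fun z => gagliardo (vertexStar K z) (t - 1) u')
        fun T hT z hz => by
          obtain ⟨A, hA⟩ := hR.fractional_poincare hd hK hΛ hu'm (by linarith : 0 < t - 1) hT hz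
          exact hmain K hK hR u u' hu' T hT z hz A _ hA
      exact ⟨q, _, hq, (hK.sum_lintegral_vertexStar_prod_le hΛ _).trans (mul_le_mul_right hN.le _)⟩
    · obtain ⟨C, hC, hmain⟩ := exists_isStarApprox_of_weakFDeriv hd hs₁ t R
        (R ^ (4 * d + 1) * 2 ^ (d + 2)) hR1 (by positivity) Ω hΛ
      refine ⟨C, hC, fun K hK hR u hu N hN => ?_⟩
      rw [sobolevSeminorm, if_neg (by linarith), if_neg (by linarith), if_neg (by linarith)] at hN
      simp only [iInf_lt_iff] at hN
      obtain ⟨u', hu', u'', hu'', hN⟩ := hN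
      obtain ⟨q, hq⟩ := choice K hK C u (fun z => ∫⁻ x in vertexStar K z, ‖u'' x‖ₑ)
        fun T hT z hz => by
          obtain ⟨A, hA⟩ := hR.poincare hd hK hΛ hu'' 0 hT hz
          refine hmain K hK hR u u' hu' T hT z hz A _ ?_
          rw [h2, show (2 : ℝ) - 1 = 1 by norm_num, Real.rpow_one]
          simpa using hA
      exact ⟨q, _, hq, (hK.sum_lintegral_vertexStar_le hΛ _).trans (mul_le_mul_right hN.le _)⟩

end StarApprox

/-! ### The `L²`-projection onto affine functions -/

section Projection

variable {d : ℕ} {S : Set (Rd d)} {c : Rd d} {r κ : ℝ}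

theorem integrableOn_affineMap (q : Rd d →ᵃ[ℝ] ℝ) (hS : Bornology.IsBounded S) :
    IntegrableOn q S :=
  ((continuous_affineMap q).continuousOn.integrableOn_compact
    hS.isCompact_closure).mono_set subset_closure

/-- Mean value property, by reflection in the centre of the ball. -/
theorem setIntegral_closedBall_affineMap (q : Rd d →ᵃ[ℝ] ℝ) (c : Rd d) (r : ℝ) :
    ∫ x in Metric.closedBall c r, q x = volume.real (Metric.closedBall c r) * q c := by
  have hint := integrableOn_affineMap q (Metric.isBounded_closedBall (x := c) (r := r))
  have hmp : MeasurePreserving (fun x : Rd d => (c + c) - x) :=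
    Measure.measurePreserving_sub_left volume (c + c)
  have hemb : MeasurableEmbedding (fun x : Rd d => (c + c) - x) :=
    (MeasurableEquiv.subLeft (c + c)).measurableEmbedding
  have hpre : (fun x : Rd d => (c + c) - x) ⁻¹' Metric.closedBall c r = Metric.closedBall c r := by
    ext x
    simp only [mem_preimage, Metric.mem_closedBall, dist_eq_norm]
    rw [← norm_neg, show -(c + c - x - c) = x - c by abel]
  have h1 : ∫ x in Metric.closedBall c r, q ((c + c) - x) = ∫ x in Metric.closedBall c r, q x := by
    rw [← hmp.setIntegral_preimage_emb hemb (fun x => q x), hpre]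
  have h2 : ∀ x, q ((c + c) - x) = 2 * q c - q x := by
    intro x
    have e1 := q.linearMap_vsub (c + c - x) c
    have e2 := q.linearMap_vsub c x
    simp only [vsub_eq_sub] at e1 e2
    rw [show c + c - x - c = c - x by abel] at e1
    linarith
  simp only [h2] at h1
  have hc : IntegrableOn (fun _ : Rd d => 2 * q c) (Metric.closedBall c r) :=
    integrableOn_const measure_closedBall_lt_top.ne
  rw [integral_sub hc hint, setIntegral_const, smul_eq_mul] at h1
  linarith

/-- On the ball of half radius the mean value property bounds `q` by `m`, the factor `2 ^ d` being
the volume ratio. The slope is then at most `2 m / (r / 2)`, which adds `4 κ m` at distance `κ r`.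
-/
theorem abs_affineMap_le_integral (hd : 1 ≤ d) (q : Rd d →ᵃ[ℝ] ℝ) (hr : 0 < r) {x : Rd d}
    (hx : x ∈ Metric.closedBall c (κ * r)) :
    |q x| ≤ (1 + 4 * κ) * 2 ^ d / volume.real (Metric.closedBall c r) *
      ∫ y in Metric.closedBall c r, |q y| := by
  have hV : 0 < volume.real (Metric.closedBall c r) :=
    ENNReal.toReal_pos (Metric.measure_closedBall_pos volume c hr).ne' measure_closedBall_lt_top.ne
  set V := volume.real (Metric.closedBall c r)
  have hint := (integrableOn_affineMap q (Metric.isBounded_closedBall (x := c) (r := r))).abs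
  set J := ∫ y in Metric.closedBall c r, |q y|
  have hvol : ∀ a : Rd d, volume.real (Metric.closedBall a (r / 2)) = V / 2 ^ d := by
    intro a
    rw [measureReal_def, volume_closedBall_center a c, show r / 2 = (1 / 2) * r by ring,
      volume_closedBall_eq hd c hr.le (by norm_num), ENNReal.toReal_mul, ENNReal.toReal_pow,
      ENNReal.toReal_ofReal (by norm_num)]
    simp only [V, measureReal_def]
    rw [one_div, inv_pow]
    field_simp
  have h1 : ∀ a ∈ Metric.closedBall c (r / 2), |q a| ≤ 2 ^ d / V * J := by
    intro a ha
    have hsub : Metric.closedBall a (r / 2) ⊆ Metric.closedBall c r :=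
      Metric.closedBall_subset_closedBall' (by rw [Metric.mem_closedBall] at ha; linarith)
    have h2 : |∫ x in Metric.closedBall a (r / 2), q x| ≤ J :=
      abs_integral_le_integral_abs.trans
        (setIntegral_mono_set hint (Filter.Eventually.of_forall fun _ => abs_nonneg _)
          hsub.eventuallyLE)
    rw [setIntegral_closedBall_affineMap, hvol, abs_mul, abs_of_pos (by positivity)] at h2
    rw [div_mul_eq_mul_div, le_div_iff₀ hV]
    rw [div_mul_eq_mul_div, div_le_iff₀ (by positivity)] at h2
    linarith
  set m := 2 ^ d / V * J
  have hc := h1 c (Metric.mem_closedBall_self (by positivity))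
  have h3 := abs_affineMap_sub_le q (c := c) (r := r / 2) (M := 2 * m) (by positivity)
    (fun a ha => (abs_sub _ _).trans (by linarith [h1 a ha])) x c
  have hm : 0 ≤ m := (abs_nonneg _).trans hc
  rw [Metric.mem_closedBall, dist_eq_norm] at hx
  have h4 : 2 * m / (r / 2) * ‖x - c‖ ≤ 4 * κ * m := by
    calc _ ≤ 2 * m / (r / 2) * (κ * r) := by gcongr
      _ = _ := by field_simp; ring
  have h5 : |q x| ≤ |q x - q c| + |q c| := by
    simpa using abs_add_le (q x - q c) (q c)
  calc |q x| ≤ (1 + 4 * κ) * m := by linarith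
    _ = _ := by simp only [m]; ring

theorem integrableOn_mul_affineMap {f : Rd d → ℝ} (hf : IntegrableOn f S)
    (hSb : Bornology.IsBounded S) (hSm : MeasurableSet S) (q : Rd d →ᵃ[ℝ] ℝ) :
    IntegrableOn (fun x => f x * q x) S := by
  obtain ⟨M, hM⟩ := (hSb.isCompact_closure).exists_bound_of_continuousOn
    (continuous_affineMap q).continuousOn
  refine hf.mul_bdd (c := M) (continuous_affineMap q).aestronglyMeasurable ?_
  exact (ae_restrict_iff' hSm).2 (Filter.Eventually.of_forall fun x hx => hM x (subset_closure hx))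

/-- An affine function is determined by its values on a ball. -/
theorem eq_zero_of_setIntegral_mul_self (hd : 1 ≤ d) (hSm : MeasurableSet S)
    (hSb : Bornology.IsBounded S) (hr : 0 < r) (hB : Metric.closedBall c r ⊆ S)
    {p : Rd d →ᵃ[ℝ] ℝ} (hp : ∫ x in S, p x * p x = 0) : p = 0 := by
  have h1 := (setIntegral_eq_zero_iff_of_nonneg_ae
    (Filter.Eventually.of_forall fun x => mul_self_nonneg (p x))
    (integrableOn_mul_affineMap (integrableOn_affineMap p hSb) hSb hSm p)).1 hp
  have h2 : ∫ y in Metric.closedBall c r, |p y| = 0 := by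
    refine integral_eq_zero_of_ae ?_
    filter_upwards [ae_restrict_of_ae_restrict_of_subset hB h1] with x hx
    simpa using hx
  ext x
  have h3 := abs_affineMap_le_integral (κ := ‖x - c‖ / r) hd p hr (c := c) (x := x)
    (by rw [Metric.mem_closedBall, dist_eq_norm, div_mul_cancel₀ _ hr.ne'])
  rw [h2, mul_zero] at h3
  simpa using h3

/-- The Gram form is nondegenerate on the finite-dimensional space of affine functions, so every
functional is represented. -/
theorem exists_isL2ProjP1 (hd : 1 ≤ d) (hSm : MeasurableSet S)
    (hSb : Bornology.IsBounded S) (hr : 0 < r) (hB : Metric.closedBall c r ⊆ S) {f : Rd d → ℝ}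
    (hf : IntegrableOn f S) : ∃ p, IsL2ProjP1 S f p := by
  have hint : ∀ p q : Rd d →ᵃ[ℝ] ℝ, IntegrableOn (fun x => p x * q x) S := fun p q =>
    integrableOn_mul_affineMap (integrableOn_affineMap p hSb) hSb hSm q
  have hfint : ∀ q : Rd d →ᵃ[ℝ] ℝ, IntegrableOn (fun x => f x * q x) S := fun q =>
    integrableOn_mul_affineMap hf hSb hSm q
  have : Module.Finite ℝ (Rd d →ᵃ[ℝ] ℝ) :=
    Module.Finite.equiv (AffineMap.toConstProdLinearMap ℝ : (Rd d →ᵃ[ℝ] ℝ) ≃ₗ[ℝ] ℝ × (Rd d →ₗ[ℝ] ℝ)).symm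
  set Φ : (Rd d →ᵃ[ℝ] ℝ) →ₗ[ℝ] Module.Dual ℝ (Rd d →ᵃ[ℝ] ℝ) :=
    LinearMap.mk₂ ℝ (fun p q => ∫ x in S, p x * q x)
      (fun p p' q => by
        rw [← integral_add (hint p q) (hint p' q)]
        simp [add_mul])
      (fun a p q => by
        rw [smul_eq_mul, ← integral_const_mul]
        simp [mul_assoc])
      (fun p q q' => by
        rw [← integral_add (hint p q) (hint p q')]
        simp [mul_add])
      (fun a p q => by
        rw [smul_eq_mul, ← integral_const_mul]
        simp [mul_left_comm]) with hΦ
  have hinj : Function.Injective Φ := by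
    rw [injective_iff_map_eq_zero]
    intro p hp
    refine eq_zero_of_setIntegral_mul_self hd hSm hSb hr hB ?_
    exact congrArg (fun l => l p) hp
  have hsurj : Function.Surjective Φ := (LinearMap.injective_iff_surjective_of_finrank_eq_finrank
    (Subspace.dual_finrank_eq).symm).1 hinj
  set ℓ : Module.Dual ℝ (Rd d →ᵃ[ℝ] ℝ) :=
    { toFun := fun q => ∫ x in S, f x * q x
      map_add' := fun q q' => by
        rw [← integral_add (hfint q) (hfint q')]
        simp [mul_add]
      map_smul' := fun a q => by
        rw [RingHom.id_apply, smul_eq_mul, ← integral_const_mul]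
        simp [mul_left_comm] } with hℓ
  obtain ⟨p, hp⟩ := hsurj ℓ
  refine ⟨p, fun q => ?_⟩
  have h1 : ∫ x in S, p x * q x = ∫ x in S, f x * q x := congrArg (fun l => l q) hp
  simp only [sub_mul]
  rw [integral_sub (hfint q) (hint p q), h1, sub_self]

/-- Stability in `L¹` of an `L²`-projection. Testing the orthogonality with `w = p - q` bounds `∫
w²` by `sup |w|` times the `L¹` distance of `f` and `q`. Conversely `sup |w|` is bounded by the mean
of `|w|` on the inner ball, hence by `(∫ w²)^{1/2}`; one factor `sup |w|` cancels. -/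
theorem IsL2ProjP1.abs_sub_le (hd : 1 ≤ d) (hSm : MeasurableSet S)
    (hr : 0 < r) (hB : Metric.closedBall c r ⊆ S) (hS : S ⊆ Metric.closedBall c (κ * r))
    {f : Rd d → ℝ} (hf : IntegrableOn f S) {p : Rd d →ᵃ[ℝ] ℝ} (hp : IsL2ProjP1 S f p)
    (q : Rd d →ᵃ[ℝ] ℝ) {z : Rd d} (hz : z ∈ S) :
    |p z - q z| ≤ ((1 + 4 * κ) * 2 ^ d) ^ 2 / volume.real (Metric.closedBall c r) *
      ∫ x in S, |f x - q x| := by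
  have hSb : Bornology.IsBounded S := Metric.isBounded_closedBall.subset hS
  have hV : 0 < volume.real (Metric.closedBall c r) :=
    ENNReal.toReal_pos (Metric.measure_closedBall_pos volume c hr).ne' measure_closedBall_lt_top.ne
  set V := volume.real (Metric.closedBall c r)
  set A := (1 + 4 * κ) * 2 ^ d
  set w := p - q with hw
  have hwx : ∀ x, w x = p x - q x := fun x => rfl
  set J := ∫ y in Metric.closedBall c r, |w y| with hJ
  set E := ∫ x in S, |f x - q x| with hE
  set m := A / V * J with hm
  have hsup : ∀ x ∈ S, |w x| ≤ m := fun x hx => abs_affineMap_le_integral hd w hr (hS hx)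
  have hm0 : 0 ≤ m := (abs_nonneg _).trans (hsup z hz)
  have hfq : IntegrableOn (fun x => f x - q x) S := hf.sub (integrableOn_affineMap q hSb)
  have hww : IntegrableOn (fun x => w x * w x) S :=
    integrableOn_mul_affineMap (integrableOn_affineMap w hSb) hSb hSm w
  have hfqw := integrableOn_mul_affineMap hfq hSb hSm w
  have h1 : ∫ x in S, w x * w x ≤ m * E := by
    have h2 : ∫ x in S, w x * w x = ∫ x in S, (f x - q x) * w x := by
      have h3 := hp w
      have h4 : ∀ x, (f x - p x) * w x = (f x - q x) * w x - w x * w x := fun x => by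
        rw [hwx]; ring
      simp only [h4] at h3
      rw [integral_sub hfqw hww] at h3
      linarith
    rw [h2, hE, ← integral_const_mul]
    refine setIntegral_mono_on hfqw (hfq.abs.const_mul m) hSm fun x hx => ?_
    calc _ ≤ |(f x - q x) * w x| := le_abs_self _
      _ = |w x| * |f x - q x| := by rw [abs_mul, mul_comm]
      _ ≤ _ := by gcongr; exact hsup x hx
  have h2 : J ^ 2 ≤ V * ∫ x in S, w x * w x := by
    have hBb := Metric.isBounded_closedBall (x := c) (r := r)
    have hBw : IntegrableOn (fun x => w x * w x) (Metric.closedBall c r) := hww.mono_set hB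
    have hBa : IntegrableOn (fun x => |w x|) (Metric.closedBall c r) :=
      (integrableOn_affineMap w hBb).abs
    have h3 : ∫ x in Metric.closedBall c r, w x * w x ≤ ∫ x in S, w x * w x :=
      setIntegral_mono_set hww (Filter.Eventually.of_forall fun x => mul_self_nonneg (w x))
        hB.eventuallyLE
    have h4 : 0 ≤ ∫ x in Metric.closedBall c r, (|w x| - J / V) ^ 2 :=
      integral_nonneg fun x => sq_nonneg _
    have h5 : ∀ x, (|w x| - J / V) ^ 2 = w x * w x - 2 * (J / V) * |w x| + (J / V) ^ 2 := fun x => by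
      rw [sub_sq, sq_abs]; ring
    simp only [h5] at h4
    have hBc : IntegrableOn (fun _ : Rd d => (J / V) ^ 2) (Metric.closedBall c r) :=
      integrableOn_const measure_closedBall_lt_top.ne
    have hBJ : IntegrableOn (fun x => 2 * (J / V) * |w x|) (Metric.closedBall c r) :=
      hBa.const_mul _
    have hBs : IntegrableOn (fun x => w x * w x - 2 * (J / V) * |w x|) (Metric.closedBall c r) :=
      hBw.sub hBJ
    rw [integral_add hBs hBc, integral_sub hBw hBJ, integral_const_mul,
      setIntegral_const, smul_eq_mul, ← hJ] at h4
    have h6 : 2 * (J / V) * J - V * (J / V) ^ 2 = J ^ 2 / V := by field_simp; ring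
    have h7 : J ^ 2 / V ≤ ∫ x in S, w x * w x := by linarith
    rw [div_le_iff₀ hV] at h7
    linarith
  have h3 : m * m ≤ A ^ 2 / V * E * m := by
    calc m * m = A ^ 2 / V ^ 2 * J ^ 2 := by rw [hm]; ring
      _ ≤ A ^ 2 / V ^ 2 * (V * (m * E)) := by gcongr; exact h2.trans (by gcongr)
      _ = _ := by field_simp
  rcases hm0.eq_or_lt with h0 | h0
  · refine ((hsup z hz).trans h0.ge).trans ?_
    have : 0 ≤ E := integral_nonneg fun x => abs_nonneg _
    positivity
  · exact (hsup z hz).trans (le_of_mul_le_mul_right h3 h0)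

theorem abs_projValue_sub_le (hd : 1 ≤ d) (hSm : MeasurableSet S)
    (hr : 0 < r) (hB : Metric.closedBall c r ⊆ S) (hS : S ⊆ Metric.closedBall c (κ * r))
    {f : Rd d → ℝ} (hf : IntegrableOn f S) (q : Rd d →ᵃ[ℝ] ℝ) {z : Rd d} (hz : z ∈ S) :
    |projValue S f z - q z| ≤ ((1 + 4 * κ) * 2 ^ d) ^ 2 / volume.real (Metric.closedBall c r) *
      ∫ x in S, |f x - q x| := by
  have h := exists_isL2ProjP1 hd hSm (Metric.isBounded_closedBall.subset hS) hr hB hf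
  rw [projValue, dif_pos h]
  exact h.choose_spec.abs_sub_le hd hSm hr hB hS hf q hz

end Projection

/-! ### Splitting the energy seminorm into near and far contributions -/

section Splitting

variable {d : ℕ} {K : Geometry.SimplicialComplex ℝ (Rd d)} {T : Finset (Rd d)}
  {Ω Λ : Set (Rd d)} {R s : ℝ}

theorem lintegral_convolution_fst {φ : Rd d → ℝ≥0∞} (hφ : Measurable φ) {f : Rd d → ℝ≥0∞}
    (hf : AEMeasurable f) (A : Set (Rd d)) :
    ∫⁻ p in A ×ˢ univ, φ (p.1 - p.2) * f p.1 = (∫⁻ w, φ w) * ∫⁻ x in A, f x := by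
  have hm : AEMeasurable (fun p : Rd d × Rd d => φ (p.1 - p.2) * f p.1)
      ((volume.restrict A).prod volume) :=
    (hφ.comp (measurable_fst.sub measurable_snd)).aemeasurable.mul
      (hf.restrict.comp_quasiMeasurePreserving Measure.quasiMeasurePreserving_fst)
  rw [Measure.volume_eq_prod, ← Measure.prod_restrict, Measure.restrict_univ, lintegral_prod _ hm]
  have h1 : ∀ x : Rd d, ∫⁻ y, φ (x - y) * f x = (∫⁻ w, φ w) * f x := fun x => by
    have hx : Measurable fun y => φ (x - y) := hφ.comp (measurable_const.sub measurable_id)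
    rw [lintegral_mul_const _ hx, lintegral_sub_left_eq_self φ x]
  simp only [h1]
  exact lintegral_const_mul'' _ hf.restrict

theorem lintegral_prod_swap (f : Rd d × Rd d → ℝ≥0∞) (A B : Set (Rd d)) :
    ∫⁻ p in A ×ˢ B, f p.swap = ∫⁻ p in B ×ˢ A, f p := by
  have h := (Measure.measurePreserving_swap (μ := (volume : Measure (Rd d)))
    (ν := (volume : Measure (Rd d)))).setLIntegral_comp_preimage_emb
      MeasurableEquiv.prodComm.measurableEmbedding f (B ×ˢ A)
  rw [preimage_swap_prod] at h
  exact h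

theorem lintegral_convolution_snd {φ : Rd d → ℝ≥0∞} (hφ : Measurable φ) {f : Rd d → ℝ≥0∞}
    (hf : AEMeasurable f) (A : Set (Rd d)) :
    ∫⁻ p in univ ×ˢ A, φ (p.1 - p.2) * f p.2 = (∫⁻ w, φ w) * ∫⁻ x in A, f x := by
  rw [← lintegral_prod_swap]
  have := lintegral_convolution_fst (φ := fun w => φ (-w)) (hφ.comp measurable_neg) hf A
  rw [lintegral_neg_eq_self] at this
  rw [← this]
  simp only [neg_sub, Prod.fst_swap, Prod.snd_swap]

theorem energySeminorm_le (s : ℝ) (Ω : Set (Rd d)) (v : Rd d → ℝ) :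
    energySeminorm s Ω v ≤
      2 * ∫⁻ p in Ω ×ˢ univ, rieszKernel (d + 2 * s) (p.1 - p.2) * ‖v p.1 - v p.2‖ₑ := by
  have h1 : QSet Ω ⊆ Ω ×ˢ univ ∪ univ ×ˢ Ω := by
    intro p hp
    by_contra h
    simp only [mem_union, mem_prod, mem_univ, and_true, true_and, not_or] at h
    exact hp ⟨h.1, h.2⟩
  have h2 : ∀ p : Rd d × Rd d,
      ENNReal.ofReal (|v p.1 - v p.2| / ‖p.1 - p.2‖ ^ ((d : ℝ) + 2 * s)) =
        rieszKernel (d + 2 * s) (p.1 - p.2) * ‖v p.1 - v p.2‖ₑ := fun p =>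
    ofReal_norm_div_rpow (α := (d : ℝ) + 2 * s) (p.1 - p.2) (v p.1 - v p.2)
  rw [energySeminorm]
  simp only [h2]
  refine (lintegral_mono_set h1).trans ((lintegral_union_le _ _ _).trans (le_of_eq ?_))
  rw [two_mul (∫⁻ p in Ω ×ˢ univ, _)]
  congr 1
  rw [← lintegral_prod_swap _ Ω univ]
  refine lintegral_congr fun p => ?_
  rw [Prod.fst_swap, Prod.snd_swap, rieszKernel_sub_comm, ← enorm_neg, neg_sub]

theorem exists_lintegral_near_le (hd : 1 ≤ d) (hs₁ : s < 1 / 2) :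
    ∃ C : ℝ, 0 < C ∧ ∀ ρ : ℝ, 0 < ρ → ∀ A : Set (Rd d),
      ∫⁻ p in A ×ˢ univ, (Metric.closedBall (0 : Rd d) ρ).indicator
        (rieszKernel (d + 2 * s - 1)) (p.1 - p.2) ≤
        ENNReal.ofReal (C * ρ ^ (1 - 2 * s)) * volume A := by
  obtain ⟨C, hC, h⟩ := exists_lintegral_rieszKernel_closedBall_le hd
    (show (d : ℝ) + 2 * s - 1 < d by linarith)
  refine ⟨C, hC, fun ρ hρ A => ?_⟩
  have hm : MeasurableSet (Metric.closedBall (0 : Rd d) ρ) := Metric.isClosed_closedBall.measurableSet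
  have h1 := lintegral_convolution_fst ((measurable_rieszKernel (d + 2 * s - 1)).indicator hm)
    (f := fun _ => 1) aemeasurable_const A
  rw [lintegral_indicator hm] at h1
  simp only [mul_one, lintegral_const, one_mul, Measure.restrict_apply_univ] at h1
  rw [h1]
  have h2 := h ρ hρ
  rw [show (d : ℝ) - (d + 2 * s - 1) = 1 - 2 * s by ring] at h2
  gcongr

/-- The kernel of order `d + 2s` is integrable away from the origin, with integral of order `ρ ^
(-2s)`. Both orders of the variables occur, since either point may be the one lying in the element.
-/
theorem exists_lintegral_far_le (hs₀ : 0 < s) :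
    ∃ C : ℝ, 0 < C ∧ ∀ ρ : ℝ, 0 < ρ → ∀ f : Rd d → ℝ≥0∞, AEMeasurable f → ∀ A : Set (Rd d),
      ∫⁻ p in A ×ˢ univ, (Metric.ball (0 : Rd d) ρ)ᶜ.indicator (rieszKernel (d + 2 * s))
        (p.1 - p.2) * f p.1 ≤ ENNReal.ofReal (C * ρ ^ (-(2 * s))) * ∫⁻ x in A, f x ∧
      ∫⁻ p in univ ×ˢ A, (Metric.ball (0 : Rd d) ρ)ᶜ.indicator (rieszKernel (d + 2 * s))
        (p.1 - p.2) * f p.2 ≤ ENNReal.ofReal (C * ρ ^ (-(2 * s))) * ∫⁻ x in A, f x := by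
  obtain ⟨C, hC, h⟩ := exists_lintegral_rieszKernel_compl_ball_le (d := d)
    (show (d : ℝ) < d + 2 * s by linarith)
  refine ⟨C, hC, fun ρ hρ f hf A => ?_⟩
  have hm : MeasurableSet (Metric.ball (0 : Rd d) ρ)ᶜ := Metric.isOpen_ball.measurableSet.compl
  have hφ := (measurable_rieszKernel (d := d) (d + 2 * s)).indicator hm
  rw [lintegral_convolution_fst hφ hf, lintegral_convolution_snd hφ hf, lintegral_indicator hm]
  have h2 := h ρ hρ
  rw [show (d : ℝ) - (d + 2 * s) = -(2 * s) by ring] at h2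
  constructor <;> gcongr

/-- Pairs of points that are close relative to the size of the element containing one of them lie,
with the segment between them, in the star of a vertex of that element. -/
theorem exists_segment_subset_openStar (hΩ : IsBoundedLipschitzDomain Ω)
    (hΛ : IsBoundedLipschitzDomain Λ) (hΩΛ : closure Ω ⊆ Λ) (hR1 : 1 ≤ R) :
    ∃ ε : ℝ, 0 < ε ∧ ∀ K : Geometry.SimplicialComplex ℝ (Rd d), IsMesh Ω Λ K →
      StarRegular Λ K R → ∀ x ∈ Ω, ∀ y, ∀ T ∈ cells K, (x ∈ simplex T ∨ y ∈ simplex T) →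
      ‖x - y‖ < ε * Metric.diam (simplex T) → ∃ z ∈ T, segment ℝ x y ⊆ openStar Λ K z := by
  obtain ⟨δ, hδ, hball⟩ := exists_pos_forall_dist_lt_mem hΩ.isBounded hΛ.isOpen hΩΛ
  set D := Metric.diam (closure Λ) + 1 with hD
  have hD0 : 0 < D := by positivity
  have hR0 : 0 < R := by linarith
  -- The first entry keeps the segment within the distance `δ` between `Ω` and the outside of `Λ`.
  -- The second makes the hat function vary by less than `1 / (d + 1)` along it.
  refine ⟨min (δ / D) (1 / (R ^ 2 * (d + 1))), by positivity, fun K hK hR x hx y T hT hxy hn => ?_⟩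
  have hT0 := hR.diam_pos T hT
  have hTD : Metric.diam (simplex T) ≤ D :=
    (Metric.diam_mono (hK.simplex_subset hT) hΛ.isBounded.closure).trans (by linarith)
  have hseg : segment ℝ x y ⊆ Λ := by
    have h1 : ‖x - y‖ < δ := by
      refine hn.trans_le ?_
      calc _ ≤ δ / D * D := by gcongr; exact min_le_left _ _
        _ = δ := div_mul_cancel₀ _ hD0.ne'
    refine ((convex_ball x δ).segment_subset (Metric.mem_ball_self hδ) ?_).trans
      (hball x (subset_closure hx))
    rwa [Metric.mem_ball, dist_comm, dist_eq_norm]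
  obtain ⟨a, ha, haT⟩ : ∃ a ∈ segment ℝ x y, a ∈ simplex T := by
    rcases hxy with h | h
    · exact ⟨x, left_mem_segment ℝ _ _, h⟩
    · exact ⟨y, right_mem_segment ℝ _ _, h⟩
  -- The `d + 1` coordinates sum to one, so one of them is at least the average.
  obtain ⟨z, hz, hza⟩ : ∃ z ∈ T, (1 : ℝ) / (d + 1) ≤ cellCoord T z a := by
    by_contra! hcon
    have h1 := sum_cellCoord hT a
    have hne : T.Nonempty := Finset.card_pos.1 (by rw [hT.2]; omega)
    have h2 := Finset.sum_lt_sum_of_nonempty hne hcon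
    rw [h1, Finset.sum_const, hT.2, nsmul_eq_mul] at h2
    push_cast at h2
    rw [mul_one_div_cancel (by positivity)] at h2
    exact lt_irrefl _ h2
  refine ⟨z, hz, fun w hw => ⟨hseg hw, ?_⟩⟩
  set H := Metric.diam (vertexStar K z) with hH
  have hH0 : 0 < H := hR.star_pos hK hΛ.isBounded hT hz
  have hsub : segment ℝ a w ⊆ segment ℝ x y := (convex_segment x y).segment_subset ha hw
  have h1 := hK.abs_sub_le_of_segment (f := hat K z) (L := R ^ 2 / H) (x := a) (y := w)
    (fun S hS _ b hb b' hb' => abs_hat_sub_le_of_mem_simplex hR0 (hR.diam_pos S hS) hS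
      (hR.star_le S hS z) hH0 (hR.inball S hS) hb hb')
    ((hsub.trans hseg).trans subset_closure)
  have h2 : ‖a - w‖ ≤ ‖x - y‖ := by
    rw [segment_eq_image'] at ha hw
    obtain ⟨α, hα, rfl⟩ := ha
    obtain ⟨β, hβ, rfl⟩ := hw
    rw [show x + α • (y - x) - (x + β • (y - x)) = (α - β) • (y - x) by module, norm_smul,
      norm_sub_rev y x]
    refine mul_le_of_le_one_left (norm_nonneg _) ?_
    rw [Real.norm_eq_abs, abs_le]
    constructor <;> linarith [hα.1, hα.2, hβ.1, hβ.2]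
  have h3 : R ^ 2 / H * ‖a - w‖ < 1 / (d + 1) := by
    calc _ ≤ R ^ 2 / H * ‖x - y‖ := by gcongr
      _ < R ^ 2 / H * (1 / (R ^ 2 * (d + 1)) * H) := by
        refine mul_lt_mul_of_pos_left (hn.trans_le ?_) (by positivity)
        gcongr
        · exact min_le_right _ _
        · exact hK.diam_simplex_le_star hΛ.isBounded hT hz
      _ = _ := by field_simp
  rw [← hat_eq_cellCoord hT haT] at hza
  have h4 := (abs_le.1 h1).2
  linarith

end Splitting

/-! ### Nodal interpolation -/

section Nodal

variable {d : ℕ} {K : Geometry.SimplicialComplex ℝ (Rd d)} {T : Finset (Rd d)}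
  {Ω Λ : Set (Rd d)} {R : ℝ}

/-- The discrete function with the values `V z` at the vertices `z`. -/
def IsMesh.nodal (hK : IsMesh Ω Λ K) (V : Rd d → ℝ) (x : Rd d) : ℝ :=
  ∑ z ∈ hK.vertFinset, V z * hat K z x

theorem IsMesh.nodal_eq (hK : IsMesh Ω Λ K) (V : Rd d → ℝ) (hT : T ∈ cells K) {x : Rd d}
    (hx : x ∈ simplex T) : hK.nodal V x = ∑ z ∈ T, V z * cellCoord T z x := by
  have hsub : T ⊆ hK.vertFinset := fun z hz => hK.mem_vertFinset.2 ⟨T, hT, hz⟩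
  rw [IsMesh.nodal, ← Finset.sum_subset hsub]
  · exact Finset.sum_congr rfl fun z _ => by rw [hat_eq_cellCoord hT hx]
  · intro z _ hz
    rw [hat_eq_cellCoord hT hx, cellCoord_of_notMem hz, mul_zero]

/-- Affine functions are reproduced exactly on each element, so only nodal errors remain. -/
theorem IsMesh.nodal_sub_eq (hK : IsMesh Ω Λ K) (V : Rd d → ℝ) (hT : T ∈ cells K) {x : Rd d}
    (hx : x ∈ simplex T) (q : Rd d →ᵃ[ℝ] ℝ) :
    hK.nodal V x - q x = ∑ z ∈ T, (V z - q z) * hat K z x := by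
  rw [hK.nodal_eq V hT hx, affineMap_eq_sum_cellCoord hT q x, ← Finset.sum_sub_distrib]
  exact Finset.sum_congr rfl fun z _ => by rw [hat_eq_cellCoord hT hx]; ring

theorem IsMesh.memVh_nodal (hK : IsMesh Ω Λ K) (V : Rd d → ℝ) : MemVh Λ K (hK.nodal V) where
  continuousOn := continuousOn_finsetSum _ fun z _ => continuousOn_const.mul (hK.continuousOn_hat z)
  affine T hT := by
    refine ⟨∑ z ∈ T, V z • cellCoord T z, fun x hx => ?_⟩
    rw [hK.nodal_eq V hT hx]
    have h : ∀ F : Finset (Rd d), (∑ z ∈ F, V z • cellCoord T z) x =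
        ∑ z ∈ F, V z * cellCoord T z x := by
      classical
      intro F
      induction F using Finset.induction_on with
      | empty => simp
      | insert a F ha ih =>
        rw [Finset.sum_insert ha, Finset.sum_insert ha, AffineMap.coe_add, Pi.add_apply, ih]
        simp
    exact (h T).symm
  zero_outside x hx := Finset.sum_eq_zero fun z _ => by rw [hK.hat_eq_zero_of_notMem hx, mul_zero]

theorem MemVh.measurable {v : Rd d → ℝ} (hv : MemVh Λ K v) : Measurable v := by
  have h : v = (closure Λ).indicator v := by
    ext x
    by_cases hx : x ∈ closure Λ
    · rw [indicator_of_mem hx]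
    · rw [indicator_of_notMem hx, hv.zero_outside x hx]
  rw [h]
  classical
  exact hv.continuousOn.measurable_piecewise continuousOn_const isClosed_closure.measurableSet

/-- Estimate of the nodal error on one element. -/
theorem IsMesh.enorm_nodal_sub_le (hK : IsMesh Ω Λ K) (V : Rd d → ℝ) (hT : T ∈ cells K) {x : Rd d}
    (hx : x ∈ simplex T) (q : Rd d →ᵃ[ℝ] ℝ) :
    ‖hK.nodal V x - q x‖ₑ ≤ ∑ z ∈ T, ‖V z - q z‖ₑ := by
  rw [hK.nodal_sub_eq V hT hx]
  refine (enorm_sum_le _ _).trans (Finset.sum_le_sum fun z _ => ?_)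
  rw [enorm_mul]
  refine mul_le_of_le_one_right (zero_le) ?_
  rw [hat_eq_cellCoord hT hx, Real.enorm_eq_ofReal (cellCoord_nonneg hT hx z)]
  exact ENNReal.ofReal_le_one.2 (cellCoord_le_one hT hx z)

/-- All elements met by the segment have `z` as a vertex, because the hat function of `z` is
positive along it. The slopes of the other hat functions on these elements are at most `R ^ 3 / diam
(vertexStar K z)`, by comparability of the stars. -/
theorem IsMesh.abs_nodal_sub_le_of_segment (hK : IsMesh Ω Λ K) (hΛ : IsBoundedLipschitzDomain Λ)
    (hR : StarRegular Λ K R) (V : Rd d → ℝ) (hT : T ∈ cells K) {z : Rd d} (hz : z ∈ T)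
    (q : Rd d →ᵃ[ℝ] ℝ) {x y : Rd d} (hxy : segment ℝ x y ⊆ openStar Λ K z) :
    |(hK.nodal V x - q x) - (hK.nodal V y - q y)| ≤ R ^ 3 / Metric.diam (vertexStar K z) *
      (∑ S ∈ hK.starFinset z, ∑ z' ∈ S, |V z' - q z'|) * ‖x - y‖ := by
  have hR0 : 0 < R := one_pos.trans_le hR.one_le
  set H := Metric.diam (vertexStar K z) with hH
  have hH0 : 0 < H := hR.star_pos hK hΛ.isBounded hT hz
  refine hK.abs_sub_le_of_segment (f := fun x => hK.nodal V x - q x) (fun S hS hne a ha b hb => ?_)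
    (hxy.trans ((openStar_subset_vertexStar z).trans (hK.vertexStar_subset z)))
  obtain ⟨w, hw, hwS⟩ := hne
  have hzS : z ∈ S := mem_of_hat_pos hS hwS (hxy hw).2
  have hHS := hR.star_le S hS z hzS
  simp only [hK.nodal_sub_eq V hS ha, hK.nodal_sub_eq V hS hb]
  rw [← Finset.sum_sub_distrib]
  calc _ ≤ ∑ z' ∈ S, |V z' - q z'| * (R ^ 3 / H * ‖a - b‖) := by
        refine (Finset.abs_sum_le_sum_abs _ _).trans (Finset.sum_le_sum fun z' hz' => ?_)
        rw [← mul_sub, abs_mul]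
        refine mul_le_mul_of_nonneg_left ?_ (abs_nonneg _)
        have hz'0 := hR.star_pos hK hΛ.isBounded hS hz'
        refine (abs_hat_sub_le_of_mem_simplex hR0 (hR.diam_pos S hS) hS (hR.star_le S hS z')
          hz'0 (hR.inball S hS) ha hb).trans ?_
        refine mul_le_mul_of_nonneg_right ?_ (norm_nonneg _)
        rw [div_le_div_iff₀ hz'0 hH0]
        have := hK.diam_simplex_le_star hΛ.isBounded hS hz'
        calc R ^ 2 * H ≤ R ^ 2 * (R * Metric.diam (vertexStar K z')) := by
              gcongr
              exact hHS.trans (by gcongr)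
          _ = _ := by ring
    _ = R ^ 3 / H * (∑ z' ∈ S, |V z' - q z'|) * ‖a - b‖ := by
        rw [← Finset.sum_mul]
        ring
    _ ≤ _ := by
        gcongr
        exact Finset.single_le_sum (f := fun S => ∑ z' ∈ S, |V z' - q z'|)
          (fun S _ => Finset.sum_nonneg fun _ _ => abs_nonneg _) (hK.mem_starFinset.2 ⟨hS, hzS⟩)

end Nodal

/-! ### Clément interpolation -/

section Clement

variable {d : ℕ} {K : Geometry.SimplicialComplex ℝ (Rd d)} {T : Finset (Rd d)}
  {Ω Λ : Set (Rd d)} {R : ℝ} {u g : Rd d → ℝ}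

open Classical in
/-- The nodal values of the Clément interpolant of `u` that uses the exterior values `g` at the
vertices outside `Ω`. -/
def clementValue (Ω : Set (Rd d)) (K : Geometry.SimplicialComplex ℝ (Rd d)) (g u : Rd d → ℝ)
    (z : Rd d) : ℝ :=
  if z ∈ Ω then projValue (vertexStar K z) u z else projValue (vertexStar K z ∩ Ωᶜ) g z

/-- The Clément interpolant of `u` has the exterior values prescribed by `g`. -/
theorem IsMesh.memVhg_clement (hK : IsMesh Ω Λ K) (hΩ : IsBoundedLipschitzDomain Ω)
    (hΛ : IsOpen Λ) (hΩΛ : closure Ω ⊆ Λ) (g u : Rd d → ℝ) :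
    MemVhg Ω Λ K g (hK.nodal (clementValue Ω K g u)) where
  memVh := hK.memVh_nodal _
  eq_exterior x hx := by
    classical
    have h1 : K.vertices ∩ Ωᶜ = ↑(hK.vertFinset.filter (· ∉ Ω)) := by
      ext z
      simp [IsMesh.vertFinset]
    rw [exteriorClement, h1, finsum_mem_coe_finset, Finset.sum_filter, IsMesh.nodal]
    refine Finset.sum_congr rfl fun z _ => ?_
    by_cases hz : z ∈ Ω
    · rw [if_neg (not_not.2 hz), hK.hat_eq_zero_of_vertex_mem hΩ hΛ hΩΛ hz hx.2, mul_zero]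
    · rw [if_pos hz, clementValue, if_neg hz]

theorem enorm_projValue_sub_le (hd : 1 ≤ d) {S : Set (Rd d)} (hSm : MeasurableSet S)
    {c : Rd d} {r κ : ℝ} (hr : 0 < r) (hκ : 0 ≤ κ)
    (hB : Metric.closedBall c r ⊆ S) (hS : S ⊆ Metric.closedBall c (κ * r))
    {f : Rd d → ℝ} (hf : IntegrableOn f S) (q : Rd d →ᵃ[ℝ] ℝ) {z : Rd d} (hz : z ∈ S) :
    ‖projValue S f z - q z‖ₑ ≤ ENNReal.ofReal (((1 + 4 * κ) * 2 ^ d) ^ 2 /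
      volume.real (Metric.closedBall c r)) * ∫⁻ x in S, ‖f x - q x‖ₑ := by
  have hfq : IntegrableOn (fun x => f x - q x) S :=
    hf.sub (integrableOn_affineMap q (Metric.isBounded_closedBall.subset hS))
  rw [← ofReal_integral_norm_eq_lintegral_enorm hfq, ← ENNReal.ofReal_mul (by positivity),
    ← ofReal_norm]
  exact ENNReal.ofReal_le_ofReal (abs_projValue_sub_le hd hSm hr hB hS hf q hz)

theorem enorm_affineMap_le (hd : 1 ≤ d) {c : Rd d} {r κ : ℝ} (hr : 0 < r) (hκ : 0 ≤ κ)
    (q : Rd d →ᵃ[ℝ] ℝ) {x : Rd d} (hx : x ∈ Metric.closedBall c (κ * r)) :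
    ‖q x‖ₑ ≤ ENNReal.ofReal ((1 + 4 * κ) * 2 ^ d / volume.real (Metric.closedBall c r)) *
      ∫⁻ x in Metric.closedBall c r, ‖q x‖ₑ := by
  rw [← ofReal_integral_norm_eq_lintegral_enorm (integrableOn_affineMap q
    Metric.isBounded_closedBall), ← ENNReal.ofReal_mul (by positivity), ← ofReal_norm]
  exact ENNReal.ofReal_le_ofReal (abs_affineMap_le_integral hd q hr hx)

theorem volume_real_closedBall_eq (hd : 1 ≤ d) (c : Rd d) {r : ℝ} (hr : 0 ≤ r) :
    volume.real (Metric.closedBall c r) = r ^ d * volume.real (Metric.closedBall (0 : Rd d) 1) := by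
  rw [measureReal_def, ← mul_one r, volume_closedBall_eq hd c zero_le_one hr,
    volume_closedBall_center c 0, ENNReal.toReal_mul, ENNReal.toReal_pow, ENNReal.toReal_ofReal hr,
    mul_one, measureReal_def]

theorem volume_real_closedBall_pos : 0 < volume.real (Metric.closedBall (0 : Rd d) 1) :=
  ENNReal.toReal_pos (Metric.measure_closedBall_pos volume 0 one_pos).ne' measure_closedBall_lt_top.ne

/-- The constant in the estimate of the nodal values of the Clément interpolant. -/
def clementConst (d : ℕ) (R : ℝ) : ℝ :=
  ((1 + 4 * R ^ 2) * 2 ^ d) ^ 2 * R ^ (2 * d) / volume.real (Metric.closedBall (0 : Rd d) 1)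

theorem clementConst_pos (hR : 1 ≤ R) : 0 < clementConst d R := by
  have := volume_real_closedBall_pos (d := d)
  rw [clementConst]
  positivity

theorem div_volume_closedBall_le (hd : 1 ≤ d) (hR : 1 ≤ R) {r h a : ℝ} (hh : 0 < h)
    (hrh : h / R ^ 2 ≤ r) (ha : a ≤ ((1 + 4 * R ^ 2) * 2 ^ d) ^ 2) (c : Rd d) :
    a / volume.real (Metric.closedBall c r) ≤ clementConst d R / h ^ d := by
  have hR0 : 0 < R := by linarith
  have hω := volume_real_closedBall_pos (d := d)
  have hr : 0 < r := lt_of_lt_of_le (by positivity) hrh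
  rw [volume_real_closedBall_eq hd c hr.le]
  calc _ ≤ ((1 + 4 * R ^ 2) * 2 ^ d) ^ 2 /
      ((h / R ^ 2) ^ d * volume.real (Metric.closedBall (0 : Rd d) 1)) := by gcongr
    _ = _ := by
      rw [clementConst, div_pow, ← pow_mul]
      field_simp

theorem IsMesh.integrableOn_vertexStar (hK : IsMesh Ω Λ K) (hΛ : IsBoundedLipschitzDomain Λ)
    (hu : IntegrableOn u Λ) (z : Rd d) : IntegrableOn u (vertexStar K z) := by
  rw [← integrableOn_congr_set_ae (hK.openStar_ae_eq hΛ z)]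
  exact hu.mono_set fun x hx => hx.1

/-- In either case the projection is taken over a subset of the star containing a full element with
vertex `z`, so the stability constant is uniform. Outside `Ω` the datum `g` may be replaced by `u`,
and the `L¹` norm over part of the star is at most that over the whole star. -/
theorem StarRegular.enorm_clementValue_sub_le (hd : 1 ≤ d) (hR : StarRegular Λ K R)
    (hK : IsMesh Ω Λ K) (hΩ : IsBoundedLipschitzDomain Ω) (hΛ : IsBoundedLipschitzDomain Λ)
    (hΩΛ : closure Ω ⊆ Λ) (hu : IntegrableOn u Λ) (hug : u =ᵐ[volume.restrict Ωᶜ] g)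
    (q : Rd d →ᵃ[ℝ] ℝ) (hT : T ∈ cells K) {z : Rd d} (hz : z ∈ T) :
    ‖clementValue Ω K g u z - q z‖ₑ ≤
      ENNReal.ofReal (clementConst d R / Metric.diam (simplex T) ^ d) *
        ∫⁻ x in vertexStar K z, ‖u x - q x‖ₑ := by
  have hR1 := hR.one_le
  have hR0 : 0 < R := by linarith
  set H := Metric.diam (vertexStar K z) with hH
  have hT0 := hR.diam_pos T hT
  have hTH := hK.diam_simplex_le_star hΛ.isBounded hT hz
  have main : ∀ S ⊆ vertexStar K z, MeasurableSet S → ∀ f, IntegrableOn f S → ∀ T' ∈ cells K,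
      z ∈ T' → simplex T' ⊆ S → ‖projValue S f z - q z‖ₑ ≤
        ENNReal.ofReal (clementConst d R / Metric.diam (simplex T) ^ d) *
          ∫⁻ x in S, ‖f x - q x‖ₑ := by
    intro S hS hSm f hf T' hT' hz' hT'S
    obtain ⟨c, hc⟩ := hR.inball T' hT'
    have hT'0 := hR.diam_pos T' hT'
    have hHT' := hR.star_le T' hT' z hz'
    have hr : 0 < Metric.diam (simplex T') / R := by positivity
    have hSB : S ⊆ Metric.closedBall c (R ^ 2 * (Metric.diam (simplex T') / R)) := fun x hx => by
      have h1 : dist x c ≤ H := Metric.dist_le_diam_of_mem (hK.isBounded_vertexStar hΛ.isBounded z)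
        (hS hx) (hS (hT'S (hc (Metric.mem_closedBall_self hr.le))))
      rw [Metric.mem_closedBall]
      refine h1.trans (hHT'.trans (le_of_eq ?_))
      field_simp
    refine (enorm_projValue_sub_le hd hSm hr (by positivity) (hc.trans hT'S) hSB hf q
      (hT'S (vertex_mem_simplex hz'))).trans (mul_le_mul_left (ENNReal.ofReal_le_ofReal ?_) _)
    refine div_volume_closedBall_le hd hR1 hT0 ?_ le_rfl c
    rw [div_le_div_iff₀ (by positivity) hR0]
    calc Metric.diam (simplex T) * R ≤ R * Metric.diam (simplex T') * R := by
          gcongr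
          exact hTH.trans hHT'
      _ = _ := by ring
  have hint := hK.integrableOn_vertexStar hΛ hu z
  by_cases hzΩ : z ∈ Ω
  · rw [clementValue, if_pos hzΩ]
    exact main _ subset_rfl (hK.measurableSet_vertexStar z) u hint T hT hz
      (simplex_subset_vertexStar hT hz)
  · rw [clementValue, if_neg hzΩ]
    obtain ⟨T', hT', hz', hT'Ω⟩ := hK.exists_cell_subset_compl hΩ hΛ.isOpen hΩΛ hT hz hzΩ
    have hug' : u =ᵐ[volume.restrict (vertexStar K z ∩ Ωᶜ)] g :=
      ae_restrict_of_ae_restrict_of_subset inter_subset_right hug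
    refine (main (vertexStar K z ∩ Ωᶜ) inter_subset_left ((hK.measurableSet_vertexStar z).inter
      hΩ.isOpen.measurableSet.compl) g ((hint.mono_set inter_subset_left).congr hug') T' hT' hz'
      (subset_inter (simplex_subset_vertexStar hT' hz') hT'Ω)).trans (mul_le_mul_right ?_ _)
    refine (lintegral_congr_ae ?_).trans_le (lintegral_mono_set inter_subset_left)
    filter_upwards [hug'] with x hx
    rw [hx]

/-- Affine functions on different stars are compared through `u` on a common element, where `L¹`
closeness controls nodal values. -/
theorem StarRegular.enorm_affineMap_sub_le (hd : 1 ≤ d) (hR : StarRegular Λ K R)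
    (hu : AEMeasurable u (volume.restrict (simplex T))) (q q' : Rd d →ᵃ[ℝ] ℝ) (hT : T ∈ cells K)
    {z : Rd d} (hz : z ∈ T) :
    ‖q z - q' z‖ₑ ≤ ENNReal.ofReal (clementConst d R / Metric.diam (simplex T) ^ d) *
      ((∫⁻ x in simplex T, ‖u x - q x‖ₑ) + ∫⁻ x in simplex T, ‖u x - q' x‖ₑ) := by
  have hR1 := hR.one_le
  have hR0 : 0 < R := by linarith
  have hT0 := hR.diam_pos T hT
  obtain ⟨c, hc⟩ := hR.inball T hT
  have hr : 0 < Metric.diam (simplex T) / R := by positivity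
  have hzc : z ∈ Metric.closedBall c (R ^ 2 * (Metric.diam (simplex T) / R)) := by
    rw [Metric.mem_closedBall]
    refine (Metric.dist_le_diam_of_mem (isCompact_simplex T).isBounded (vertex_mem_simplex hz)
      (hc (Metric.mem_closedBall_self hr.le))).trans ?_
    calc _ ≤ R * Metric.diam (simplex T) := le_mul_of_one_le_left hT0.le hR1
      _ = _ := by field_simp
  have hA : (1 : ℝ) ≤ (1 + 4 * R ^ 2) * 2 ^ d :=
    one_le_mul_of_one_le_of_one_le (by nlinarith) (one_le_pow₀ one_le_two)
  refine (enorm_affineMap_le hd hr (by positivity) (q - q') hzc).trans ?_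
  refine mul_le_mul' (ENNReal.ofReal_le_ofReal ?_) ?_
  · refine div_volume_closedBall_le hd hR1 hT0 ?_ (le_self_pow₀ hA two_ne_zero) c
    gcongr
    exact le_self_pow₀ hR1 two_ne_zero
  · refine (lintegral_mono_set hc).trans ?_
    have hm : AEMeasurable (fun x => ‖u x - q x‖ₑ) (volume.restrict (simplex T)) :=
      (hu.sub (continuous_affineMap q).measurable.aemeasurable).enorm
    rw [← lintegral_add_left' hm]
    refine lintegral_mono fun x => ?_
    have h1 : (q - q') x = -(u x - q x) + (u x - q' x) := by
      rw [AffineMap.coe_sub, Pi.sub_apply]; ring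
    rw [h1]
    exact (enorm_add_le _ _).trans_eq (by rw [enorm_neg])

/-- The nodal error of the Clément interpolant, compared with the affine approximation on the star
of another vertex of the same element. -/
theorem StarRegular.sum_enorm_clementValue_sub_le (hd : 1 ≤ d) (hR : StarRegular Λ K R)
    (hK : IsMesh Ω Λ K) (hΩ : IsBoundedLipschitzDomain Ω) (hΛ : IsBoundedLipschitzDomain Λ)
    (hΩΛ : closure Ω ⊆ Λ) (hu : IntegrableOn u Λ) (hug : u =ᵐ[volume.restrict Ωᶜ] g)
    (q : Rd d → (Rd d →ᵃ[ℝ] ℝ)) (hT : T ∈ cells K) {z₀ : Rd d} (hz₀ : z₀ ∈ T) :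
    ∑ z ∈ T, ‖clementValue Ω K g u z - q z₀ z‖ₑ ≤
      ENNReal.ofReal (clementConst d R * (d + 3) / Metric.diam (simplex T) ^ d) *
        ∑ z ∈ T, ∫⁻ x in vertexStar K z, ‖u x - q z x‖ₑ := by
  set E : Rd d → ℝ≥0∞ := fun z => ∫⁻ x in vertexStar K z, ‖u x - q z x‖ₑ with hE
  set F := ∑ z ∈ T, E z with hF
  set B := ENNReal.ofReal (clementConst d R / Metric.diam (simplex T) ^ d) with hB
  have hum : AEMeasurable u (volume.restrict (simplex T)) :=
    ((hK.integrableOn_vertexStar hΛ hu z₀).mono_set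
      (simplex_subset_vertexStar hT hz₀)).aemeasurable
  -- Change of reference function from `q z` to `q z₀`. Summing over the `d + 1` vertices produces
  -- `2 + (d + 1) = d + 3`.
  have h1 : ∀ z ∈ T, ‖clementValue Ω K g u z - q z₀ z‖ₑ ≤ B * (2 * E z + E z₀) := by
    intro z hz
    have h2 := hR.enorm_clementValue_sub_le hd hK hΩ hΛ hΩΛ hu hug (q z) hT hz
    have h3 := hR.enorm_affineMap_sub_le hd hum (q z) (q z₀) hT hz
    calc _ = ‖(clementValue Ω K g u z - q z z) + (q z z - q z₀ z)‖ₑ := by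
          rw [sub_add_sub_cancel]
      _ ≤ _ := enorm_add_le _ _
      _ ≤ B * E z + B * (E z + E z₀) := by
          refine add_le_add h2 (h3.trans ?_)
          gcongr
          · exact lintegral_mono_set (simplex_subset_vertexStar hT hz)
          · exact lintegral_mono_set (simplex_subset_vertexStar hT hz₀)
      _ = _ := by ring
  calc _ ≤ ∑ z ∈ T, B * (2 * E z + E z₀) := Finset.sum_le_sum h1
    _ = B * (2 * F + (d + 1) * E z₀) := by
        rw [← Finset.mul_sum, Finset.sum_add_distrib, ← Finset.mul_sum, Finset.sum_const, hT.2,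
          nsmul_eq_mul]
        push_cast
        rfl
    _ ≤ B * (2 * F + (d + 1) * F) := by
        gcongr
        exact Finset.single_le_sum (f := E) (fun _ _ => zero_le) hz₀
    _ = _ := by
        rw [mul_div_right_comm, ENNReal.ofReal_mul' (by positivity), ← hB,
          ENNReal.ofReal_add (by positivity) (by positivity), ENNReal.ofReal_natCast,
          ENNReal.ofReal_ofNat]
        ring

/-- The `L¹` error of the Clément interpolant on an element. -/
theorem StarRegular.lintegral_sub_clement_le (hd : 1 ≤ d) (hR : StarRegular Λ K R)
    (hK : IsMesh Ω Λ K) (hΩ : IsBoundedLipschitzDomain Ω) (hΛ : IsBoundedLipschitzDomain Λ)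
    (hΩΛ : closure Ω ⊆ Λ) (hu : IntegrableOn u Λ) (hug : u =ᵐ[volume.restrict Ωᶜ] g)
    (q : Rd d → (Rd d →ᵃ[ℝ] ℝ)) (hT : T ∈ cells K) :
    ∫⁻ x in simplex T, ‖u x - hK.nodal (clementValue Ω K g u) x‖ₑ ≤
      ENNReal.ofReal (1 + clementConst d R * (d + 3) *
        volume.real (Metric.closedBall (0 : Rd d) 1)) *
        ∑ z ∈ T, ∫⁻ x in vertexStar K z, ‖u x - q z x‖ₑ := by
  obtain ⟨z₀, hz₀⟩ : T.Nonempty := Finset.card_pos.1 (by rw [hT.2]; omega)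
  set V := clementValue Ω K g u with hV
  set h := Metric.diam (simplex T) with hh
  have hT0 : 0 < h := hR.diam_pos T hT
  have hC := clementConst_pos (d := d) hR.one_le
  have hsum := hR.sum_enorm_clementValue_sub_le hd hK hΩ hΛ hΩΛ hu hug q hT hz₀
  set E : Rd d → ℝ≥0∞ := fun z => ∫⁻ x in vertexStar K z, ‖u x - q z x‖ₑ with hE
  set F := ∑ z ∈ T, E z with hF
  have hvol : volume (simplex T) ≤
      ENNReal.ofReal (h ^ d * volume.real (Metric.closedBall (0 : Rd d) 1)) := by
    rw [← volume_real_closedBall_eq hd z₀ hT0.le, measureReal_def,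
      ENNReal.ofReal_toReal measure_closedBall_lt_top.ne]
    exact measure_mono fun x hx => Metric.dist_le_diam_of_mem (isCompact_simplex T).isBounded hx
      (vertex_mem_simplex hz₀)
  have hpt : ∀ x ∈ simplex T, ‖u x - hK.nodal V x‖ₑ ≤ ‖u x - q z₀ x‖ₑ +
      ∑ z ∈ T, ‖V z - q z₀ z‖ₑ := fun x hx => by
    calc _ = ‖(u x - q z₀ x) + -(hK.nodal V x - q z₀ x)‖ₑ := by congr 1; ring
      _ ≤ _ := enorm_add_le _ _
      _ ≤ _ := by
        rw [enorm_neg]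
        gcongr
        exact hK.enorm_nodal_sub_le V hT hx _
  calc _ ≤ ∫⁻ x in simplex T, (‖u x - q z₀ x‖ₑ + ∑ z ∈ T, ‖V z - q z₀ z‖ₑ) :=
        setLIntegral_mono' (measurableSet_simplex T) hpt
    _ = (∫⁻ x in simplex T, ‖u x - q z₀ x‖ₑ) +
        (∑ z ∈ T, ‖V z - q z₀ z‖ₑ) * volume (simplex T) := by
        rw [lintegral_add_right _ measurable_const, lintegral_const, Measure.restrict_apply_univ]
    _ ≤ F + (ENNReal.ofReal (clementConst d R * (d + 3) / h ^ d) * F) *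
        ENNReal.ofReal (h ^ d * volume.real (Metric.closedBall (0 : Rd d) 1)) := by
        gcongr
        exact (lintegral_mono_set (simplex_subset_vertexStar hT hz₀)).trans
          (Finset.single_le_sum (f := E) (fun _ _ => zero_le) hz₀)
    _ = _ := by
        rw [ENNReal.ofReal_add zero_le_one (by positivity), add_mul, ENNReal.ofReal_one, one_mul,
          mul_right_comm, ← ENNReal.ofReal_mul (by positivity)]
        congr 3
        field_simp

end Clement

/-! ### The interpolation error in the energy seminorm -/

section InterpolationError

variable {d : ℕ} {K : Geometry.SimplicialComplex ℝ (Rd d)} {T : Finset (Rd d)}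
  {Ω Λ : Set (Rd d)} {R s t : ℝ}

theorem lintegral_biUnion_finset_le {α ι : Type*} [MeasurableSpace α] {μ : Measure α}
    (F : Finset ι) (A : ι → Set α) (f : α → ℝ≥0∞) :
    ∫⁻ x in ⋃ i ∈ F, A i, f x ∂μ ≤ ∑ i ∈ F, ∫⁻ x in A i, f x ∂μ := by
  classical
  induction F using Finset.induction_on with
  | empty => simp
  | insert i F hi ih =>
    rw [Finset.set_biUnion_insert, Finset.sum_insert hi]
    exact (lintegral_union_le _ _ _).trans (add_le_add le_rfl ih)

theorem rieszKernel_mul_ofReal_norm_le (α : ℝ) (w : Rd d) :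
    rieszKernel α w * ENNReal.ofReal ‖w‖ ≤ rieszKernel (α - 1) w := by
  rw [rieszKernel, rieszKernel, ← ENNReal.ofReal_mul (by positivity)]
  refine ENNReal.ofReal_le_ofReal ?_
  rcases (norm_nonneg w).eq_or_lt with h | h
  · rw [← h, mul_zero]
    positivity
  · rw [show -(α - 1) = -α + 1 by ring, Real.rpow_add h, Real.rpow_one]

/-- Writing `u - I = (u - q) - (I - q)`, the first part is left for the affine approximation. The
second is Lipschitz along the segments in question, with slope of order `H ^ (-1 - d)` times the
local `L¹` errors. Integrating the kernel lowered by one order over the star gives `H ^ (1 - 2s +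
d)`, in total `H ^ (-2s)`. -/
theorem exists_lintegral_near_clement_le (hd : 1 ≤ d) (hs₁ : s < 1 / 2) (hR1 : 1 ≤ R)
    (hΩ : IsBoundedLipschitzDomain Ω) (hΛ : IsBoundedLipschitzDomain Λ) (hΩΛ : closure Ω ⊆ Λ) :
    ∃ C : ℝ, 0 < C ∧ ∀ (K : Geometry.SimplicialComplex ℝ (Rd d)) (hK : IsMesh Ω Λ K),
      StarRegular Λ K R → ∀ u g : Rd d → ℝ, IntegrableOn u Λ → u =ᵐ[volume.restrict Ωᶜ] g →
      ∀ (q : Rd d → (Rd d →ᵃ[ℝ] ℝ)), ∀ T ∈ cells K, ∀ z ∈ T,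
      ∫⁻ p in {p : Rd d × Rd d | segment ℝ p.1 p.2 ⊆ openStar Λ K z},
        rieszKernel (d + 2 * s) (p.1 - p.2) *
          ‖(u - hK.nodal (clementValue Ω K g u)) p.1 - (u - hK.nodal (clementValue Ω K g u)) p.2‖ₑ ≤
      (∫⁻ p in {p : Rd d × Rd d | segment ℝ p.1 p.2 ⊆ openStar Λ K z},
        rieszKernel (d + 2 * s) (p.1 - p.2) * ‖(u p.1 - q z p.1) - (u p.2 - q z p.2)‖ₑ) +
      ENNReal.ofReal (C * Metric.diam (vertexStar K z) ^ (-(2 * s))) *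
        ∑ S ∈ hK.starFinset z, ∑ z' ∈ S, ∫⁻ x in vertexStar K z', ‖u x - q z' x‖ₑ := by
  obtain ⟨C₃, hC₃, hnear⟩ := exists_lintegral_near_le hd hs₁
  have hR0 : 0 < R := by linarith
  have hω := volume_real_closedBall_pos (d := d)
  have hCc := clementConst_pos (d := d) hR1
  set ω := volume.real (Metric.closedBall (0 : Rd d) 1)
  refine ⟨R ^ 3 * (clementConst d R * (d + 3) * R ^ d) * C₃ * ω, by positivity,
    fun K hK hR u g hu hug q T hT z hz => ?_⟩
  set V := clementValue Ω K g u with hV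
  set H := Metric.diam (vertexStar K z) with hH
  have hH0 : 0 < H := hR.star_pos hK hΛ.isBounded hT hz
  set L := R ^ 3 / H * ∑ S ∈ hK.starFinset z, ∑ z' ∈ S, |V z' - q z z'| with hL
  set near := {p : Rd d × Rd d | segment ℝ p.1 p.2 ⊆ openStar Λ K z} with hnr
  set G := ∑ S ∈ hK.starFinset z, ∑ z' ∈ S, ∫⁻ x in vertexStar K z', ‖u x - q z' x‖ₑ with hG
  set ψ : Rd d → ℝ≥0∞ :=
    (Metric.closedBall (0 : Rd d) H).indicator (rieszKernel (d + 2 * s - 1)) with hψ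
  have hψm : Measurable ψ := (measurable_rieszKernel _).indicator
    Metric.isClosed_closedBall.measurableSet
  have hψm' : Measurable fun p : Rd d × Rd d => ψ (p.1 - p.2) :=
    hψm.comp (measurable_fst.sub measurable_snd)
  have hnearm : MeasurableSet near :=
    (isOpen_setOf_segment_subset (hK.isOpen_openStar hΛ.isOpen z)).measurableSet
  have hpt : ∀ p ∈ near, rieszKernel (d + 2 * s) (p.1 - p.2) *
      ‖(u - hK.nodal V) p.1 - (u - hK.nodal V) p.2‖ₑ ≤
      rieszKernel (d + 2 * s) (p.1 - p.2) * ‖(u p.1 - q z p.1) - (u p.2 - q z p.2)‖ₑ +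
      ENNReal.ofReal L * ψ (p.1 - p.2) := by
    intro p hp
    have h1 := hK.abs_nodal_sub_le_of_segment hΛ hR V hT hz (q z) hp
    rw [← hL] at h1
    have h2 : ‖(hK.nodal V p.1 - q z p.1) - (hK.nodal V p.2 - q z p.2)‖ₑ ≤
        ENNReal.ofReal L * ENNReal.ofReal ‖p.1 - p.2‖ := by
      rw [← ENNReal.ofReal_mul (by positivity), ← ofReal_norm]
      exact ENNReal.ofReal_le_ofReal h1
    have h3 : ψ (p.1 - p.2) = rieszKernel (d + 2 * s - 1) (p.1 - p.2) := by
      rw [hψ, indicator_of_mem]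
      rw [mem_closedBall_zero_iff]
      exact hK.norm_sub_le_of_segment_subset hΛ hp
    calc _ = rieszKernel (d + 2 * s) (p.1 - p.2) *
          ‖((u p.1 - q z p.1) - (u p.2 - q z p.2)) +
            -((hK.nodal V p.1 - q z p.1) - (hK.nodal V p.2 - q z p.2))‖ₑ := by
          congr 2
          simp only [Pi.sub_apply]
          ring
      _ ≤ rieszKernel (d + 2 * s) (p.1 - p.2) * (‖(u p.1 - q z p.1) - (u p.2 - q z p.2)‖ₑ +
          ENNReal.ofReal L * ENNReal.ofReal ‖p.1 - p.2‖) := by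
          refine mul_le_mul_right ((enorm_add_le _ _).trans ?_) _
          rw [enorm_neg]
          gcongr
      _ ≤ _ := by
          rw [mul_add, h3, mul_left_comm]
          gcongr
          exact rieszKernel_mul_ofReal_norm_le _ _
  have hLG : ENNReal.ofReal L ≤
      ENNReal.ofReal (R ^ 3 / H * (clementConst d R * (d + 3) * R ^ d / H ^ d)) * G := by
    rw [hL, ENNReal.ofReal_mul (by positivity), ENNReal.ofReal_mul (by positivity), mul_assoc]
    refine mul_le_mul_right ?_ _
    rw [ENNReal.ofReal_sum_of_nonneg fun S _ => Finset.sum_nonneg fun _ _ => abs_nonneg _, hG,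
      Finset.mul_sum]
    refine Finset.sum_le_sum fun S hS => ?_
    obtain ⟨hSK, hzS⟩ := hK.mem_starFinset.1 hS
    rw [ENNReal.ofReal_sum_of_nonneg fun _ _ => abs_nonneg _]
    have h1 := hR.sum_enorm_clementValue_sub_le hd hK hΩ hΛ hΩΛ hu hug q hSK hzS
    simp only [← ofReal_norm, Real.norm_eq_abs] at h1 ⊢
    refine h1.trans (mul_le_mul_left (ENNReal.ofReal_le_ofReal ?_) _)
    have hS0 := hR.diam_pos S hSK
    rw [div_le_div_iff₀ (by positivity) (by positivity)]
    have h2 : H ^ d ≤ R ^ d * Metric.diam (simplex S) ^ d := by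
      rw [← mul_pow]
      gcongr
      exact hR.star_le S hSK z hzS
    calc _ ≤ clementConst d R * (d + 3) * (R ^ d * Metric.diam (simplex S) ^ d) := by gcongr
      _ = _ := by ring
  have hvol : volume (vertexStar K z) ≤ ENNReal.ofReal (H ^ d * ω) := by
    rw [← volume_real_closedBall_eq hd z hH0.le, measureReal_def,
      ENNReal.ofReal_toReal measure_closedBall_lt_top.ne]
    exact measure_mono (hK.vertexStar_subset_closedBall hΛ.isBounded hT hz)
  have hψle : ∫⁻ p in near, ψ (p.1 - p.2) ≤
      ENNReal.ofReal (C₃ * H ^ (1 - 2 * s)) * ENNReal.ofReal (H ^ d * ω) := by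
    refine (lintegral_mono_set fun p hp => ?_).trans ((hnear H hH0 (vertexStar K z)).trans
      (mul_le_mul_right hvol _))
    exact ⟨openStar_subset_vertexStar z (hp (left_mem_segment ℝ _ _)), mem_univ _⟩
  refine (setLIntegral_mono' hnearm hpt).trans ?_
  rw [lintegral_add_right _ (hψm'.const_mul _), lintegral_const_mul _ hψm']
  refine add_le_add le_rfl ((mul_le_mul' hLG hψle).trans (le_of_eq ?_))
  rw [mul_right_comm, ← ENNReal.ofReal_mul (by positivity), ← ENNReal.ofReal_mul (by positivity)]
  congr 2
  rw [show (1 : ℝ) - 2 * s = -(2 * s) + 1 by ring, Real.rpow_add hH0, Real.rpow_one]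
  field_simp

theorem IsMesh.diam_simplex_le_meshSize (hK : IsMesh Ω Λ K) (hT : T ∈ cells K) :
    Metric.diam (simplex T) ≤ meshSize K :=
  le_csSup (hK.cells_finite.image _).bddAbove (mem_image_of_mem _ hT)

theorem IsMesh.meshSize_nonneg (K : Geometry.SimplicialComplex ℝ (Rd d)) : 0 ≤ meshSize K :=
  Real.sSup_nonneg (by rintro _ ⟨T, -, rfl⟩; exact Metric.diam_nonneg)

theorem IsMesh.sum_star_comm (hK : IsMesh Ω Λ K) (f : Rd d → Finset (Rd d) → ℝ≥0∞) :
    ∑ z ∈ hK.vertFinset, ∑ T ∈ hK.starFinset z, f z T =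
      ∑ T ∈ hK.cellFinset, ∑ z ∈ T, f z T := by
  refine Finset.sum_comm' fun z T => ?_
  simp only [hK.mem_vertFinset, hK.mem_starFinset, hK.mem_cellFinset]
  exact ⟨fun h => ⟨h.2.2, h.2.1⟩, fun h => ⟨⟨T, h.2, h.1⟩, h.2, h.1⟩⟩

/-- Splitting of the energy seminorm of a function that vanishes outside the mesh. -/
theorem exists_energySeminorm_le_sum (hs₀ : 0 < s) (hR1 : 1 ≤ R)
    (hΩ : IsBoundedLipschitzDomain Ω) (hΛ : IsBoundedLipschitzDomain Λ) (hΩΛ : closure Ω ⊆ Λ) :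
    ∃ C : ℝ, 0 < C ∧ ∀ (K : Geometry.SimplicialComplex ℝ (Rd d)) (hK : IsMesh Ω Λ K),
      StarRegular Λ K R → ∀ e : Rd d → ℝ, AEStronglyMeasurable e → e =ᵐ[volume.restrict Λᶜ] 0 →
      energySeminorm s Ω e ≤ 2 * (∑ z ∈ hK.vertFinset,
        ∫⁻ p in {p : Rd d × Rd d | segment ℝ p.1 p.2 ⊆ openStar Λ K z},
          rieszKernel (d + 2 * s) (p.1 - p.2) * ‖e p.1 - e p.2‖ₑ) +
        ENNReal.ofReal C * ∑ T ∈ hK.cellFinset,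
          ENNReal.ofReal (Metric.diam (simplex T) ^ (-(2 * s))) * ∫⁻ x in simplex T, ‖e x‖ₑ := by
  obtain ⟨ε, hε, hseg⟩ := exists_segment_subset_openStar hΩ hΛ hΩΛ hR1
  obtain ⟨C₄, hC₄, hfar⟩ := exists_lintegral_far_le (d := d) hs₀
  -- A factor two comes from symmetrization in `energySeminorm_le`, another from bounding `|e(x) -
  -- e(y)|` by two terms.
  refine ⟨4 * (C₄ * ε ^ (-(2 * s))), by positivity, fun K hK hR e he he0 => ?_⟩
  set near : Rd d → Set (Rd d × Rd d) :=
    fun z => {p : Rd d × Rd d | segment ℝ p.1 p.2 ⊆ openStar Λ K z} with hnr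
  set F : Rd d × Rd d → ℝ≥0∞ :=
    fun p => rieszKernel (d + 2 * s) (p.1 - p.2) * ‖e p.1 - e p.2‖ₑ with hF
  set φ : Finset (Rd d) → Rd d → ℝ≥0∞ := fun T =>
    (Metric.ball (0 : Rd d) (ε * Metric.diam (simplex T)))ᶜ.indicator (rieszKernel (d + 2 * s))
    with hφ
  set far : Set (Rd d × Rd d) := (Ω ×ˢ univ) \ ⋃ z ∈ hK.vertFinset, near z with hfr
  set X := ∑ T ∈ hK.cellFinset,
    ENNReal.ofReal (Metric.diam (simplex T) ^ (-(2 * s))) * ∫⁻ x in simplex T, ‖e x‖ₑ with hX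
  have hfarm : MeasurableSet far := by
    refine (hΩ.isOpen.measurableSet.prod MeasurableSet.univ).diff ?_
    exact hK.vertFinset.measurableSet_biUnion fun z _ =>
      (isOpen_setOf_segment_subset (hK.isOpen_openStar hΛ.isOpen z)).measurableSet
  -- For a pair in no near set the distance is at least `ε` times the diameter of any element
  -- containing one of the points, so the kernel may be cut off at that local scale.
  have hdist : ∀ p ∈ far, ∀ T ∈ cells K, (p.1 ∈ simplex T ∨ p.2 ∈ simplex T) →
      φ T (p.1 - p.2) = rieszKernel (d + 2 * s) (p.1 - p.2) := by
    intro p hp T hT h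
    rw [hφ]
    refine indicator_of_mem ?_ _
    rw [mem_compl_iff, mem_ball_zero_iff]
    intro hlt
    obtain ⟨z, hz, hsub⟩ := hseg K hK hR p.1 hp.1.1 p.2 T hT h hlt
    exact hp.2 (mem_biUnion (hK.mem_vertFinset.2 ⟨T, hT, hz⟩) hsub)
  have hem : AEMeasurable fun x => ‖e x‖ₑ := he.enorm
  have hkm : Measurable fun p : Rd d × Rd d => rieszKernel (d + 2 * s) (p.1 - p.2) :=
    (measurable_rieszKernel _).comp (measurable_fst.sub measurable_snd)
  have hm1 : AEMeasurable fun p : Rd d × Rd d =>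
      rieszKernel (d + 2 * s) (p.1 - p.2) * ‖e p.1‖ₑ :=
    hkm.aemeasurable.mul (hem.comp_quasiMeasurePreserving Measure.quasiMeasurePreserving_fst)
  have hscale : ∀ T ∈ hK.cellFinset,
      ENNReal.ofReal (C₄ * (ε * Metric.diam (simplex T)) ^ (-(2 * s))) =
      ENNReal.ofReal (C₄ * ε ^ (-(2 * s))) *
        ENNReal.ofReal (Metric.diam (simplex T) ^ (-(2 * s))) := by
    intro T _
    rw [← ENNReal.ofReal_mul (by positivity), Real.mul_rpow hε.le Metric.diam_nonneg, mul_assoc]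
  have hfar1 : ∫⁻ p in far, rieszKernel (d + 2 * s) (p.1 - p.2) * ‖e p.1‖ₑ ≤
      ENNReal.ofReal (C₄ * ε ^ (-(2 * s))) * X := by
    have hcov : far ⊆ ⋃ T ∈ hK.cellFinset, far ∩ (simplex T ×ˢ univ) := by
      intro p hp
      obtain ⟨T, hT, hxT⟩ := hK.exists_mem_simplex (subset_closure (hΩΛ (subset_closure hp.1.1)))
      exact mem_biUnion (hK.mem_cellFinset.2 hT) ⟨hp, hxT, mem_univ _⟩
    refine (lintegral_mono_set hcov).trans ((lintegral_biUnion_finset_le _ _ _).trans ?_)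
    rw [hX, Finset.mul_sum]
    refine Finset.sum_le_sum fun T hT => ?_
    have hTK := hK.mem_cellFinset.1 hT
    rw [← mul_assoc, ← hscale T hT]
    refine le_trans ?_ (hfar _ (mul_pos hε (hR.diam_pos T hTK)) _ hem (simplex T)).1
    refine (setLIntegral_mono' (hfarm.inter ((measurableSet_simplex T).prod MeasurableSet.univ))
      fun p hp => ?_).trans (lintegral_mono_set inter_subset_right)
    rw [← hdist p hp.1 T hTK (Or.inl hp.2.1)]
  have hfar2 : ∫⁻ p in far, rieszKernel (d + 2 * s) (p.1 - p.2) * ‖e p.2‖ₑ ≤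
      ENNReal.ofReal (C₄ * ε ^ (-(2 * s))) * X := by
    have hcov : far ⊆ far ∩ (univ ×ˢ Λᶜ) ∪ ⋃ T ∈ hK.cellFinset, far ∩ (univ ×ˢ simplex T) := by
      intro p hp
      by_cases hp2 : p.2 ∈ Λ
      · obtain ⟨T, hT, hxT⟩ := hK.exists_mem_simplex (subset_closure hp2)
        exact Or.inr (mem_biUnion (hK.mem_cellFinset.2 hT) ⟨hp, mem_univ _, hxT⟩)
      · exact Or.inl ⟨hp, mem_univ _, hp2⟩
    -- If `y` is outside `Λ` no element controls it, but there `e` vanishes almost everywhere.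
    have hzero : ∫⁻ p in far ∩ (univ ×ˢ Λᶜ),
        rieszKernel (d + 2 * s) (p.1 - p.2) * ‖e p.2‖ₑ = 0 := by
      refine le_antisymm ((lintegral_mono_set inter_subset_right).trans ?_) (zero_le)
      have h1 := lintegral_convolution_snd (measurable_rieszKernel (d := d) (d + 2 * s)) hem Λᶜ
      rw [h1]
      have h2 : ∫⁻ x in Λᶜ, ‖e x‖ₑ = 0 := by
        rw [lintegral_congr_ae (g := fun _ => 0) ?_, lintegral_zero]
        filter_upwards [he0] with x hx
        simp [hx]
      rw [h2, mul_zero]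
    refine (lintegral_mono_set hcov).trans ((lintegral_union_le _ _ _).trans ?_)
    rw [hzero, zero_add]
    refine (lintegral_biUnion_finset_le _ _ _).trans ?_
    rw [hX, Finset.mul_sum]
    refine Finset.sum_le_sum fun T hT => ?_
    have hTK := hK.mem_cellFinset.1 hT
    rw [← mul_assoc, ← hscale T hT]
    refine le_trans ?_ (hfar _ (mul_pos hε (hR.diam_pos T hTK)) _ hem (simplex T)).2
    refine (setLIntegral_mono' (hfarm.inter (MeasurableSet.univ.prod (measurableSet_simplex T)))
      fun p hp => ?_).trans (lintegral_mono_set inter_subset_right)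
    rw [← hdist p hp.1 T hTK (Or.inr hp.2.2)]
  have hfarF : ∫⁻ p in far, F p ≤ ENNReal.ofReal (C₄ * ε ^ (-(2 * s))) * X +
      ENNReal.ofReal (C₄ * ε ^ (-(2 * s))) * X := by
    refine le_trans ?_ (add_le_add hfar1 hfar2)
    rw [← lintegral_add_left' hm1.restrict]
    refine lintegral_mono fun p => ?_
    rw [← mul_add]
    exact mul_le_mul_right (enorm_sub_le) _
  refine (energySeminorm_le s Ω e).trans ?_
  have hsplit : ∫⁻ p in Ω ×ˢ univ, F p ≤ (∑ z ∈ hK.vertFinset, ∫⁻ p in near z, F p) +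
      ∫⁻ p in far, F p := by
    have hcov : Ω ×ˢ univ ⊆ (⋃ z ∈ hK.vertFinset, near z) ∪ far := fun p hp => by
      by_cases h : p ∈ ⋃ z ∈ hK.vertFinset, near z
      · exact Or.inl h
      · exact Or.inr ⟨hp, h⟩
    refine (lintegral_mono_set hcov).trans ((lintegral_union_le _ _ _).trans ?_)
    gcongr
    exact lintegral_biUnion_finset_le _ _ _
  refine (mul_le_mul_right (hsplit.trans (add_le_add le_rfl hfarF)) 2).trans (le_of_eq ?_)
  rw [ENNReal.ofReal_mul (p := 4) (by norm_num), ENNReal.ofReal_ofNat]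
  ring

end InterpolationError

/-! ### The energy seminorm of the Clément interpolation error -/

section ClementEnergy

variable {d : ℕ} {Ω Λ : Set (Rd d)} {R s t : ℝ}

/-- Passes from strict upper bounds `N` of the seminorm, for which weak derivatives can be chosen,
to the seminorm itself. Finiteness of `b` supplies an admissible `N` when `c = 0`. -/
theorem le_mul_of_forall_lt_le_mul {a b c : ℝ≥0∞} (hc : c ≠ ∞) (h : ∀ N, b < N → a ≤ c * N)
    (hb : b ≠ ∞) : a ≤ c * b := by
  rcases eq_or_ne c 0 with rfl | hc0
  · simpa using h ∞ (lt_top_iff_ne_top.2 hb)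
  · rw [mul_comm, ← ENNReal.div_le_iff_le_mul (Or.inl hc0) (Or.inl hc)]
    refine le_of_forall_gt_imp_ge_of_dense fun N hN => ?_
    rw [ENNReal.div_le_iff_le_mul (Or.inl hc0) (Or.inl hc), mul_comm]
    exact h N hN

/-- The error of the Clément interpolant in the energy seminorm. -/
theorem exists_energySeminorm_sub_clement_le (hd : 1 ≤ d) (hs₀ : 0 < s) (hs₁ : s < 1 / 2)
    (hst : 2 * s < t) (ht : t ≤ 2) (hR1 : 1 ≤ R)
    (hΩ : IsBoundedLipschitzDomain Ω) (hΛ : IsBoundedLipschitzDomain Λ) (hΩΛ : closure Ω ⊆ Λ) :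
    ∃ C : ℝ, 0 < C ∧ ∀ (K : Geometry.SimplicialComplex ℝ (Rd d)) (hK : IsMesh Ω Λ K),
      StarRegular Λ K R → ∀ u g : Rd d → ℝ, AEStronglyMeasurable u →
      u =ᵐ[volume.restrict Ωᶜ] g → u =ᵐ[volume.restrict Λᶜ] 0 → MemSobolev Λ t u →
      energySeminorm s Ω (u - hK.nodal (clementValue Ω K g u)) ≤
        ENNReal.ofReal (C * meshSize K ^ (t - 2 * s)) * sobolevSeminorm Λ t u := by
  obtain ⟨CA, hCA, happrox⟩ := exists_isStarApprox hd hs₀ hs₁ hst ht R hR1 Ω hΛ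
  obtain ⟨CN, hCN, hnear⟩ := exists_lintegral_near_clement_le hd hs₁ hR1 hΩ hΛ hΩΛ
  obtain ⟨CS, hCS, hsplit⟩ := exists_energySeminorm_le_sum (d := d) hs₀ hR1 hΩ hΛ hΩΛ
  have hR0 : 0 < R := by linarith
  have hω := volume_real_closedBall_pos (d := d)
  have hCc := clementConst_pos (d := d) hR1
  set CL := 1 + clementConst d R * (d + 3) * volume.real (Metric.closedBall (0 : Rd d) 1) with hCL
  have hCL0 : 0 < CL := by positivity
  set c₁ := 2 * CA + (2 * ((d + 1) * CN) + CS * CL) * (R * (R ^ (2 * s) * CA)) with hc₁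
  refine ⟨c₁ * 2 ^ (t - 2 * s) * (d + 1), by positivity, fun K hK hR u g hum hug hu0 hu => ?_⟩
  refine le_mul_of_forall_lt_le_mul ENNReal.ofReal_ne_top (fun N hN => ?_) hu.seminorm_lt_top.ne
  obtain ⟨q, S, hq, hS⟩ := happrox K hK hR u hu N hN
  set V := clementValue Ω K g u with hV
  set h : Finset (Rd d) → ℝ := fun T => Metric.diam (simplex T) with hh
  set H : Rd d → ℝ := fun z => Metric.diam (vertexStar K z) with hH
  set E : Rd d → ℝ≥0∞ := fun z => ∫⁻ x in vertexStar K z, ‖u x - q z x‖ₑ with hE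
  set P := ENNReal.ofReal ((2 * meshSize K) ^ (t - 2 * s)) with hP
  set Z := ∑ T ∈ hK.cellFinset, ENNReal.ofReal (h T ^ (-(2 * s))) * ∑ z ∈ T, E z with hZ
  have hM0 := IsMesh.meshSize_nonneg K
  have hHM : ∀ z, H z ≤ 2 * meshSize K := fun z =>
    diam_vertexStar_le hM0 fun T hT _ => hK.diam_simplex_le_meshSize hT
  have hHP : ∀ z, ∀ a : ℝ, 0 ≤ a → ENNReal.ofReal (a * H z ^ (t - 2 * s)) ≤
      ENNReal.ofReal a * P := by
    intro z a ha
    rw [ENNReal.ofReal_mul ha]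
    gcongr
    exact ENNReal.ofReal_le_ofReal (Real.rpow_le_rpow Metric.diam_nonneg (hHM z) (by linarith))
  have hnear1 : ∑ z ∈ hK.vertFinset, ENNReal.ofReal (CA * H z ^ (t - 2 * s)) * S z ≤
      ENNReal.ofReal CA * P * ∑ z ∈ hK.vertFinset, S z := by
    rw [Finset.mul_sum]
    exact Finset.sum_le_sum fun z _ => mul_le_mul_left (hHP z CA hCA.le) _
  -- The sum over vertices and elements of their stars is turned into a sum over elements and their
  -- vertices. The power is negative, so the smaller diameter `h T` may replace `H z`.
  have hnear2 : ∑ z ∈ hK.vertFinset, ENNReal.ofReal (CN * H z ^ (-(2 * s))) *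
      ∑ T ∈ hK.starFinset z, ∑ z' ∈ T, E z' ≤ ENNReal.ofReal ((d + 1) * CN) * Z := by
    simp only [Finset.mul_sum (hK.starFinset _)]
    rw [hK.sum_star_comm, hZ, Finset.mul_sum]
    refine Finset.sum_le_sum fun T hT => ?_
    have hTK := hK.mem_cellFinset.1 hT
    calc _ ≤ ∑ z ∈ T, ENNReal.ofReal (CN * h T ^ (-(2 * s))) * ∑ z' ∈ T, E z' := by
          refine Finset.sum_le_sum fun z hz => ?_
          gcongr ENNReal.ofReal (CN * ?_) * _
          exact Real.rpow_le_rpow_of_nonpos (hR.diam_pos T hTK)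
            (hK.diam_simplex_le_star hΛ.isBounded hTK hz) (by linarith)
      _ = _ := by
          rw [Finset.sum_const, hTK.2, nsmul_eq_mul, ENNReal.ofReal_mul hCN.le,
            ENNReal.ofReal_mul (by positivity), ENNReal.ofReal_add (by positivity) zero_le_one,
            ENNReal.ofReal_natCast, ENNReal.ofReal_one]
          push_cast
          ring
  -- The double sum is exchanged back. The size of the star replaces that of its elements at the
  -- price `R ^ (2 * s)`, and each star has at most `R` elements.
  have hZle : Z ≤ ENNReal.ofReal (R * (R ^ (2 * s) * CA)) * P * ∑ z ∈ hK.vertFinset, S z := by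
    simp only [hZ, Finset.mul_sum]
    rw [← hK.sum_star_comm]
    refine Finset.sum_le_sum fun z hz => ?_
    have hterm : ∀ T ∈ hK.starFinset z, ENNReal.ofReal (h T ^ (-(2 * s))) * E z ≤
        ENNReal.ofReal (R ^ (2 * s) * CA) * P * S z := by
      intro T hT
      obtain ⟨hTK, hzT⟩ := hK.mem_starFinset.1 hT
      have hH0 : 0 < H z := hR.star_pos hK hΛ.isBounded hTK hzT
      have h1 : h T ^ (-(2 * s)) ≤ R ^ (2 * s) * H z ^ (-(2 * s)) := by
        calc h T ^ (-(2 * s)) ≤ (H z / R) ^ (-(2 * s)) := by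
              refine Real.rpow_le_rpow_of_nonpos (by positivity) ?_ (by linarith)
              rw [div_le_iff₀' hR0]
              exact hR.star_le T hTK z hzT
          _ = _ := by
              rw [Real.div_rpow hH0.le hR0.le, Real.rpow_neg hR0.le, div_inv_eq_mul, mul_comm]
      calc _ ≤ ENNReal.ofReal (R ^ (2 * s) * H z ^ (-(2 * s))) *
            (ENNReal.ofReal (CA * H z ^ t) * S z) := by
            gcongr
            exact (hq z hz).norm_le
        _ = ENNReal.ofReal (R ^ (2 * s) * CA * H z ^ (t - 2 * s)) * S z := by
            rw [← mul_assoc, ← ENNReal.ofReal_mul (by positivity)]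
            congr 2
            rw [show t - 2 * s = -(2 * s) + t by ring, Real.rpow_add hH0]
            ring
        _ ≤ _ := by
            gcongr
            exact hHP z _ (by positivity)
    refine (Finset.sum_le_sum hterm).trans ?_
    rw [Finset.sum_const, nsmul_eq_mul, ENNReal.ofReal_mul hR0.le, ← mul_assoc, ← mul_assoc]
    gcongr
    rw [← ENNReal.ofReal_natCast]
    exact ENNReal.ofReal_le_ofReal (hR.card_le z _ fun T hT => hK.mem_starFinset.1 hT)
  have hloc : ∑ T ∈ hK.cellFinset, ENNReal.ofReal (h T ^ (-(2 * s))) *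
      ∫⁻ x in simplex T, ‖(u - hK.nodal V) x‖ₑ ≤ ENNReal.ofReal CL * Z := by
    rw [hZ, Finset.mul_sum]
    refine Finset.sum_le_sum fun T hT => ?_
    rw [mul_left_comm]
    gcongr
    exact hR.lintegral_sub_clement_le hd hK hΩ hΛ hΩΛ hu.integrable hug q (hK.mem_cellFinset.1 hT)
  have he0 : u - hK.nodal V =ᵐ[volume.restrict Λᶜ] 0 := by
    have h1 : ∀ᵐ x, x ∉ closure Λ \ Λ := measure_eq_zero_iff_ae_notMem.1 (hK.volume_frontier hΛ)
    filter_upwards [hu0, ae_restrict_of_ae h1,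
      ae_restrict_mem hΛ.isOpen.measurableSet.compl] with x hx hx1 hx2
    have hx3 : x ∉ closure Λ := fun h => hx1 ⟨h, hx2⟩
    rw [Pi.sub_apply, hx, (hK.memVh_nodal V).zero_outside x hx3]
    simp
  have hem : AEStronglyMeasurable (u - hK.nodal V) :=
    hum.sub (hK.memVh_nodal V).measurable.aestronglyMeasurable
  refine (hsplit K hK hR _ hem he0).trans ?_
  have hnearsum : ∑ z ∈ hK.vertFinset,
        ∫⁻ p in {p : Rd d × Rd d | segment ℝ p.1 p.2 ⊆ openStar Λ K z},
          rieszKernel (d + 2 * s) (p.1 - p.2) *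
            ‖(u - hK.nodal V) p.1 - (u - hK.nodal V) p.2‖ₑ ≤
      ENNReal.ofReal CA * P * (∑ z ∈ hK.vertFinset, S z) + ENNReal.ofReal ((d + 1) * CN) * Z := by
    refine le_trans (Finset.sum_le_sum fun z hz => ?_)
      (Finset.sum_add_distrib.le.trans (add_le_add hnear1 hnear2))
    obtain ⟨T, hT, hzT⟩ := hK.mem_vertFinset.1 hz
    exact (hnear K hK hR u g hu.integrable hug q T hT z hzT).trans
      (add_le_add (hq z hz).near_le le_rfl)
  calc _ ≤ 2 * (ENNReal.ofReal CA * P * (∑ z ∈ hK.vertFinset, S z) +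
        ENNReal.ofReal ((d + 1) * CN) * Z) + ENNReal.ofReal CS * (ENNReal.ofReal CL * Z) := by
        gcongr
    _ = 2 * ENNReal.ofReal CA * P * (∑ z ∈ hK.vertFinset, S z) +
        (2 * ENNReal.ofReal ((d + 1) * CN) + ENNReal.ofReal CS * ENNReal.ofReal CL) * Z := by ring
    _ ≤ 2 * ENNReal.ofReal CA * P * ((d + 1) * N) +
        (2 * ENNReal.ofReal ((d + 1) * CN) + ENNReal.ofReal CS * ENNReal.ofReal CL) *
          (ENNReal.ofReal (R * (R ^ (2 * s) * CA)) * P * ((d + 1) * N)) := by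
        gcongr
        exact hZle.trans (by gcongr)
    _ = ENNReal.ofReal c₁ * P * ((d + 1) * N) := by
        have h2 : ENNReal.ofReal c₁ = 2 * ENNReal.ofReal CA + (2 * ENNReal.ofReal ((d + 1) * CN) +
            ENNReal.ofReal CS * ENNReal.ofReal CL) * ENNReal.ofReal (R * (R ^ (2 * s) * CA)) := by
          rw [hc₁, ENNReal.ofReal_add (by positivity) (by positivity),
            ENNReal.ofReal_mul (p := 2) (by norm_num),
            ENNReal.ofReal_mul (q := R * (R ^ (2 * s) * CA)) (by positivity),
            ENNReal.ofReal_add (by positivity) (by positivity),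
            ENNReal.ofReal_mul (p := 2) (by norm_num), ENNReal.ofReal_mul (p := CS) hCS.le,
            ENNReal.ofReal_ofNat]
        rw [h2]
        ring
    _ = _ := by
        have h3 : (d + 1 : ℝ≥0∞) = ENNReal.ofReal (d + 1) := by
          rw [ENNReal.ofReal_add (by positivity) zero_le_one, ENNReal.ofReal_natCast,
            ENNReal.ofReal_one]
        rw [h3, hP, ← mul_assoc, ← ENNReal.ofReal_mul (by positivity),
          ← ENNReal.ofReal_mul (by positivity), Real.mul_rpow zero_le_two hM0]
        congr 2
        ring

end ClementEnergy

/-! ### Galerkin orthogonality -/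

section Galerkin

variable {d : ℕ} {K : Geometry.SimplicialComplex ℝ (Rd d)} {Ω Λ : Set (Rd d)} {s t : ℝ}

theorem MemVh.sub {v w : Rd d → ℝ} (hv : MemVh Λ K v) (hw : MemVh Λ K w) : MemVh Λ K (v - w) where
  continuousOn := hv.continuousOn.sub hw.continuousOn
  affine T hT := by
    obtain ⟨a, ha⟩ := hv.affine T hT
    obtain ⟨b, hb⟩ := hw.affine T hT
    exact ⟨a - b, fun x hx => by
      rw [Pi.sub_apply, ha hx, hb hx, AffineMap.coe_sub, Pi.sub_apply]⟩
  zero_outside x hx := by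
    rw [Pi.sub_apply, hv.zero_outside x hx, hw.zero_outside x hx, sub_zero]

theorem MemVh.exists_abs_sub_le {v : Rd d → ℝ} (hv : MemVh Λ K v) (hK : IsMesh Ω Λ K) :
    ∃ L : ℝ, 0 ≤ L ∧ ∀ x y, segment ℝ x y ⊆ closure Λ → |v x - v y| ≤ L * ‖x - y‖ := by
  have h1 : ∀ T : Finset (Rd d), ∃ L : ℝ, 0 ≤ L ∧ (T ∈ cells K →
      ∀ a ∈ simplex T, ∀ b ∈ simplex T, |v a - v b| ≤ L * ‖a - b‖) := by
    intro T
    by_cases hT : T ∈ cells K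
    · obtain ⟨q, hq⟩ := hv.affine T hT
      refine ⟨‖q.linear.toContinuousLinearMap‖, norm_nonneg _, fun _ a ha b hb => ?_⟩
      have h2 := q.linear.toContinuousLinearMap.le_opNorm (a - b)
      have h3 := q.linearMap_vsub a b
      simp only [vsub_eq_sub] at h3
      rw [LinearMap.coe_toContinuousLinearMap', h3, Real.norm_eq_abs] at h2
      rwa [hq ha, hq hb]
    · exact ⟨0, le_rfl, fun h => absurd h hT⟩
  choose L hL0 hL using h1
  refine ⟨∑ T ∈ hK.cellFinset, L T, Finset.sum_nonneg fun T _ => hL0 T, fun x y hxy => ?_⟩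
  refine hK.abs_sub_le_of_segment (fun T hT _ a ha b hb => (hL T hT a ha b hb).trans ?_) hxy
  gcongr
  exact Finset.single_le_sum (f := L) (fun T _ => hL0 T) (hK.mem_cellFinset.2 hT)

/-- Discrete functions have finite energy. -/
theorem MemVh.energySeminorm_lt_top (hd : 1 ≤ d) (hs₀ : 0 < s) (hs₁ : s < 1 / 2)
    {v : Rd d → ℝ} (hv : MemVh Λ K v) (hK : IsMesh Ω Λ K)
    (hΩ : IsBoundedLipschitzDomain Ω) (hΛ : IsBoundedLipschitzDomain Λ) (hΩΛ : closure Ω ⊆ Λ) :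
    energySeminorm s Ω v < ∞ := by
  obtain ⟨L, hL0, hL⟩ := hv.exists_abs_sub_le hK
  obtain ⟨M, hM⟩ := hΛ.isBounded.isCompact_closure.exists_bound_of_continuousOn hv.continuousOn
  have hMall : ∀ x, ‖v x‖ₑ ≤ ENNReal.ofReal M := by
    intro x
    by_cases hx : x ∈ closure Λ
    · rw [← ofReal_norm]
      exact ENNReal.ofReal_le_ofReal (hM x hx)
    · rw [hv.zero_outside x hx, enorm_zero]
      exact zero_le
  obtain ⟨δ, hδ, hball⟩ := exists_pos_forall_dist_lt_mem hΩ.isBounded hΛ.isOpen hΩΛ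
  obtain ⟨C₁, hC₁, hnear⟩ := exists_lintegral_near_le hd hs₁
  obtain ⟨C₂, hC₂, hfar⟩ := exists_lintegral_far_le (d := d) hs₀
  have hρ : 0 < δ / 2 := by positivity
  have h1 := hnear (δ / 2) hρ Ω
  have h2 := (hfar (δ / 2) hρ (fun _ => 2 * ENNReal.ofReal M) aemeasurable_const Ω).1
  have hvol : volume Ω < ∞ := hΩ.isBounded.measure_lt_top
  set ψ : Rd d → ℝ≥0∞ :=
    (Metric.closedBall (0 : Rd d) (δ / 2)).indicator (rieszKernel (d + 2 * s - 1)) with hψ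
  set φ : Rd d → ℝ≥0∞ :=
    (Metric.ball (0 : Rd d) (δ / 2))ᶜ.indicator (rieszKernel (d + 2 * s)) with hφ
  have hψm : Measurable fun p : Rd d × Rd d => ψ (p.1 - p.2) :=
    ((measurable_rieszKernel _).indicator Metric.isClosed_closedBall.measurableSet).comp
      (measurable_fst.sub measurable_snd)
  -- Close to the diagonal the segment stays in `Λ` and `v` is Lipschitz along it, which is
  -- integrable for `s < 1/2`; away from it boundedness of `v` suffices. Extension by zero may
  -- create a jump across `∂Λ`, but that is at positive distance from `Ω`.
  have hpt : ∀ p ∈ Ω ×ˢ (univ : Set (Rd d)),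
      rieszKernel (d + 2 * s) (p.1 - p.2) * ‖v p.1 - v p.2‖ₑ ≤
        ENNReal.ofReal L * ψ (p.1 - p.2) + φ (p.1 - p.2) * (2 * ENNReal.ofReal M) := by
    intro p hp
    rcases lt_or_ge ‖p.1 - p.2‖ (δ / 2) with h | h
    · have hsub : segment ℝ p.1 p.2 ⊆ closure Λ := by
        refine (((convex_ball p.1 δ).segment_subset (Metric.mem_ball_self hδ) ?_).trans
          (hball p.1 (subset_closure hp.1))).trans subset_closure
        rw [Metric.mem_ball, dist_comm, dist_eq_norm]
        linarith
      have h3 : ‖v p.1 - v p.2‖ₑ ≤ ENNReal.ofReal L * ENNReal.ofReal ‖p.1 - p.2‖ := by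
        rw [← ENNReal.ofReal_mul hL0, ← ofReal_norm]
        exact ENNReal.ofReal_le_ofReal (hL p.1 p.2 hsub)
      refine le_add_right ?_
      rw [hψ, indicator_of_mem (by rw [mem_closedBall_zero_iff]; exact h.le)]
      calc _ ≤ rieszKernel (d + 2 * s) (p.1 - p.2) *
            (ENNReal.ofReal L * ENNReal.ofReal ‖p.1 - p.2‖) := by gcongr
        _ = ENNReal.ofReal L *
            (rieszKernel (d + 2 * s) (p.1 - p.2) * ENNReal.ofReal ‖p.1 - p.2‖) := by ring
        _ ≤ _ := by
            gcongr
            exact rieszKernel_mul_ofReal_norm_le _ _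
    · refine le_add_left ?_
      rw [hφ, indicator_of_mem (by rw [mem_compl_iff, mem_ball_zero_iff, not_lt]; exact h),
        two_mul (ENNReal.ofReal M)]
      gcongr
      exact enorm_sub_le.trans (add_le_add (hMall _) (hMall _))
  refine (energySeminorm_le s Ω v).trans_lt (ENNReal.mul_lt_top (by simp) ?_)
  refine (setLIntegral_mono' (hΩ.isOpen.measurableSet.prod MeasurableSet.univ) hpt).trans_lt ?_
  rw [lintegral_add_left (hψm.const_mul _), lintegral_const_mul _ hψm]
  refine ENNReal.add_lt_top.2 ⟨ENNReal.mul_lt_top ENNReal.ofReal_lt_top (h1.trans_lt ?_),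
    h2.trans_lt ?_⟩
  · exact ENNReal.mul_lt_top ENNReal.ofReal_lt_top hvol
  · rw [lintegral_const, Measure.restrict_apply_univ]
    exact ENNReal.mul_lt_top ENNReal.ofReal_lt_top (ENNReal.mul_lt_top
      (ENNReal.mul_lt_top (by simp) ENNReal.ofReal_lt_top) hvol)

theorem prod_subset_QSet (Ω : Set (Rd d)) : Ω ×ˢ Ω ⊆ QSet Ω := fun _ hp h => h.1 hp.1

/-- A discrete function that vanishes in `Λ \ Ω` is a test function of the continuous problem. -/
theorem MemVh.memV_zero (hd : 1 ≤ d) (hs₀ : 0 < s) (hs₁ : s < 1 / 2)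
    {v : Rd d → ℝ} (hv : MemVh Λ K v) (hv0 : ∀ x ∈ Λ \ Ω, v x = 0) (hK : IsMesh Ω Λ K)
    (hΩ : IsBoundedLipschitzDomain Ω) (hΛ : IsBoundedLipschitzDomain Λ) (hΩΛ : closure Ω ⊆ Λ) :
    MemV s Ω 0 v := by
  have hfin := hv.energySeminorm_lt_top hd hs₀ hs₁ hK hΩ hΛ hΩΛ
  -- Since `2 * s < 1` the clause on derivatives is vacuous, and the seminorm is the Gagliardo one,
  -- dominated by the energy because `Ω ×ˢ Ω` lies in `Q_Ω`.
  refine ⟨⟨?_, fun h => by linarith, ?_⟩, ?_, hfin⟩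
  · exact (hv.continuousOn.integrableOn_compact hΛ.isBounded.isCompact_closure).mono_set
      (subset_closure.trans (hΩΛ.trans subset_closure))
  · rw [sobolevSeminorm, if_pos (by linarith)]
    exact (lintegral_mono_set (prod_subset_QSet Ω)).trans_lt hfin
  · have h1 : ∀ᵐ x, x ∉ closure Λ \ Λ := measure_eq_zero_iff_ae_notMem.1 (hK.volume_frontier hΛ)
    filter_upwards [ae_restrict_of_ae h1, ae_restrict_mem hΩ.isOpen.measurableSet.compl]
      with x hx1 hx2
    by_cases hx : x ∈ Λ
    · exact hv0 x ⟨hx, hx2⟩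
    · exact hv.zero_outside x fun h => hx1 ⟨h, hx⟩

/-- `projValue` is defined by choice, so its vanishing for zero data needs well-posedness of the
projection; it follows from the nodal estimate with `u = g = 0` and `q = 0`. It identifies the
discrete test functions. -/
theorem IsMesh.exteriorClement_zero {R : ℝ} (hd : 1 ≤ d) (hK : IsMesh Ω Λ K)
    (hR : StarRegular Λ K R) (hΩ : IsBoundedLipschitzDomain Ω) (hΛ : IsBoundedLipschitzDomain Λ)
    (hΩΛ : closure Ω ⊆ Λ) (x : Rd d) : exteriorClement Ω K 0 x = 0 := by
  refine finsum_mem_eq_zero_of_forall_eq_zero fun z hz => ?_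
  obtain ⟨T, hT, hzT⟩ := hK.mem_vertices_iff.1 hz.1
  have h := hR.enorm_clementValue_sub_le hd hK hΩ hΛ hΩΛ (u := 0) (g := 0)
    integrableOn_zero Filter.EventuallyEq.rfl 0 hT hzT
  rw [clementValue, if_neg hz.2] at h
  simp only [Pi.zero_apply, AffineMap.coe_zero, sub_zero, enorm_zero, lintegral_zero, mul_zero,
    nonpos_iff_eq_zero, enorm_eq_zero] at h
  rw [h, zero_mul]

theorem Gs_eq_mul_GsTilde (d : ℕ) (s ρ : ℝ) : Gs d s ρ = ρ * GsTilde d s ρ := by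
  have h := intervalIntegral.mul_integral_comp_mul_left (a := 0) (b := 1) (c := ρ)
    (f := fun r : ℝ => (1 + r ^ 2) ^ (-((d : ℝ) + 1 + 2 * s) / 2))
  simp only [mul_pow, mul_zero, mul_one] at h
  rw [Gs, GsTilde, h]

theorem continuous_Gs_integrand (d : ℕ) (s : ℝ) :
    Continuous fun r : ℝ => (1 + r ^ 2) ^ (-((d : ℝ) + 1 + 2 * s) / 2) :=
  Continuous.rpow_const (by fun_prop) fun r => Or.inl (by positivity)

theorem continuous_Gs (d : ℕ) (s : ℝ) : Continuous (Gs d s) :=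
  intervalIntegral.continuous_primitive
    (fun a b => (continuous_Gs_integrand d s).intervalIntegrable a b) 0

/-- Since `d ≥ 1` the exponent is at most `-1`, and the integral is compared with that of the
arctangent. This boundedness makes the squared error linear in the interpolation error. -/
theorem abs_Gs_le (hd : 1 ≤ d) (hs₀ : 0 < s) (ρ : ℝ) : |Gs d s ρ| ≤ Real.pi / 2 := by
  have hd' : (1 : ℝ) ≤ d := by exact_mod_cast hd
  have hcont : Continuous fun r : ℝ => (1 + r ^ 2)⁻¹ :=
    Continuous.inv₀ (by fun_prop) fun r => by positivity
  have h1 : ‖Gs d s ρ‖ ≤ |∫ r in (0 : ℝ)..ρ, (1 + r ^ 2)⁻¹| := by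
    refine intervalIntegral.norm_integral_le_abs_of_norm_le (ae_of_all _ fun r => ?_)
      (hcont.intervalIntegrable _ _)
    have h2 : (1 : ℝ) ≤ 1 + r ^ 2 := by nlinarith [sq_nonneg r]
    rw [Real.norm_of_nonneg (by positivity), ← Real.rpow_neg_one]
    exact Real.rpow_le_rpow_of_exponent_le h2 (by linarith)
  rw [integral_inv_one_add_sq, Real.arctan_zero, sub_zero] at h1
  exact h1.trans (abs_le.2 ⟨(Real.neg_pi_div_two_lt_arctan ρ).le, (Real.arctan_lt_pi_div_two ρ).le⟩)

/-- The integrand of the form `a_u(u, v)`, written with `G_s` in place of `G̃_s`. -/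
theorem GsTilde_mul_eq (s : ℝ) (u v : Rd d → ℝ) (p : Rd d × Rd d) :
    GsTilde d s (diffQuot u p.1 p.2) *
      ((u p.1 - u p.2) * (v p.1 - v p.2) / ‖p.1 - p.2‖ ^ ((d : ℝ) + 1 + 2 * s)) =
    Gs d s (diffQuot u p.1 p.2) * ((v p.1 - v p.2) / ‖p.1 - p.2‖ ^ ((d : ℝ) + 2 * s)) := by
  rw [Gs_eq_mul_GsTilde]
  rcases eq_or_ne p.1 p.2 with h | h
  · simp [h]
  · have hn : 0 < ‖p.1 - p.2‖ := norm_pos_iff.2 (sub_ne_zero.2 h)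
    rw [diffQuot, show (d : ℝ) + 1 + 2 * s = (d + 2 * s) + 1 by ring, Real.rpow_add hn,
      Real.rpow_one]
    field_simp

theorem aestronglyMeasurable_Gs_diffQuot (s : ℝ) {u : Rd d → ℝ} (hu : AEStronglyMeasurable u) :
    AEStronglyMeasurable fun p : Rd d × Rd d => Gs d s (diffQuot u p.1 p.2) := by
  have h1 : AEMeasurable fun p : Rd d × Rd d => diffQuot u p.1 p.2 := by
    refine AEMeasurable.div ?_ (by fun_prop)
    exact (hu.aemeasurable.comp_quasiMeasurePreserving Measure.quasiMeasurePreserving_fst).sub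
      (hu.aemeasurable.comp_quasiMeasurePreserving Measure.quasiMeasurePreserving_snd)
  exact ((continuous_Gs d s).measurable.comp_aemeasurable h1).aestronglyMeasurable

theorem integrableOn_diff_div (s : ℝ) {v : Rd d → ℝ} (hv : AEStronglyMeasurable v)
    (hfin : energySeminorm s Ω v < ∞) :
    IntegrableOn (fun p : Rd d × Rd d => (v p.1 - v p.2) / ‖p.1 - p.2‖ ^ ((d : ℝ) + 2 * s))
      (QSet Ω) := by
  have hm : AEStronglyMeasurable fun p : Rd d × Rd d =>
      (v p.1 - v p.2) / ‖p.1 - p.2‖ ^ ((d : ℝ) + 2 * s) := by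
    refine AEMeasurable.aestronglyMeasurable (AEMeasurable.div ?_ (by fun_prop))
    exact (hv.aemeasurable.comp_quasiMeasurePreserving Measure.quasiMeasurePreserving_fst).sub
      (hv.aemeasurable.comp_quasiMeasurePreserving Measure.quasiMeasurePreserving_snd)
  refine ⟨hm.restrict, ?_⟩
  rw [hasFiniteIntegral_iff_norm]
  refine lt_of_eq_of_lt (lintegral_congr fun p => ?_) hfin
  rw [norm_div, Real.norm_eq_abs, Real.norm_of_nonneg (by positivity)]

theorem integral_abs_diff_div (s : ℝ) {v : Rd d → ℝ} (hv : AEStronglyMeasurable v)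
    (hfin : energySeminorm s Ω v < ∞) :
    ∫ p in QSet Ω, |(v p.1 - v p.2) / ‖p.1 - p.2‖ ^ ((d : ℝ) + 2 * s)| =
      (energySeminorm s Ω v).toReal := by
  have h := integral_norm_eq_lintegral_enorm (integrableOn_diff_div s hv hfin).aestronglyMeasurable
  simp only [Real.norm_eq_abs] at h
  rw [h]
  congr 1
  refine lintegral_congr fun p => ?_
  rw [← ofReal_norm, norm_div, Real.norm_eq_abs, Real.norm_of_nonneg (by positivity)]

theorem integrableOn_Gs_mul (hd : 1 ≤ d) (hs₀ : 0 < s) {u v : Rd d → ℝ}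
    (hu : AEStronglyMeasurable u) (hv : AEStronglyMeasurable v)
    (hfin : energySeminorm s Ω v < ∞) :
    IntegrableOn (fun p : Rd d × Rd d => Gs d s (diffQuot u p.1 p.2) *
      ((v p.1 - v p.2) / ‖p.1 - p.2‖ ^ ((d : ℝ) + 2 * s))) (QSet Ω) :=
  (integrableOn_diff_div s hv hfin).bdd_mul (c := Real.pi / 2)
    (aestronglyMeasurable_Gs_diffQuot s hu).restrict (ae_of_all _ fun _ => abs_Gs_le hd hs₀ _)

/-- The integrand is linear in `u - w` once the two factors `G_s` are fixed. On the diagonal all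
differences vanish, so the power with base zero plays no role. -/
theorem errorIntegrand_eq (s : ℝ) (u w e v : Rd d → ℝ) (h : u - w = e + v) (p : Rd d × Rd d) :
    errorIntegrand s u w p =
      (Gs d s (diffQuot u p.1 p.2) * ((e p.1 - e p.2) / ‖p.1 - p.2‖ ^ ((d : ℝ) + 2 * s)) -
      Gs d s (diffQuot w p.1 p.2) * ((e p.1 - e p.2) / ‖p.1 - p.2‖ ^ ((d : ℝ) + 2 * s))) +
      (Gs d s (diffQuot u p.1 p.2) * ((v p.1 - v p.2) / ‖p.1 - p.2‖ ^ ((d : ℝ) + 2 * s)) -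
      Gs d s (diffQuot w p.1 p.2) * ((v p.1 - v p.2) / ‖p.1 - p.2‖ ^ ((d : ℝ) + 2 * s))) := by
  have h1 : diffQuot (e + v) p.1 p.2 = (e p.1 + v p.1 - (e p.2 + v p.2)) / ‖p.1 - p.2‖ := rfl
  rw [errorIntegrand, h, h1]
  rcases eq_or_ne p.1 p.2 with hp | hp
  · simp [hp]
  · have hn : 0 < ‖p.1 - p.2‖ := norm_pos_iff.2 (sub_ne_zero.2 hp)
    rw [show (d : ℝ) + 2 * s = 1 + (d - 1 + 2 * s) by ring,
      Real.rpow_add hn 1, Real.rpow_one]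
    field_simp
    ring

/-- Galerkin orthogonality: the geometric error is bounded by the energy seminorm of `e`, whenever
`u - u_h = e + v` with a test function `v` of both problems. -/
theorem integral_errorIntegrand_le (hd : 1 ≤ d) (hs₀ : 0 < s) {u w e v : Rd d → ℝ}
    (h : u - w = e + v) (hu : AEStronglyMeasurable u) (hw : AEStronglyMeasurable w)
    (he : AEStronglyMeasurable e) (hv : AEStronglyMeasurable v)
    (hefin : energySeminorm s Ω e < ∞) (hvfin : energySeminorm s Ω v < ∞)
    (huv : aForm s Ω u u v = 0) (hwv : aForm s Ω w w v = 0) :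
    IntegrableOn (errorIntegrand s u w) (QSet Ω) ∧
      ∫ p in QSet Ω, errorIntegrand s u w p ≤ Real.pi * (energySeminorm s Ω e).toReal := by
  have hue := integrableOn_Gs_mul (Ω := Ω) hd hs₀ hu he hefin
  have hwe := integrableOn_Gs_mul (Ω := Ω) hd hs₀ hw he hefin
  have huv' := integrableOn_Gs_mul (Ω := Ω) hd hs₀ hu hv hvfin
  have hwv' := integrableOn_Gs_mul (Ω := Ω) hd hs₀ hw hv hvfin
  have heq : errorIntegrand s u w = _ := funext fun p => errorIntegrand_eq s u w e v h p
  have hesub : IntegrableOn (fun p : Rd d × Rd d =>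
      Gs d s (diffQuot u p.1 p.2) * ((e p.1 - e p.2) / ‖p.1 - p.2‖ ^ ((d : ℝ) + 2 * s)) -
      Gs d s (diffQuot w p.1 p.2) * ((e p.1 - e p.2) / ‖p.1 - p.2‖ ^ ((d : ℝ) + 2 * s)))
      (QSet Ω) := hue.sub hwe
  have hvsub : IntegrableOn (fun p : Rd d × Rd d =>
      Gs d s (diffQuot u p.1 p.2) * ((v p.1 - v p.2) / ‖p.1 - p.2‖ ^ ((d : ℝ) + 2 * s)) -
      Gs d s (diffQuot w p.1 p.2) * ((v p.1 - v p.2) / ‖p.1 - p.2‖ ^ ((d : ℝ) + 2 * s)))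
      (QSet Ω) := huv'.sub hwv'
  simp only [aForm, GsTilde_mul_eq] at huv hwv
  rw [heq]
  refine ⟨hesub.add hvsub, ?_⟩
  -- The contribution of `v` is the difference of the two forms tested with `v`, hence zero. In the
  -- rest the difference of the factors `G_s` is at most `π / 2 + π / 2`.
  rw [integral_add hesub hvsub, integral_sub huv' hwv', huv, hwv, sub_self,
    add_zero, ← integral_abs_diff_div s he hefin, ← integral_const_mul]
  refine integral_mono hesub ((integrableOn_diff_div s he hefin).abs.const_mul _)
    fun p => ?_
  have h1 := abs_Gs_le hd hs₀ (diffQuot u p.1 p.2)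
  have h2 := abs_Gs_le hd hs₀ (diffQuot w p.1 p.2)
  simp only
  rw [← sub_mul]
  refine (le_abs_self _).trans ?_
  rw [abs_mul]
  refine mul_le_mul_of_nonneg_right ((abs_sub _ _).trans ?_) (abs_nonneg _)
  linarith

end Galerkin

end

end NonlocalMinimalGraph

/-! ### The error estimate -/

open NonlocalMinimalGraph

theorem mainTheorem5 (d : ℕ) (hd : 1 ≤ d) (s t : ℝ) (hs₀ : 0 < s) (hs₁ : s < 1 / 2)
    (ht₀ : 2 * s < t) (ht₁ : t ≤ 2) (Ω Λ : Set (Rd d))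
    (hΩ : IsBoundedLipschitzDomain Ω) (hΛ : IsBoundedLipschitzDomain Λ) (hΩΛ : closure Ω ⊆ Λ)
    (σ : ℝ) :
    ∃ C : ℝ, 0 < C ∧
      ∀ K : Geometry.SimplicialComplex ℝ (Rd d), IsMesh Ω Λ K → IsShapeRegular σ K →
      ∀ g : Rd d → ℝ, MemLp g ∞ volume → HasCompactSupport g → tsupport g ⊆ Λ →
      ∀ u uh : Rd d → ℝ, IsWeakSolution s Ω g u → IsDiscreteSolution s Ω Λ K g uh →
        MemSobolev Λ t u →
        IntegrableOn (errorIntegrand s u uh) (QSet Ω) ∧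
        geomError s Ω u uh ≤
          C * meshSize K ^ (t / 2 - s) * (sobolevSeminorm Λ t u).toReal ^ (1 / 2 : ℝ) := by
  -- The bound `1 ≤ R` is read off from a mesh. Without an admissible mesh the claim is vacuous.
  by_cases hex : ∃ K : Geometry.SimplicialComplex ℝ (Rd d), IsMesh Ω Λ K ∧ IsShapeRegular σ K
  swap
  · exact ⟨1, one_pos, fun K hK hσ => absurd ⟨K, hK, hσ⟩ hex⟩
  obtain ⟨R, hreg⟩ := exists_starRegular (Ω := Ω) hd hΛ σ
  have hR1 : 1 ≤ R := by
    obtain ⟨K, hK, hσ⟩ := hex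
    exact (hreg K hK hσ).one_le
  obtain ⟨C, hC, hmain⟩ := exists_energySeminorm_sub_clement_le hd hs₀ hs₁ ht₀ ht₁ hR1 hΩ hΛ hΩΛ
  have hCds : 0 ≤ Cds d s := div_nonneg (by linarith) ENNReal.toReal_nonneg
  -- The summand `1` ensures positivity, as only `0 ≤ Cds d s` has been established.
  refine ⟨Real.sqrt (Cds d s * (Real.pi * C)) + 1, by positivity,
    fun K hK hσ g _ _ hgΛ u uh hu huh huS => ?_⟩
  have hR := hreg K hK hσ
  have hu0 : u =ᵐ[volume.restrict Λᶜ] 0 := by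
    have h1 : Λᶜ ⊆ Ωᶜ := compl_subset_compl.2 (subset_closure.trans hΩΛ)
    filter_upwards [ae_restrict_of_ae_restrict_of_subset h1 hu.1.eq_exterior,
      ae_restrict_mem hΛ.isOpen.measurableSet.compl] with x hx hxΛ
    rw [hx, image_eq_zero_of_notMem_tsupport fun h => hxΛ (hgΛ h), Pi.zero_apply]
  -- Measurability on the whole space: `u` is integrable on `Λ` and vanishes almost everywhere
  -- outside, because the support of `g` lies in `Λ`.
  have hum : AEStronglyMeasurable u := by
    have h1 : AEStronglyMeasurable (Λ.indicator u) :=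
      (aestronglyMeasurable_indicator_iff hΛ.isOpen.measurableSet).2
        huS.integrable.aestronglyMeasurable
    refine h1.congr ?_
    filter_upwards [(ae_restrict_iff' hΛ.isOpen.measurableSet.compl).1 hu0] with x hx
    by_cases hxΛ : x ∈ Λ
    · rw [indicator_of_mem hxΛ]
    · rw [indicator_of_notMem hxΛ, hx hxΛ, Pi.zero_apply]
  set I := hK.nodal (clementValue Ω K g u) with hI
  have hImem : MemVhg Ω Λ K g I := hK.memVhg_clement hΩ hΛ.isOpen hΩΛ g u
  have hv : MemVh Λ K (I - uh) := hImem.memVh.sub huh.1.memVh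
  have hv0 : ∀ x ∈ Λ \ Ω, (I - uh) x = 0 := fun x hx => by
    rw [Pi.sub_apply, hImem.eq_exterior hx, huh.1.eq_exterior hx, sub_self]
  have hvV := hv.memV_zero hd hs₀ hs₁ hv0 hK hΩ hΛ hΩΛ
  have hvh : MemVhg Ω Λ K 0 (I - uh) :=
    -- `I` and `uh` share the exterior values `Π_h^c g`, so their difference is admissible in both
    -- the discrete and the continuous equation.
    ⟨hv, fun x hx => by rw [hv0 x hx, hK.exteriorClement_zero hd hR hΩ hΛ hΩΛ]⟩
  have hbound := hmain K hK hR u g hum hu.1.eq_exterior hu0 huS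
  have hfin := hbound.trans_lt (ENNReal.mul_lt_top ENNReal.ofReal_lt_top huS.seminorm_lt_top)
  obtain ⟨hint, hle⟩ := integral_errorIntegrand_le (Ω := Ω) hd hs₀
    (show u - uh = (u - I) + (I - uh) by abel) hum huh.1.memVh.measurable.aestronglyMeasurable
    (hum.sub hImem.memVh.measurable.aestronglyMeasurable) hv.measurable.aestronglyMeasurable
    hfin hvV.seminorm_lt_top (hu.2 _ hvV) (huh.2 _ hvh)
  refine ⟨hint, ?_⟩
  have hM0 := IsMesh.meshSize_nonneg K
  set m := meshSize K
  set N := (sobolevSeminorm Λ t u).toReal with hN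
  have hN0 : 0 ≤ N := ENNReal.toReal_nonneg
  have hreal : (energySeminorm s Ω (u - I)).toReal ≤ C * m ^ (t - 2 * s) * N := by
    refine (ENNReal.toReal_mono (ENNReal.mul_ne_top ENNReal.ofReal_ne_top
      huS.seminorm_lt_top.ne) hbound).trans (le_of_eq ?_)
    rw [ENNReal.toReal_mul, ENNReal.toReal_ofReal (by positivity)]
  calc geomError s Ω u uh
      ≤ Real.sqrt (Cds d s * (Real.pi * C) * (m ^ (t - 2 * s) * N)) := by
        refine Real.sqrt_le_sqrt ?_
        calc _ ≤ Cds d s * (Real.pi * (C * m ^ (t - 2 * s) * N)) := by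
              gcongr
              exact hle.trans (by gcongr)
          _ = _ := by ring
    _ = Real.sqrt (Cds d s * (Real.pi * C)) * (m ^ (t / 2 - s) * N ^ (1 / 2 : ℝ)) := by
        rw [Real.sqrt_mul (by positivity), Real.sqrt_mul (x := m ^ _) (by positivity),
          Real.sqrt_eq_rpow (m ^ _),
          Real.sqrt_eq_rpow N, ← Real.rpow_mul hM0]
        congr 3
        ring
    _ ≤ (Real.sqrt (Cds d s * (Real.pi * C)) + 1) * (m ^ (t / 2 - s) * N ^ (1 / 2 : ℝ)) := by
        gcongr
        linarith
    _ = _ := by ring
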